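/- Let $\mathsf{RCA}_0^\omega$ be Kohlenbach's base theory of higher-order Reverse Mathematics, i.e. $\mathsf{E}\text{-}\mathsf{PRA}^\omega+\mathsf{QF}\text{-}\mathsf{AC}^{1,0}$: classical many-sorted logic in all finite types with equality of type $0$ as the only primitive relation (higher-type equality being pointwise), the axioms for zero and successor, the defining equations of the combinators $\Pi,\Sigma$ and of the recursor $R_0$ for primitive recursion of type $0$, extensionality in all finite types, induction for quantifier-free formulas, and the scheme $(\forall x^1)(\exists y^0)A(x,y)\to(\exists Y^{1\to 0})(\forall x^1)A(x,Y(x))$ for quantifier-free $A$. In this language, a real number is a sequence $(q_n)_{n\in\mathbb N}$ of (codes of) rationals with $|q_n-q_{n+i}|<2^{-n}$ for all $n,i\in\mathbb N$; reals $(q_n)$ and $(r_n)$ are equal if $|q_n-r_n|\le 2^{-n+1}$ for all $n$, and $(q_n)<(r_n)$ means $q_n+2^{-n+1}<r_n$ for some $n$; a function $f:\mathbb R\to\mathbb R$ is an object of type $1\to1$ that maps reals to reals and equal reals to equal reals. For $f:\mathbb R\to\mathbb R$ let $G(f)=\{(x,y)\in\mathbb R\times\mathbb R: f(x)=y\}$.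 We say that - $f$ is *continuous* if $(\forall x\in\mathbb R)(\forall k\in\mathbb N)(\exists N\in\mathbb N)(\forall y\in\mathbb R)\big(|x-y|<2^{-N}\to|f(x)-f(y)|<2^{-k}\big)$; - $f$ is *graph continuous* if there is a continuous $g:\mathbb R\to\mathbb R$ with $G(g)\subset\overline{G(f)}$, where $(x,y)\in\overline{G(f)}$ means that for every $k\in\mathbb N$ there is $(z,w)\in G(f)$ with $|x-z|<2^{-k}$ and $|y-w|<2^{-k}$; - $f$ is *quasi-continuous* if for all $x\in\mathbb R$ and all $k,N\in\mathbb N$ there is a non-empty open interval $(a,b)\subset B(x,2^{-N})$ such that $|f(x)-f(y)|<2^{-k}$ for all $y\in(a,b)$. **Theorem.** The theory $\mathsf{RCA}_0^\omega$ proves each of the following statements. 1. For every $f:\mathbb R\to\mathbb R$ there are graph continuous $g,h:\mathbb R\to\mathbb R$ such that $f=g+h$. 2. Every $f:\mathbb R\to\mathbb R$ is continuous on $\mathbb R$ if and only if it is both quasi-continuous and graph continuous on $\mathbb R$. -/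

import Mathlib

/-! Provability in Kohlenbach's base theory of higher-order Reverse Mathematics: the syntax of
arithmetic in all finite types, classical many-sorted natural deduction, the non-logical
postulates of the theory, and the coding of real analysis inside the language. -/

namespace RCAomega

/-! ### Finite types, terms and formulas -/

/-- The finite types: `nat` is type `0`, and `arr σ τ` is `σ → τ`. -/
inductive Ty : Type
  | nat : Ty
  | arr (σ τ : Ty) : Ty

local infixr:65 " ⇢ " => Ty.arr

/-- Type `1`, the type of number-theoretic functions. -/
abbrev Ty.one : Ty := Ty.nat ⇢ Ty.nat

/-- A context gives, for each finite type, the free variables of that type. -/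
abbrev Ctx : Type 1 := Ty → Type

/-- The context without variables. -/
def Ctx.empty : Ctx := fun _ => Empty

/-- The context `V` extended by one new variable, of type `σ`. -/
inductive Ctx.Ext (V : Ctx) (σ : Ty) : Ty → Type
  | new : Ctx.Ext V σ σ
  | old {τ : Ty} (x : V τ) : Ctx.Ext V σ τ

/-- The constants of the language: zero, successor, the combinators `Π` (here `K`) and
`Σ` (here `S`) for all types, and the recursor for primitive recursion of type `0`. -/
inductive Const : Ty → Type
  | zero : Const Ty.nat
  | succ : Const (Ty.nat ⇢ Ty.nat)
  | K (σ τ : Ty) : Const (σ ⇢ τ ⇢ σ)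
  | S (ρ σ τ : Ty) : Const ((ρ ⇢ σ ⇢ τ) ⇢ (ρ ⇢ σ) ⇢ ρ ⇢ τ)
  | recur : Const ((Ty.nat ⇢ Ty.nat ⇢ Ty.nat) ⇢ Ty.nat ⇢ Ty.nat ⇢ Ty.nat)

/-- Terms of each finite type with free variables in `V`. -/
inductive Term (V : Ctx) : Ty → Type
  | var {σ : Ty} (x : V σ) : Term V σ
  | const {σ : Ty} (c : Const σ) : Term V σ
  | app {σ τ : Ty} (s : Term V (σ ⇢ τ)) (t : Term V σ) : Term V τ

local infixl:90 " ⬝ " => Term.app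

/-- Formulas with free variables in `V`. The only prime formulas are equations of type `0`
and falsity; quantifiers range over any finite type. -/
inductive Formula : Ctx → Type 1
  | eq {V : Ctx} (s t : Term V Ty.nat) : Formula V
  | bot {V : Ctx} : Formula V
  | imp {V : Ctx} (φ ψ : Formula V) : Formula V
  | all {V : Ctx} (σ : Ty) (φ : Formula (Ctx.Ext V σ)) : Formula V

/-! ### Substitution -/

/-- Simultaneous substitution of terms for variables, in a term. -/
def Term.subst {V W : Ctx} (s : ∀ σ : Ty, V σ → Term W σ) : {τ : Ty} → Term V τ → Term W τ
  | _, .var x => s _ x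
  | _, .const c => .const c
  | _, .app t u => .app (t.subst s) (u.subst s)

/-- A term regarded as a term with one more available variable. -/
def Term.wk {V : Ctx} (σ : Ty) {τ : Ty} (t : Term V τ) : Term (Ctx.Ext V σ) τ :=
  t.subst fun _ x => .var (.old x)

instance {V : Ctx} {σ τ : Ty} : Coe (Term V τ) (Term (Ctx.Ext V σ) τ) := ⟨Term.wk σ⟩

/-- A substitution carried under a binder of type `σ`: it fixes the newest variable and is
`s` (weakened) on all others. -/
def liftSubst {V W : Ctx} (σ : Ty) (s : ∀ τ : Ty, V τ → Term W τ) :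
    ∀ τ : Ty, Ctx.Ext V σ τ → Term (Ctx.Ext W σ) τ
  | _, .new => .var .new
  | _, .old x => (s _ x).wk σ

/-- Simultaneous (capture-avoiding) substitution in a formula. -/
def Formula.subst : {V : Ctx} → Formula V → {W : Ctx} → (∀ σ : Ty, V σ → Term W σ) → Formula W
  | _, .eq t u, _, s => .eq (t.subst s) (u.subst s)
  | _, .bot, _, _ => .bot
  | _, .imp φ ψ, _, s => .imp (φ.subst s) (ψ.subst s)
  | _, .all σ φ, _, s => .all σ (φ.subst (liftSubst σ s))

/-- A formula regarded as a formula with one more available variable. -/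
def Formula.wk {V : Ctx} (σ : Ty) (φ : Formula V) : Formula (Ctx.Ext V σ) :=
  φ.subst fun _ x => .var (.old x)

/-- The substitution of `t` for the newest variable that agrees with `s` on all others. -/
def consSubst {V W : Ctx} {σ : Ty} (t : Term W σ) (s : ∀ τ : Ty, V τ → Term W τ) :
    ∀ τ : Ty, Ctx.Ext V σ τ → Term W τ
  | _, .new => t
  | _, .old x => s _ x

/-- `φ(t)`, where `t` replaces the newest variable. -/
def Formula.inst {V : Ctx} {σ : Ty} (φ : Formula (Ctx.Ext V σ)) (t : Term V σ) : Formula V :=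
  φ.subst (consSubst t fun _ x => .var x)

/-! ### Defined connectives (the logic is classical) and binders -/

namespace Formula

variable {V : Ctx}

def not (φ : Formula V) : Formula V := .imp φ .bot

def and (φ ψ : Formula V) : Formula V := .not (.imp φ (.not ψ))

def iff (φ ψ : Formula V) : Formula V := .and (.imp φ ψ) (.imp ψ φ)

def ex (σ : Ty) (φ : Formula (Ctx.Ext V σ)) : Formula V := .not (.all σ (.not φ))

/-- `∀ x : σ, b x`, with the bound variable passed to `b` by name. -/
def forAll (σ : Ty) (b : Term (Ctx.Ext V σ) σ → Formula (Ctx.Ext V σ)) : Formula V :=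
  .all σ (b (.var .new))

/-- `∃ x : σ, b x`, with the bound variable passed to `b` by name. -/
def exists_ (σ : Ty) (b : Term (Ctx.Ext V σ) σ → Formula (Ctx.Ext V σ)) : Formula V :=
  .ex σ (b (.var .new))

/-- Equality of type `σ`, which for higher types abbreviates pointwise equality. -/
def eqT : {V : Ctx} → (σ : Ty) → Term V σ → Term V σ → Formula V
  | _, .nat, s, t => .eq s t
  | _, .arr σ τ, s, t => .forAll σ fun x => eqT τ (s ⬝ x) (t ⬝ x)

/-- Formulas without quantifiers. -/
def QuantFree : {V : Ctx} → Formula V → Prop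
  | _, .eq _ _ => True
  | _, .bot => True
  | _, .imp φ ψ => φ.QuantFree ∧ ψ.QuantFree
  | _, .all _ _ => False

end Formula

local infixr:25 " ⟹ " => Formula.imp
local infixr:35 " ⋏ " => Formula.and
local infix:20 " ⟺ " => Formula.iff
local infix:50 " ≐ " => Formula.eq

/-! ### Lambda abstraction and basic terms -/

section Terms

variable {V : Ctx}

/-- Abstraction `λ x : σ, t`, where `x` is the newest variable, defined from the combinators. -/
def Term.lam {σ : Ty} : {τ : Ty} → Term (Ctx.Ext V σ) τ → Term V (σ ⇢ τ)
  | _, .var .new => .const (.S σ (σ ⇢ σ) σ) ⬝ .const (.K σ (σ ⇢ σ)) ⬝ .const (.K σ σ)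
  | τ, .var (.old x) => .const (.K τ σ) ⬝ .var x
  | τ, .const c => .const (.K τ σ) ⬝ .const c
  | τ, .app (σ := ρ) s t => .const (.S σ ρ τ) ⬝ s.lam ⬝ t.lam

/-- `λ x : σ, b x`, with the bound variable passed to `b` by name. -/
def fn (σ : Ty) {τ : Ty} (b : Term (Ctx.Ext V σ) σ → Term (Ctx.Ext V σ) τ) : Term V (σ ⇢ τ) :=
  Term.lam (b (.var .new))

def zero : Term V Ty.nat := .const .zero

def succ (t : Term V Ty.nat) : Term V Ty.nat := .const .succ ⬝ t

/-- `recur f m n`: the value at `n` of the function with value `m` at `0` and value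
`f n r` at `n + 1` if its value at `n` is `r`. -/
def recur (f : Term V (Ty.nat ⇢ Ty.nat ⇢ Ty.nat)) (m n : Term V Ty.nat) : Term V Ty.nat :=
  .const .recur ⬝ f ⬝ m ⬝ n

end Terms

/-! ### The theory and its proofs -/

/-- The non-logical postulates of Kohlenbach's `RCA₀^ω`, that is, of `E-PRA^ω` together with
`QF-AC^{1,0}`. They are given with free variables in an arbitrary context, hence with arbitrary
parameters in the two schemes. -/
inductive RCA0omega : {V : Ctx} → Formula V → Prop
  /-- Equality of type `0` is an equivalence relation. -/
  | eq_refl {V : Ctx} (t : Term V Ty.nat) : RCA0omega (t ≐ t)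
  | eq_symm {V : Ctx} (s t : Term V Ty.nat) : RCA0omega (s ≐ t ⟹ t ≐ s)
  | eq_trans {V : Ctx} (s t u : Term V Ty.nat) : RCA0omega (s ≐ t ⟹ t ≐ u ⟹ s ≐ u)
  /-- The successor function is injective and does not take the value zero. -/
  | succ_ne_zero {V : Ctx} (t : Term V Ty.nat) : RCA0omega (.not (succ t ≐ zero))
  | succ_inj {V : Ctx} (s t : Term V Ty.nat) : RCA0omega (succ s ≐ succ t ⟹ s ≐ t)
  /-- The defining equations of the combinators. -/
  | K_eq {V : Ctx} {σ τ : Ty} (s : Term V σ) (t : Term V τ) :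
      RCA0omega (.eqT σ (.const (.K σ τ) ⬝ s ⬝ t) s)
  | S_eq {V : Ctx} {ρ σ τ : Ty} (r : Term V (ρ ⇢ σ ⇢ τ)) (s : Term V (ρ ⇢ σ)) (t : Term V ρ) :
      RCA0omega (.eqT τ (.const (.S ρ σ τ) ⬝ r ⬝ s ⬝ t) (r ⬝ t ⬝ (s ⬝ t)))
  /-- The defining equations of the recursor. -/
  | recur_zero {V : Ctx} (f : Term V (Ty.nat ⇢ Ty.nat ⇢ Ty.nat)) (m : Term V Ty.nat) :
      RCA0omega (recur f m zero ≐ m)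
  | recur_succ {V : Ctx} (f : Term V (Ty.nat ⇢ Ty.nat ⇢ Ty.nat)) (m n : Term V Ty.nat) :
      RCA0omega (recur f m (succ n) ≐ f ⬝ n ⬝ recur f m n)
  /-- Extensionality in all finite types. -/
  | extensionality {V : Ctx} {σ τ : Ty} (f : Term V (σ ⇢ τ)) (s t : Term V σ) :
      RCA0omega (.eqT σ s t ⟹ .eqT τ (f ⬝ s) (f ⬝ t))
  /-- Quantifier-free induction: `A(0) → (∀ n, A(n) → A(n + 1)) → ∀ n, A(n)`. -/
  | induction {V : Ctx} (A : Formula (Ctx.Ext V Ty.nat)) (hA : A.QuantFree) :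
      RCA0omega (A.inst zero ⟹
        .all Ty.nat (A ⟹ A.subst (consSubst (succ (.var .new)) fun _ x => .var (.old x))) ⟹
        .all Ty.nat A)
  /-- Quantifier-free choice: `(∀ x¹ ∃ y⁰ A(x, y)) → ∃ Y ∀ x¹ A(x, Y x)`. -/
  | choice {V : Ctx} (A : Formula (Ctx.Ext (Ctx.Ext V Ty.one) Ty.nat)) (hA : A.QuantFree) :
      RCA0omega (.all Ty.one (.ex Ty.nat A) ⟹
        .ex (Ty.one ⇢ Ty.nat) (.all Ty.one (A.subst
          (consSubst (.var (.old .new) ⬝ .var .new)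
            (liftSubst Ty.one fun _ x => .var (.old x))))))

/-- Natural deduction for classical many-sorted predicate logic, over the postulates `Γ`.
`Proves Γ H φ` says that `φ` is derivable from the hypotheses `H`. -/
inductive Proves (Γ : (V : Ctx) → Formula V → Prop) :
    {V : Ctx} → Set (Formula V) → Formula V → Prop
  | postulate {V : Ctx} {H : Set (Formula V)} {φ : Formula V} (h : Γ V φ) : Proves Γ H φ
  | hyp {V : Ctx} {H : Set (Formula V)} {φ : Formula V} (h : φ ∈ H) : Proves Γ H φ
  | imp_intro {V : Ctx} {H : Set (Formula V)} {φ ψ : Formula V}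
      (h : Proves Γ (insert φ H) ψ) : Proves Γ H (φ ⟹ ψ)
  | imp_elim {V : Ctx} {H : Set (Formula V)} {φ ψ : Formula V}
      (h₁ : Proves Γ H (φ ⟹ ψ)) (h₂ : Proves Γ H φ) : Proves Γ H ψ
  | by_contra {V : Ctx} {H : Set (Formula V)} {φ : Formula V}
      (h : Proves Γ (insert (.not φ) H) .bot) : Proves Γ H φ
  | all_intro {V : Ctx} {H : Set (Formula V)} {σ : Ty} {φ : Formula (Ctx.Ext V σ)}
      (h : Proves Γ (Formula.wk σ '' H) φ) : Proves Γ H (.all σ φ)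
  | all_elim {V : Ctx} {H : Set (Formula V)} {σ : Ty} {φ : Formula (Ctx.Ext V σ)}
      (t : Term V σ) (h : Proves Γ H (.all σ φ)) : Proves Γ H (φ.inst t)

/-- `RCA₀^ω ⊢ φ`, for a sentence `φ`. -/
def Provable (φ : Formula Ctx.empty) : Prop := Proves (fun _ ψ => RCA0omega ψ) ∅ φ

/-! ### Arithmetic inside the language -/

section Arithmetic

variable {V : Ctx}

def plusC : Term V (Ty.nat ⇢ Ty.nat ⇢ Ty.nat) :=
  fn .nat fun s => fn .nat fun t =>
    recur (fn .nat fun _ => fn .nat fun r => succ r) s t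

def plus (s t : Term V Ty.nat) : Term V Ty.nat := plusC ⬝ s ⬝ t

def timesC : Term V (Ty.nat ⇢ Ty.nat ⇢ Ty.nat) :=
  fn .nat fun s => fn .nat fun t =>
    recur (fn .nat fun _ => fn .nat fun r => plus r s) zero t

def times (s t : Term V Ty.nat) : Term V Ty.nat := timesC ⬝ s ⬝ t

def predC : Term V (Ty.nat ⇢ Ty.nat) :=
  fn .nat fun t => recur (fn .nat fun n => fn .nat fun _ => n) zero t

def pred (t : Term V Ty.nat) : Term V Ty.nat := predC ⬝ t

def monusC : Term V (Ty.nat ⇢ Ty.nat ⇢ Ty.nat) :=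
  fn .nat fun s => fn .nat fun t =>
    recur (fn .nat fun _ => fn .nat fun r => pred r) s t

/-- Truncated subtraction. -/
def monus (s t : Term V Ty.nat) : Term V Ty.nat := monusC ⬝ s ⬝ t

def le (s t : Term V Ty.nat) : Formula V := monus s t ≐ zero

def lt (s t : Term V Ty.nat) : Formula V := le (succ s) t

def pow2C : Term V (Ty.nat ⇢ Ty.nat) :=
  fn .nat fun t => recur (fn .nat fun _ => fn .nat fun r => plus r r) (succ zero) t

/-- `2 ^ t`. -/
def pow2 (t : Term V Ty.nat) : Term V Ty.nat := pow2C ⬝ t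

def triC : Term V (Ty.nat ⇢ Ty.nat) :=
  fn .nat fun t => recur (fn .nat fun n => fn .nat fun r => plus r (succ n)) zero t

/-- The triangular number `t (t + 1) / 2`. -/
def tri (t : Term V Ty.nat) : Term V Ty.nat := triC ⬝ t

def triRootC : Term V (Ty.nat ⇢ Ty.nat) :=
  fn .nat fun t =>
    recur (fn .nat fun n => fn .nat fun w =>
      plus w (monus (succ zero) (monus (tri (succ w)) (succ n)))) zero t

/-- The largest `w` such that `w (w + 1) / 2 ≤ t`. -/
def triRoot (t : Term V Ty.nat) : Term V Ty.nat := triRootC ⬝ t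

def pairC : Term V (Ty.nat ⇢ Ty.nat ⇢ Ty.nat) :=
  fn .nat fun s => fn .nat fun t => plus (tri (plus s t)) t

/-- The Cantor pairing function. -/
def pair (s t : Term V Ty.nat) : Term V Ty.nat := pairC ⬝ s ⬝ t

def sndC : Term V (Ty.nat ⇢ Ty.nat) := fn .nat fun t => monus t (tri (triRoot t))

def snd (t : Term V Ty.nat) : Term V Ty.nat := sndC ⬝ t

def fstC : Term V (Ty.nat ⇢ Ty.nat) := fn .nat fun t => monus (triRoot t) (snd t)

def fst (t : Term V Ty.nat) : Term V Ty.nat := fstC ⬝ t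

/-! Rational numbers: the code `pair (pair a b) d` stands for `(a - b) / (d + 1)`. -/

def qmk (a b d : Term V Ty.nat) : Term V Ty.nat := pair (pair a b) d

def qpos (p : Term V Ty.nat) : Term V Ty.nat := fst (fst p)

def qneg (p : Term V Ty.nat) : Term V Ty.nat := snd (fst p)

def qden (p : Term V Ty.nat) : Term V Ty.nat := succ (snd p)

def qaddC : Term V (Ty.nat ⇢ Ty.nat ⇢ Ty.nat) :=
  fn .nat fun p => fn .nat fun q =>
    qmk (plus (times (qpos p) (qden q)) (times (qpos q) (qden p)))
      (plus (times (qneg p) (qden q)) (times (qneg q) (qden p)))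
      (pred (times (qden p) (qden q)))

/-- `p + q` on codes of rationals. -/
def qadd (p q : Term V Ty.nat) : Term V Ty.nat := qaddC ⬝ p ⬝ q

def qoppC : Term V (Ty.nat ⇢ Ty.nat) := fn .nat fun p => qmk (qneg p) (qpos p) (snd p)

/-- `- p` on codes of rationals. -/
def qopp (p : Term V Ty.nat) : Term V Ty.nat := qoppC ⬝ p

def qabsC : Term V (Ty.nat ⇢ Ty.nat) :=
  fn .nat fun p =>
    qmk (plus (monus (qpos p) (qneg p)) (monus (qneg p) (qpos p))) zero (snd p)

/-- `|p|` on codes of rationals. -/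
def qabs (p : Term V Ty.nat) : Term V Ty.nat := qabsC ⬝ p

def qhalfC : Term V (Ty.nat ⇢ Ty.nat) := fn .nat fun n => qmk (succ zero) zero (pred (pow2 n))

/-- (A code of) the rational `2 ^ (- n)`. -/
def qhalf (n : Term V Ty.nat) : Term V Ty.nat := qhalfC ⬝ n

/-- `p ≤ q` for (codes of) rationals. -/
def qle (p q : Term V Ty.nat) : Formula V :=
  le (plus (times (qpos p) (qden q)) (times (qneg q) (qden p)))
    (plus (times (qpos q) (qden p)) (times (qneg p) (qden q)))

/-- `p < q` for (codes of) rationals. -/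
def qlt (p q : Term V Ty.nat) : Formula V :=
  lt (plus (times (qpos p) (qden q)) (times (qneg q) (qden p)))
    (plus (times (qpos q) (qden p)) (times (qneg p) (qden q)))

end Arithmetic

/-! ### Real numbers and functions on the reals inside the language -/

section Reals

variable {V : Ctx}

/-- The `n`-th entry of the sequence `x`. -/
def seq (x : Term V Ty.one) (n : Term V Ty.nat) : Term V Ty.nat := x ⬝ n

/-- The value `f x` of an object `f` of type `1 → 1`. -/
def value (f : Term V (Ty.one ⇢ Ty.one)) (x : Term V Ty.one) : Term V Ty.one := f ⬝ x

/-- `x ∈ ℝ`: the object `x` of type `1` is a fast-converging Cauchy sequence of rationals,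
i.e. `|x n - x (n + i)| < 2 ^ (- n)` for all `n` and `i`. -/
def isReal (x : Term V Ty.one) : Formula V :=
  .forAll .nat fun n => .forAll .nat fun i =>
    qlt (qabs (qadd (seq x n) (qopp (seq x (plus n i))))) (qhalf n)

/-- `x = y` in `ℝ`: `|x n - y n| ≤ 2 ^ (- n + 1)` for all `n`. -/
def eqR (x y : Term V Ty.one) : Formula V :=
  .forAll .nat fun n =>
    qle (qabs (qadd (seq x n) (qopp (seq y n)))) (qadd (qhalf n) (qhalf n))

/-- `x < y` in `ℝ`: `x n + 2 ^ (- n + 1) < y n` for some `n`. -/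
def ltR (x y : Term V Ty.one) : Formula V :=
  .exists_ .nat fun n => qlt (qadd (seq x n) (qadd (qhalf n) (qhalf n))) (seq y n)

def addR (x y : Term V Ty.one) : Term V Ty.one :=
  fn .nat fun n => qadd (seq x (succ n)) (seq y (succ n))

def oppR (x : Term V Ty.one) : Term V Ty.one := fn .nat fun n => qopp (seq x n)

def absR (x : Term V Ty.one) : Term V Ty.one := fn .nat fun n => qabs (seq x n)

/-- A rational number as a real number. -/
def ofRat (q : Term V Ty.nat) : Term V Ty.one := fn .nat fun _ => q

/-- `|x - y| < 2 ^ (- k)`, i.e. `y ∈ B(x, 2 ^ (- k))`. -/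
def near (x y : Term V Ty.one) (k : Term V Ty.nat) : Formula V :=
  ltR (absR (addR x (oppR y))) (ofRat (qhalf k))

/-- `∀ x ∈ ℝ, b x`. -/
def forAllR (b : Term (Ctx.Ext V Ty.one) Ty.one → Formula (Ctx.Ext V Ty.one)) : Formula V :=
  .forAll .one fun x => isReal x ⟹ b x

/-- `∃ x ∈ ℝ, b x`. -/
def existsR (b : Term (Ctx.Ext V Ty.one) Ty.one → Formula (Ctx.Ext V Ty.one)) : Formula V :=
  .exists_ .one fun x => isReal x ⋏ b x

/-- `f : ℝ → ℝ`: the object `f` of type `1 → 1` maps reals to reals and equal reals to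
equal reals. -/
def isFun (f : Term V (Ty.one ⇢ Ty.one)) : Formula V :=
  (forAllR fun x => isReal (value f x)) ⋏
    forAllR fun x => forAllR fun y => eqR x y ⟹ eqR (value f x) (value f y)

/-- `∀ f : ℝ → ℝ, b f`. -/
def forAllFun (b : Term (Ctx.Ext V (Ty.one ⇢ Ty.one)) (Ty.one ⇢ Ty.one) →
    Formula (Ctx.Ext V (Ty.one ⇢ Ty.one))) : Formula V :=
  .forAll (Ty.one ⇢ Ty.one) fun f => isFun f ⟹ b f

/-- `∃ f : ℝ → ℝ, b f`. -/
def existsFun (b : Term (Ctx.Ext V (Ty.one ⇢ Ty.one)) (Ty.one ⇢ Ty.one) →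
    Formula (Ctx.Ext V (Ty.one ⇢ Ty.one))) : Formula V :=
  .exists_ (Ty.one ⇢ Ty.one) fun f => isFun f ⋏ b f

/-- `f` is continuous on `ℝ`. -/
def continuous (f : Term V (Ty.one ⇢ Ty.one)) : Formula V :=
  forAllR fun x => .forAll .nat fun k => .exists_ .nat fun N => forAllR fun y =>
    near x y N ⟹ near (value f x) (value f y) k

/-- `(x, y) ∈ G(f)`. -/
def inGraph (f : Term V (Ty.one ⇢ Ty.one)) (x y : Term V Ty.one) : Formula V :=
  eqR (value f x) y

/-- `(x, y)` belongs to the closure of `G(f)` in the plane. -/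
def inClosureGraph (f : Term V (Ty.one ⇢ Ty.one)) (x y : Term V Ty.one) : Formula V :=
  .forAll .nat fun k => existsR fun z => existsR fun w =>
    inGraph f z w ⋏ near x z k ⋏ near y w k

/-- `f` is graph continuous: the closure of `G(f)` contains `G(g)` for a continuous
`g : ℝ → ℝ`. -/
def graphContinuous (f : Term V (Ty.one ⇢ Ty.one)) : Formula V :=
  existsFun fun g => continuous g ⋏
    forAllR fun x => forAllR fun y => inGraph g x y ⟹ inClosureGraph f x y

/-- `x` belongs to the open interval `(a, b)`. -/
def inInterval (a b x : Term V Ty.one) : Formula V := ltR a x ⋏ ltR x b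

/-- `f` is quasi-continuous: every neighbourhood `B(x, 2 ^ (- N))` of any `x` includes a
non-empty open interval `(a, b)` with `|f x - f y| < 2 ^ (- k)` for all `y ∈ (a, b)`. -/
def quasiContinuous (f : Term V (Ty.one ⇢ Ty.one)) : Formula V :=
  forAllR fun x => .forAll .nat fun k => .forAll .nat fun N =>
    existsR fun a => existsR fun b => ltR a b ⋏
      (forAllR fun y => inInterval a b y ⟹ near x y N) ⋏
      (forAllR fun y => inInterval a b y ⟹ near (value f x) (value f y) k)

/-- `f = g + h` on `ℝ`. -/
def isSum (f g h : Term V (Ty.one ⇢ Ty.one)) : Formula V :=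
  forAllR fun x => eqR (value f x) (addR (value g x) (value h x))

end Reals

/-- For every `f : ℝ → ℝ`, there are graph continuous `g, h : ℝ → ℝ` with `f = g + h`. -/
def sumOfGraphContinuous : Formula Ctx.empty :=
  forAllFun fun f => existsFun fun g => existsFun fun h =>
    graphContinuous g ⋏ graphContinuous h ⋏ isSum f g h

/-- For every `f : ℝ → ℝ`, `f` is continuous if and only if it is quasi-continuous and graph
continuous. -/
def decompositionOfContinuity : Formula Ctx.empty :=
  forAllFun fun f => continuous f ⟺ (quasiContinuous f ⋏ graphContinuous f)

end RCAomega

/-! Provability is reduced to truth. A Henkin construction (`exists_henkin`, `sat_termModel`) shows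
that a sentence true in every extensional model of `RCA0omega` is derivable (`provable_of_sat`), so
everything else takes place inside one arbitrary model `M`. The numbers of `M` may be nonstandard
and satisfy induction only for quantifier-free predicates. This suffices to make them an ordered
semiring, whose field of fractions is the field of rationals of `M`. The coded reals are then
compared through their approximations at all sufficiently large indices.

Decomposition of continuity. A continuous function is its own witness for graph continuity, and its
continuity balls contain the intervals needed for quasi-continuity. Conversely, let `g` be
continuous with graph in the closure of the graph of `f`, and suppose that `f x` and `g x` differ.
Quasi-continuity gives an interval close to `x` on which `f` stays near `f x`, while `g` stays near
`g x` there. For `p` in that interval, the point of the plane over `p` on the graph of `g` is a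
limit of points of the graph of `f` over the interval, so `g x` and `f x` are arbitrarily close, a
contradiction. Hence `f` equals `g` (`eqR_of_quasiCts`).

Sums. The argument splits on whether `M` contains Kleene's quantifier `∃²`. If not, every function
on the reals is continuous (`cts_of_not_hasE2`, by Grilliot's trick), and `f = f + 0` is the
decomposition. If it does, membership in the set of fractions with odd denominator is decidable
(`exists_decision`). This set and its complement are dense. Let `g` be `0` on the set and `f` off
it, and let `h` be `f` on the set and `0` off it: then `f = g + h`, and each summand agrees with the
continuous function `0` on a dense set (`exists_sum`). -/

namespace RCAomega

local infixr:65 " ⇢ " => Ty.arr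
local infixl:90 " ⬝ " => Term.app
local infixr:25 " ⟹ " => Formula.imp
local infixr:35 " ⋏ " => Formula.and
local infix:20 " ⟺ " => Formula.iff
local infix:50 " ≐ " => Formula.eq

/-! ### Substitution calculus -/

section Substitution

variable {V W U : Ctx}

/-- The identity substitution. -/
def idSubst (V : Ctx) : ∀ σ : Ty, V σ → Term V σ := fun _ x => .var x

theorem Term.subst_id {τ : Ty} (t : Term V τ) : t.subst (idSubst V) = t := by
  induction t with
  | var x => rfl
  | const c => rfl
  | app s t hs ht => simp only [Term.subst, hs, ht]

theorem Term.subst_subst {τ : Ty} (t : Term V τ) (s : ∀ σ, V σ → Term W σ)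
    (s' : ∀ σ, W σ → Term U σ) :
    (t.subst s).subst s' = t.subst fun σ x => (s σ x).subst s' := by
  induction t with
  | var x => rfl
  | const c => rfl
  | app a b ha hb => simp only [Term.subst, ha, hb]

theorem liftSubst_id (σ : Ty) : liftSubst σ (idSubst V) = idSubst (Ctx.Ext V σ) := by
  funext τ x
  cases x <;> rfl

theorem Term.subst_wk {σ τ : Ty} (t : Term V τ) (s : ∀ ρ, Ctx.Ext V σ ρ → Term W ρ) :
    (t.wk σ).subst s = t.subst fun ρ x => s ρ (.old x) := by
  simp only [Term.wk, Term.subst_subst, Term.subst]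

theorem Term.wk_subst {σ τ : Ty} (t : Term V τ) (s : ∀ ρ, V ρ → Term W ρ) :
    (t.subst s).wk σ = t.subst fun ρ x => (s ρ x).wk σ := by
  simp only [Term.wk, Term.subst_subst]

theorem liftSubst_comp (σ : Ty) (s : ∀ σ, V σ → Term W σ) (s' : ∀ σ, W σ → Term U σ) :
    (fun τ x => (liftSubst σ s τ x).subst (liftSubst σ s')) =
      liftSubst σ fun τ x => (s τ x).subst s' := by
  funext τ x
  cases x with
  | new => rfl
  | old x => simp only [liftSubst, Term.subst_wk, Term.wk_subst]

theorem Formula.subst_id (φ : Formula V) : φ.subst (idSubst V) = φ := by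
  induction φ with
  | eq s t => simp only [Formula.subst, Term.subst_id]
  | bot => rfl
  | imp φ ψ h₁ h₂ => simp only [Formula.subst, h₁, h₂]
  | all σ φ h => simp only [Formula.subst, liftSubst_id, h]

theorem Formula.subst_subst (φ : Formula V) : ∀ {W U : Ctx} (s : ∀ σ, V σ → Term W σ)
    (s' : ∀ σ, W σ → Term U σ),
    (φ.subst s).subst s' = φ.subst fun σ x => (s σ x).subst s' := by
  induction φ with
  | eq s t => intros; simp only [Formula.subst, Term.subst_subst]
  | bot => intros; rfl
  | imp φ ψ h₁ h₂ => intros; simp only [Formula.subst, h₁, h₂]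
  | all σ φ h => intros; simp only [Formula.subst, h, liftSubst_comp]

theorem Formula.subst_wk {σ : Ty} (φ : Formula V) (s : ∀ ρ, Ctx.Ext V σ ρ → Term W ρ) :
    (φ.wk σ).subst s = φ.subst fun ρ x => s ρ (.old x) := by
  simp only [Formula.wk, Formula.subst_subst, Term.subst]

theorem Formula.wk_subst {σ : Ty} (φ : Formula V) (s : ∀ ρ, V ρ → Term W ρ) :
    (φ.subst s).wk σ = φ.subst fun ρ x => (s ρ x).wk σ := by
  simp only [Formula.wk, Formula.subst_subst, Term.wk]

theorem Formula.wk_subst_lift {σ : Ty} (φ : Formula V) (s : ∀ ρ, V ρ → Term W ρ) :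
    (φ.wk σ).subst (liftSubst σ s) = (φ.subst s).wk σ := by
  rw [Formula.subst_wk, Formula.wk_subst]
  rfl

theorem consSubst_comp {σ : Ty} (t : Term W σ) (s : ∀ σ, V σ → Term W σ)
    (s' : ∀ σ, W σ → Term U σ) :
    (fun τ x => (consSubst t s τ x).subst s') =
      consSubst (t.subst s') fun τ x => (s τ x).subst s' := by
  funext τ x
  cases x <;> rfl

theorem liftSubst_consSubst {σ : Ty} (t : Term U σ) (s : ∀ σ, V σ → Term W σ)
    (s' : ∀ σ, W σ → Term U σ) :
    (fun τ x => (liftSubst σ s τ x).subst (consSubst t s')) =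
      consSubst t fun τ x => (s τ x).subst s' := by
  funext τ x
  cases x with
  | new => rfl
  | old x => simp only [liftSubst, Term.subst_wk, consSubst]

theorem Formula.inst_subst {σ : Ty} (φ : Formula (Ctx.Ext V σ)) (t : Term V σ)
    (s : ∀ ρ, V ρ → Term W ρ) :
    (φ.inst t).subst s = (φ.subst (liftSubst σ s)).inst (t.subst s) := by
  simp only [Formula.inst, Formula.subst_subst, consSubst_comp, liftSubst_consSubst, Term.subst]
  congr 2
  funext τ x
  exact (Term.subst_id _).symm

theorem Formula.subst_lift_inst {σ : Ty} (φ : Formula (Ctx.Ext V σ)) (t : Term W σ)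
    (s : ∀ ρ, V ρ → Term W ρ) :
    (φ.subst (liftSubst σ s)).inst t = φ.subst (consSubst t s) := by
  simp only [Formula.inst, Formula.subst_subst, liftSubst_consSubst]
  congr 2
  funext τ x
  exact Term.subst_id _

theorem Formula.eqT_subst {V W : Ctx} (σ : Ty) (t u : Term V σ) (s : ∀ ρ, V ρ → Term W ρ) :
    (Formula.eqT σ t u).subst s = Formula.eqT σ (t.subst s) (u.subst s) := by
  induction σ generalizing V W with
  | nat => rfl
  | arr σ τ _ h =>
    simp only [Formula.eqT, Formula.forAll, Formula.subst, h, Term.subst, Term.subst_wk,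
      Term.wk_subst, liftSubst]

theorem Formula.QuantFree.subst {φ : Formula V} (h : φ.QuantFree) (s : ∀ ρ, V ρ → Term W ρ) :
    (φ.subst s).QuantFree := by
  induction φ generalizing W with
  | eq s t => trivial
  | bot => trivial
  | imp φ ψ h₁ h₂ => exact ⟨h₁ h.1 s, h₂ h.2 s⟩
  | all σ φ _ => exact h.elim

end Substitution

/-- The postulates are stated with arbitrary terms and parameters, so an instance substitutes to an
instance. This is what lets derivations be moved between contexts. -/
theorem RCA0omega.subst {V W : Ctx} {φ : Formula V} (h : RCA0omega φ)
    (s : ∀ ρ, V ρ → Term W ρ) : RCA0omega (φ.subst s) := by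
  cases h with
  | eq_refl t => exact .eq_refl _
  | eq_symm => exact .eq_symm _ _
  | eq_trans => exact .eq_trans _ _ _
  | succ_ne_zero => exact .succ_ne_zero _
  | succ_inj => exact .succ_inj _ _
  | K_eq => rw [Formula.eqT_subst]; exact .K_eq _ _
  | S_eq => rw [Formula.eqT_subst]; exact .S_eq _ _ _
  | recur_zero => exact .recur_zero _ _
  | recur_succ => exact .recur_succ _ _ _
  | extensionality =>
    simp only [Formula.subst, Formula.eqT_subst]; exact .extensionality _ _ _
  | induction A hA =>
    have := RCA0omega.induction (A.subst (liftSubst .nat s)) (hA.subst _)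
    convert this using 1
    simp only [Formula.subst, Formula.inst_subst]
    congr 3
    simp only [Formula.subst_subst]
    congr 1
    congr 1
    funext τ x
    cases x with
    | new => rfl
    | old x =>
      simp only [consSubst, liftSubst, Term.wk, Term.subst_subst, Term.subst]
  | choice A hA =>
    have := RCA0omega.choice (A.subst (liftSubst .nat (liftSubst .one s))) (hA.subst _)
    convert this using 1
    simp only [Formula.subst, Formula.ex, Formula.not, Formula.subst_subst]
    congr 6
    funext τ x
    cases x with
    | new => rfl
    | old x =>
      cases x with
      | new => rfl
      | old x =>
        simp only [consSubst, liftSubst, Term.wk, Term.subst_subst, Term.subst]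

/-- Derivability in `RCA₀^ω` from hypotheses. -/
abbrev Derives {V : Ctx} (H : Set (Formula V)) (φ : Formula V) : Prop :=
  Proves (fun _ ψ => RCA0omega ψ) H φ

namespace Derives

variable {V W : Ctx} {H H' : Set (Formula V)} {φ ψ : Formula V}

theorem mono (h : Derives H φ) (hH : H ⊆ H') : Derives H' φ := by
  induction h with
  | postulate h => exact .postulate h
  | hyp h => exact .hyp (hH h)
  | imp_intro _ ih => exact .imp_intro (ih (Set.insert_subset_insert hH))
  | imp_elim _ _ h₁ h₂ => exact .imp_elim (h₁ hH) (h₂ hH)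
  | by_contra _ ih => exact .by_contra (ih (Set.insert_subset_insert hH))
  | all_intro _ ih => exact .all_intro (ih (Set.image_mono hH))
  | all_elim t _ ih => exact .all_elim t (ih hH)

theorem subst (h : Derives H φ) : ∀ {W : Ctx} (s : ∀ ρ, V ρ → Term W ρ),
    Derives ((fun ψ => Formula.subst ψ s) '' H) (φ.subst s) := by
  induction h with
  | postulate h => intro W s; exact .postulate (h.subst s)
  | hyp h => intro W s; exact .hyp (Set.mem_image_of_mem _ h)
  | imp_intro _ ih =>
    intro W s; refine .imp_intro ?_; have := ih s; rwa [Set.image_insert_eq] at this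
  | imp_elim _ _ h₁ h₂ => intro W s; exact .imp_elim (h₁ s) (h₂ s)
  | by_contra _ ih =>
    intro W s; refine .by_contra ?_; have := ih s; rwa [Set.image_insert_eq] at this
  | @all_intro V H σ φ _ ih =>
    intro W s
    refine .all_intro ?_
    have := ih (liftSubst σ s)
    rw [Set.image_image] at this ⊢
    simpa only [Formula.wk_subst_lift] using this
  | all_elim t _ ih =>
    intro W s
    rw [Formula.inst_subst]
    exact .all_elim _ (ih s)

/-- Compactness of derivability; it keeps the union of a chain of consistent sets consistent. -/
theorem exists_finite (h : Derives H φ) : ∃ H₀ ⊆ H, H₀.Finite ∧ Derives H₀ φ := by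
  induction h with
  | postulate h => exact ⟨∅, Set.empty_subset _, Set.finite_empty, .postulate h⟩
  | @hyp V H φ h => exact ⟨{φ}, by simpa, Set.finite_singleton _, .hyp rfl⟩
  | @imp_intro V H φ ψ _ ih =>
    obtain ⟨H₀, h₀, hf, hd⟩ := ih
    exact ⟨H₀ \ {φ}, by simpa [Set.subset_def, or_iff_not_imp_left] using h₀, hf.sdiff,
      .imp_intro (hd.mono (by simp))⟩
  | imp_elim _ _ h₁ h₂ =>
    obtain ⟨H₁, h₁, hf₁, hd₁⟩ := h₁
    obtain ⟨H₂, h₂, hf₂, hd₂⟩ := h₂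
    exact ⟨H₁ ∪ H₂, Set.union_subset h₁ h₂, hf₁.union hf₂,
      .imp_elim (hd₁.mono Set.subset_union_left) (hd₂.mono Set.subset_union_right)⟩
  | @by_contra V H φ _ ih =>
    obtain ⟨H₀, h₀, hf, hd⟩ := ih
    exact ⟨H₀ \ {φ.not}, by simpa [Set.subset_def, or_iff_not_imp_left] using h₀, hf.sdiff,
      .by_contra (hd.mono (by simp))⟩
  | all_intro _ ih =>
    obtain ⟨H₀, h₀, hf, hd⟩ := ih
    obtain ⟨H₁, h₁, rfl⟩ := Set.subset_image_iff.1 h₀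
    obtain ⟨H₂, h₂, hf₂, he⟩ := Set.exists_subset_image_finite_and.1 ⟨_, h₀, hf, rfl⟩
    exact ⟨H₂, h₂, hf₂, .all_intro (he ▸ hd)⟩
  | all_elim t _ ih =>
    obtain ⟨H₀, h₀, hf, hd⟩ := ih
    exact ⟨H₀, h₀, hf, .all_elim t hd⟩

theorem of_bot (h : Derives H .bot) : Derives H φ :=
  .by_contra (h.mono (Set.subset_insert _ _))

end Derives

/-! ### Countability of the language -/

section Countability

/-- The depth of a finite type. -/
def Ty.depth : Ty → ℕ
  | .nat => 0
  | .arr σ τ => max σ.depth τ.depth + 1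

/-- Stratification by depth: each stratum is the image of countable lower strata. The same scheme
serves terms and formulas. -/
instance : Countable Ty := by
  have key : ∀ n, Set.Countable {σ : Ty | σ.depth < n} := by
    intro n
    induction n with
    | zero => simp
    | succ n ih =>
      refine ((Set.countable_singleton Ty.nat).union (ih.image2 ih Ty.arr)).mono ?_
      rintro (_ | ⟨σ, τ⟩) h
      · exact Or.inl rfl
      · simp only [Ty.depth, Set.mem_ofPred_eq] at h
        exact Or.inr ⟨σ, by simp; omega, τ, by simp; omega, rfl⟩
  rw [← Set.countable_univ_iff]
  exact (Set.countable_iUnion key).mono fun σ _ =>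
    Set.mem_iUnion.2 ⟨σ.depth + 1, Nat.lt_succ_self _⟩

/-- The types of the constants are pairwise distinct and determine the indices of `K` and `S`. -/
instance (σ : Ty) : Subsingleton (Const σ) where
  allEq c d := by cases c <;> cases d <;> rfl

variable {V : Ctx}

/-- The depth of a term. -/
def Term.depth : {τ : Ty} → Term V τ → ℕ
  | _, .var _ => 0
  | _, .const _ => 0
  | _, .app s t => max s.depth t.depth + 1

instance [∀ σ, Countable (V σ)] (τ : Ty) : Countable (Term V τ) := by
  have key : ∀ n, ∀ τ, Set.Countable {t : Term V τ | t.depth < n} := by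
    intro n
    induction n with
    | zero => simp
    | succ n ih =>
      intro τ
      have h₁ := Set.countable_range (fun x : V τ => Term.var x)
      have h₂ := Set.countable_range (fun x : Const τ => Term.const (V := V) x)
      have h₃ := Set.countable_iUnion fun σ : Ty => (ih (σ ⇢ τ)).image2 (ih σ) Term.app
      refine ((h₁.union h₂).union h₃).mono ?_
      rintro (x | c | ⟨s, t⟩) h
      · exact Or.inl (Or.inl ⟨x, rfl⟩)
      · exact Or.inl (Or.inr ⟨c, rfl⟩)
      · simp only [Term.depth, Set.mem_ofPred_eq] at h
        exact Or.inr (Set.mem_iUnion.2 ⟨_, s, by simp; omega, t, by simp; omega, rfl⟩)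
  rw [← Set.countable_univ_iff]
  exact (Set.countable_iUnion fun n => key n τ).mono fun t _ =>
    Set.mem_iUnion.2 ⟨t.depth + 1, Nat.lt_succ_self _⟩

/-- The depth of a formula. -/
def Formula.depth : {V : Ctx} → Formula V → ℕ
  | _, .eq _ _ => 0
  | _, .bot => 0
  | _, .imp φ ψ => max φ.depth ψ.depth + 1
  | _, .all _ φ => φ.depth + 1

instance [∀ σ, Countable (V σ)] (σ τ : Ty) : Countable (Ctx.Ext V σ τ) := by
  let e : Ctx.Ext V σ τ → Option (V τ) := fun x => match x with
    | .new => none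
    | .old x => some x
  refine Function.Injective.countable (f := e) ?_
  intro x y h
  cases x <;> cases y <;> first | rfl | simp_all [e]

instance [∀ σ, Countable (V σ)] : Countable (Formula V) := by
  -- The context is quantified inside the induction because a quantifier changes it.
  have key : ∀ n, ∀ (V : Ctx) [∀ σ, Countable (V σ)],
      Set.Countable {φ : Formula V | φ.depth < n} := by
    intro n
    induction n with
    | zero => simp
    | succ n ih =>
      intro V _
      have h₁ := Set.countable_range (fun x : Term V .nat × Term V .nat => x.1 ≐ x.2)
      have h₂ := Set.countable_singleton (Formula.bot (V := V))
      have h₃ := (ih V).image2 (ih V) Formula.imp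
      have h₄ := Set.countable_iUnion fun σ : Ty => (ih (Ctx.Ext V σ)).image (Formula.all σ)
      refine (((h₁.union h₂).union h₃).union h₄).mono ?_
      intro φ h
      cases φ with
      | eq s t => exact Or.inl (Or.inl (Or.inl ⟨(s, t), rfl⟩))
      | bot => exact Or.inl (Or.inl (Or.inr rfl))
      | imp φ ψ =>
        simp only [Formula.depth, Set.mem_ofPred_eq] at h
        exact Or.inl (Or.inr ⟨φ, by simp; omega, ψ, by simp; omega, rfl⟩)
      | all σ φ =>
        simp only [Formula.depth, Set.mem_ofPred_eq] at h
        exact Or.inr (Set.mem_iUnion.2 ⟨σ, φ, by simp; omega, rfl⟩)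
  rw [← Set.countable_univ_iff]
  exact (Set.countable_iUnion fun n => key n V).mono fun t _ =>
    Set.mem_iUnion.2 ⟨t.depth + 1, Nat.lt_succ_self _⟩

end Countability

/-! ### Free variables -/

section FreeVariables

variable {V W : Ctx}

/-- The variables of a term. -/
def Term.vars : {τ : Ty} → Term V τ → Set (Σ σ, V σ)
  | _, .var x => {⟨_, x⟩}
  | _, .const _ => ∅
  | _, .app s t => s.vars ∪ t.vars

/-- The free variables of a formula. -/
def Formula.vars : {V : Ctx} → Formula V → Set (Σ σ, V σ)
  | _, .eq s t => s.vars ∪ t.vars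
  | _, .bot => ∅
  | _, .imp φ ψ => φ.vars ∪ ψ.vars
  | _, .all _ φ => {x | ⟨x.1, .old x.2⟩ ∈ φ.vars}

theorem Term.finite_vars {τ : Ty} (t : Term V τ) : t.vars.Finite := by
  induction t with
  | var x => exact Set.finite_singleton _
  | const c => exact Set.finite_empty
  | app s t hs ht => exact hs.union ht

theorem Formula.finite_vars (φ : Formula V) : φ.vars.Finite := by
  induction φ with
  | eq s t => exact s.finite_vars.union t.finite_vars
  | bot => exact Set.finite_empty
  | imp φ ψ h₁ h₂ => exact h₁.union h₂
  | all σ φ h =>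
    refine h.preimage
      (f := fun x : Σ τ, _ => (⟨x.1, .old x.2⟩ : Σ τ, Ctx.Ext _ σ τ)) (Function.Injective.injOn ?_)
    rintro ⟨_, x⟩ ⟨_, y⟩ hxy
    cases hxy
    rfl

theorem Term.subst_congr {τ : Ty} (t : Term V τ) {s s' : ∀ σ, V σ → Term W σ}
    (h : ∀ x ∈ t.vars, s x.1 x.2 = s' x.1 x.2) : t.subst s = t.subst s' := by
  induction t with
  | var x => exact h ⟨_, x⟩ rfl
  | const c => rfl
  | app a b ha hb =>
    simp only [Term.subst, ha fun x hx => h x (Or.inl hx), hb fun x hx => h x (Or.inr hx)]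

theorem Formula.subst_congr (φ : Formula V) : ∀ {W : Ctx} {s s' : ∀ σ, V σ → Term W σ},
    (∀ x ∈ φ.vars, s x.1 x.2 = s' x.1 x.2) → φ.subst s = φ.subst s' := by
  induction φ with
  | eq t u =>
    intro W s s' h
    simp only [Formula.subst, t.subst_congr fun x hx => h x (Or.inl hx),
      u.subst_congr fun x hx => h x (Or.inr hx)]
  | bot => intros; rfl
  | imp φ ψ h₁ h₂ =>
    intro W s s' h
    simp only [Formula.subst, h₁ fun x hx => h x (Or.inl hx), h₂ fun x hx => h x (Or.inr hx)]
  | all σ φ ih =>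
    intro W s s' h
    simp only [Formula.subst]
    rw [ih]
    rintro ⟨τ, x⟩ hx
    cases x with
    | new => rfl
    | old x => simp only [liftSubst, h ⟨τ, x⟩ hx]

open Classical in
/-- The renaming that turns the variable `c` into the newest one. -/
noncomputable def abstractVar {σ : Ty} (c : V σ) : ∀ τ, V τ → Term (Ctx.Ext V σ) τ := fun τ x =>
  if h : (⟨τ, x⟩ : Σ τ, V τ) = ⟨σ, c⟩ then
    (show σ = τ from (congrArg Sigma.fst h).symm) ▸ (Term.var .new : Term (Ctx.Ext V σ) σ)
  else .var (.old x)

theorem abstractVar_self {σ : Ty} (c : V σ) : abstractVar c σ c = .var .new := by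
  simp [abstractVar]

theorem Formula.subst_abstractVar {σ : Ty} {c : V σ} {φ : Formula V} (h : ⟨σ, c⟩ ∉ φ.vars) :
    φ.subst (abstractVar c) = φ.wk σ := by
  refine φ.subst_congr ?_
  rintro ⟨τ, x⟩ hx
  have : (⟨τ, x⟩ : Σ τ, V τ) ≠ ⟨σ, c⟩ := fun e => h (e ▸ hx)
  simp [abstractVar, this]

/-- Generalization on a variable that is not free in the hypotheses. -/
theorem Derives.all_of_fresh {H : Set (Formula V)} {σ : Ty} {φ : Formula (Ctx.Ext V σ)} {c : V σ}
    (hH : ∀ ψ ∈ H, ⟨σ, c⟩ ∉ ψ.vars) (hφ : ⟨σ, c⟩ ∉ (Formula.all σ φ).vars)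
    (h : Derives H (φ.inst (.var c))) : Derives H (.all σ φ) := by
  refine .all_intro ?_
  -- Renaming `c` to the newest variable turns the derivation of `φ(c)` into one of `φ`; as `c` is
  -- fresh, the hypotheses are merely weakened.
  have h₁ := h.subst (abstractVar c)
  have h₂ : (fun ψ => Formula.subst ψ (abstractVar c)) '' H = Formula.wk σ '' H :=
    Set.image_congr fun ψ hψ => Formula.subst_abstractVar (hH ψ hψ)
  have h₃ : (φ.inst (.var c)).subst (abstractVar c) = φ := by
    rw [Formula.inst, Formula.subst_subst]
    conv_rhs => rw [← φ.subst_id]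
    refine φ.subst_congr ?_
    rintro ⟨τ, x⟩ hx
    cases x with
    | new => simp only [consSubst, Term.subst, abstractVar_self]; rfl
    | old x =>
      have : (⟨τ, x⟩ : Σ τ, V τ) ≠ ⟨σ, c⟩ := fun e => hφ (by
        cases e
        exact hx)
      simp [consSubst, Term.subst, abstractVar, this, idSubst]
  rwa [h₂, h₃] at h₁

end FreeVariables

/-! ### Maximal consistent sets with witnesses -/

section Henkin

/-- The context with countably many variables of each type. -/
abbrev Ctx.omega : Ctx := fun _ => ℕ

/-- One step of Henkin's construction. Keeping `T` finite leaves a variable of each type unused, and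
such variables serve as the witnesses. -/
theorem exists_extension {T : Set (Formula Ctx.omega)} (hf : T.Finite) (hc : ¬ Derives T .bot)
    (A : Formula Ctx.omega) : ∃ T', T ⊆ T' ∧ T'.Finite ∧ ¬ Derives T' .bot ∧
      (A ∈ T' ∨ A.not ∈ T') ∧
      ∀ σ φ, A = .all σ φ → A ∈ T' ∨ ∃ t, (φ.inst t).not ∈ T' := by
  by_cases h : Derives (insert A T) .bot
  swap
  · exact ⟨insert A T, Set.subset_insert _ _, hf.insert _, h, .inl (Set.mem_insert _ _),
      fun _ _ _ => .inl (Set.mem_insert _ _)⟩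
  have hn : Derives T A.not := .imp_intro h
  -- `T` already derives `A.not`, so adding it is harmless.
  have hc' : ¬ Derives (insert A.not T) .bot := fun h' =>
    hc (.imp_elim (.imp_intro h') hn)
  by_cases hA : ∃ σ φ, A = .all σ φ
  swap
  · exact ⟨insert A.not T, Set.subset_insert _ _, hf.insert _, hc', .inr (Set.mem_insert _ _),
      fun σ φ e => (hA ⟨σ, φ, e⟩).elim⟩
  obtain ⟨σ, φ, rfl⟩ := hA
  have hfin : ((⋃ ψ ∈ insert (Formula.all σ φ).not T, ψ.vars) ∪
      (Formula.all σ φ).vars).Finite :=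
    ((hf.insert _).biUnion fun ψ _ => ψ.finite_vars).union (Formula.finite_vars _)
  have hfin' := hfin.preimage (f := fun c : ℕ => (⟨σ, c⟩ : Σ σ, Ctx.omega σ))
    (Function.Injective.injOn fun a b e => by cases e; rfl)
  obtain ⟨c, hcf⟩ := hfin'.exists_notMem
  simp only [Set.mem_preimage, Set.mem_union, Set.mem_iUnion, not_or, not_exists] at hcf
  refine ⟨insert (φ.inst (.var c)).not (insert (Formula.all σ φ).not T),
    (Set.subset_insert _ _).trans (Set.subset_insert _ _), (hf.insert _).insert _, ?_,
    .inr (by simp), ?_⟩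
  -- If the witness clause were inconsistent, `φ(c)` would be derivable, hence `∀ φ` by freshness of
  -- `c`, against its negation.
  · intro h'
    exact hc' (.imp_elim (.hyp (Set.mem_insert _ _))
      (Derives.all_of_fresh hcf.1 hcf.2 (.by_contra h')))
  · intro σ' φ' e
    cases e
    exact .inr ⟨_, Set.mem_insert _ _⟩

theorem exists_henkin {A : Formula Ctx.omega} (hA : ¬ Derives {A} .bot) :
    ∃ T : Set (Formula Ctx.omega), A ∈ T ∧ ¬ Derives T .bot ∧ (∀ B, B ∈ T ∨ B.not ∈ T) ∧
      ∀ σ φ, Formula.all σ φ ∈ T ∨ ∃ t, (φ.inst t).not ∈ T := by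
  have : Nonempty (Formula Ctx.omega) := ⟨A⟩
  obtain ⟨e, he⟩ := exists_surjective_nat (Formula Ctx.omega)
  let C := {T : Set (Formula Ctx.omega) // T.Finite ∧ ¬ Derives T .bot}
  have step : ∀ (B : Formula Ctx.omega) (T : C), ∃ T' : C, T.1 ⊆ T'.1 ∧
      (B ∈ T'.1 ∨ B.not ∈ T'.1) ∧
      ∀ σ φ, B = .all σ φ → B ∈ T'.1 ∨ ∃ t, (φ.inst t).not ∈ T'.1 := by
    rintro B ⟨T, hf, hc⟩
    obtain ⟨T', h₁, h₂, h₃, h₄⟩ := exists_extension hf hc B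
    exact ⟨⟨T', h₂, h₃⟩, h₁, h₄⟩
  choose next hnext hdec hwit using step
  let T : ℕ → C := fun n =>
    Nat.rec ⟨{A}, Set.finite_singleton _, hA⟩ (fun n T => next (e n) T) n
  have hmono : Monotone fun n => (T n).1 := monotone_nat_of_le_succ fun n => hnext _ _
  refine ⟨⋃ n, (T n).1, Set.mem_iUnion.2 ⟨0, rfl⟩, ?_, ?_, ?_⟩
  · intro h
    obtain ⟨H₀, h₀, hf, hd⟩ := h.exists_finite
    -- The finitely many hypotheses of a derivation of falsity already belong to one consistent
    -- stage.
    obtain ⟨n, hn⟩ := hmono.directed_le.exists_mem_subset_of_finset_subset_biUnion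
      (s := hf.toFinset) (by simpa using h₀)
    exact (T n).2.2 (hd.mono (by simpa using hn))
  · intro B
    obtain ⟨n, rfl⟩ := he B
    exact (hdec (e n) (T n)).imp (fun h => Set.mem_iUnion.2 ⟨n + 1, h⟩)
      fun h => Set.mem_iUnion.2 ⟨n + 1, h⟩
  · intro σ φ
    obtain ⟨n, hn⟩ := he (.all σ φ)
    refine (hwit (e n) (T n) σ φ hn).imp (fun h => Set.mem_iUnion.2 ⟨n + 1, hn ▸ h⟩) ?_
    rintro ⟨t, h⟩
    exact ⟨t, Set.mem_iUnion.2 ⟨n + 1, h⟩⟩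

end Henkin

/-! ### Semantics -/

/-- A structure for the language of all finite types. -/
structure Str where
  El : Ty → Type
  app {σ τ : Ty} : El (σ ⇢ τ) → El σ → El τ
  const {σ : Ty} : Const σ → El σ

namespace Str

instance (M : Str) (σ τ : Ty) : CoeFun (M.El (σ ⇢ τ)) fun _ => M.El σ → M.El τ := ⟨M.app⟩

variable (M : Str) {V W : Ctx}

/-- The valuation `ρ`, extended by `a` as the value of the newest variable. -/
def cons {σ : Ty} (a : M.El σ) (ρ : ∀ τ, V τ → M.El τ) : ∀ τ, Ctx.Ext V σ τ → M.El τ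
  | _, .new => a
  | _, .old x => ρ _ x

/-- The value of a term. -/
def eval (ρ : ∀ τ, V τ → M.El τ) : {τ : Ty} → Term V τ → M.El τ
  | _, .var x => ρ _ x
  | _, .const c => M.const c
  | _, .app s t => M.app (eval ρ s) (eval ρ t)

/-- Satisfaction of a formula. -/
def Sat : {V : Ctx} → (∀ τ, V τ → M.El τ) → Formula V → Prop
  | _, ρ, .eq s t => M.eval ρ s = M.eval ρ t
  | _, _, .bot => False
  | _, ρ, .imp φ ψ => Sat ρ φ → Sat ρ ψ
  | _, ρ, .all σ φ => ∀ a : M.El σ, Sat (M.cons a ρ) φ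

/-- Extensional models of `RCA₀^ω`. -/
class IsModel : Prop where
  ext {σ τ : Ty} {f g : M.El (σ ⇢ τ)} : (∀ a, f a = g a) → f = g
  sat {V : Ctx} {φ : Formula V} (ρ : ∀ τ, V τ → M.El τ) : RCA0omega φ → M.Sat ρ φ

theorem eval_subst (ρ : ∀ τ, W τ → M.El τ) (s : ∀ τ, V τ → Term W τ) {τ : Ty} (t : Term V τ) :
    M.eval ρ (t.subst s) = M.eval (fun _ x => M.eval ρ (s _ x)) t := by
  induction t with
  | var x => rfl
  | const c => rfl
  | app a b ha hb => simp only [Term.subst, eval, ha, hb]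

end Str

/-! ### Completeness -/

section Completeness

variable {T : Set (Formula Ctx.omega)}

/-- Complete consistent sets of formulas with witnesses. -/
structure IsHenkin (T : Set (Formula Ctx.omega)) : Prop where
  consistent : ¬ Derives T .bot
  complete : ∀ B, B ∈ T ∨ B.not ∈ T
  witness : ∀ σ φ, Formula.all σ φ ∈ T ∨ ∃ t, (φ.inst t).not ∈ T

namespace IsHenkin

theorem mem_of_derives (hT : IsHenkin T) {A : Formula Ctx.omega} (h : Derives T A) : A ∈ T :=
  (hT.complete A).resolve_right fun h' => hT.consistent (.imp_elim (.hyp h') h)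

theorem not_mem_iff (hT : IsHenkin T) {A : Formula Ctx.omega} : A.not ∈ T ↔ A ∉ T :=
  ⟨fun h h' => hT.consistent (.imp_elim (.hyp h) (.hyp h')), (hT.complete A).resolve_left⟩

theorem imp_mem_iff (hT : IsHenkin T) {A B : Formula Ctx.omega} :
    (A ⟹ B) ∈ T ↔ (A ∈ T → B ∈ T) := by
  refine ⟨fun h h' => hT.mem_of_derives (.imp_elim (.hyp h) (.hyp h')), fun h => ?_⟩
  by_cases hA : A ∈ T
  · exact hT.mem_of_derives (.imp_intro (.hyp (Or.inr (h hA))))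
  · exact hT.mem_of_derives (.imp_intro (Derives.of_bot (.imp_elim
      (.hyp (Or.inr (hT.not_mem_iff.2 hA))) (.hyp (Or.inl rfl)))))

theorem all_mem_iff (hT : IsHenkin T) {σ : Ty} {φ : Formula (Ctx.Ext Ctx.omega σ)} :
    Formula.all σ φ ∈ T ↔ ∀ t, φ.inst t ∈ T := by
  refine ⟨fun h t => hT.mem_of_derives (.all_elim t (.hyp h)), fun h => ?_⟩
  refine (hT.witness σ φ).resolve_right ?_
  rintro ⟨t, ht⟩
  exact hT.not_mem_iff.1 ht (h t)

/-- By the witness property, pointwise equality amounts to agreement on all terms; this makes the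
term model extensional. -/
theorem eqT_arr_mem_iff (hT : IsHenkin T) {σ τ : Ty} {f g : Term Ctx.omega (σ ⇢ τ)} :
    Formula.eqT (σ ⇢ τ) f g ∈ T ↔ ∀ t, Formula.eqT τ (f ⬝ t) (g ⬝ t) ∈ T := by
  rw [Formula.eqT, Formula.forAll, hT.all_mem_iff]
  refine forall_congr' fun t => ?_
  have (f : Term Ctx.omega (σ ⇢ τ)) : f.subst (fun _ x => Term.var x) = f := Term.subst_id f
  simp only [Formula.inst, Formula.eqT_subst, Term.subst, Term.subst_wk, consSubst, this]

theorem eqT_equivalence (hT : IsHenkin T) (σ : Ty) :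
    Equivalence fun s t : Term Ctx.omega σ => Formula.eqT σ s t ∈ T := by
  induction σ with
  | nat =>
    have h {A : Formula Ctx.omega} (hA : RCA0omega A) : A ∈ T :=
      hT.mem_of_derives (.postulate hA)
    exact ⟨fun t => h (.eq_refl t), fun {s t} => hT.imp_mem_iff.1 (h (.eq_symm s t)),
      fun {s t u} h₁ h₂ => hT.imp_mem_iff.1 (hT.imp_mem_iff.1 (h (.eq_trans s t u)) h₁) h₂⟩
  | arr σ τ _ ih =>
    simp only [hT.eqT_arr_mem_iff]
    exact ⟨fun f t => ih.refl _, fun h t => ih.symm (h t), fun h₁ h₂ t => ih.trans (h₁ t) (h₂ t)⟩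

/-- The extensionality postulate is exactly what makes application well defined on the quotient. -/
theorem eqT_app (hT : IsHenkin T) {σ τ : Ty} {f g : Term Ctx.omega (σ ⇢ τ)}
    {s t : Term Ctx.omega σ} (hf : Formula.eqT (σ ⇢ τ) f g ∈ T) (hs : Formula.eqT σ s t ∈ T) :
    Formula.eqT τ (f ⬝ s) (g ⬝ t) ∈ T :=
  (hT.eqT_equivalence τ).trans
    (hT.imp_mem_iff.1 (hT.mem_of_derives (.postulate (.extensionality f s t))) hs)
    (hT.eqT_arr_mem_iff.1 hf t)

/-- Provable equality of terms. -/
def setoid (hT : IsHenkin T) (σ : Ty) : Setoid (Term Ctx.omega σ) where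
  r s t := Formula.eqT σ s t ∈ T
  iseqv := hT.eqT_equivalence σ

/-- The structure of terms modulo provable equality. -/
def termModel (hT : IsHenkin T) : Str where
  El σ := Quotient (hT.setoid σ)
  app := Quotient.map₂ Term.app fun _ _ hf _ _ hs => hT.eqT_app hf hs
  const c := Quotient.mk _ (.const c)

variable (hT : IsHenkin T) {V : Ctx}

/-- The value of a substitution in the term model. -/
def val (s : ∀ τ, V τ → Term Ctx.omega τ) : ∀ τ, V τ → hT.termModel.El τ :=
  fun _ x => Quotient.mk _ (s _ x)

theorem eval_termModel (s : ∀ τ, V τ → Term Ctx.omega τ) {τ : Ty} (t : Term V τ) :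
    hT.termModel.eval (hT.val s) t = Quotient.mk _ (t.subst s) := by
  induction t with
  | var x => rfl
  | const c => rfl
  | app a b ha hb => simp only [Str.eval, ha, hb]; rfl

theorem cons_val {σ : Ty} (t : Term Ctx.omega σ) (s : ∀ τ, V τ → Term Ctx.omega τ) :
    hT.termModel.cons (Quotient.mk (hT.setoid σ) t) (hT.val s) = hT.val (consSubst t s) := by
  funext τ x
  cases x <;> rfl

/-- The truth lemma: completeness of `T` handles implication, and witnesses handle the quantifier.
-/
theorem sat_termModel (φ : Formula V) : ∀ s : ∀ τ, V τ → Term Ctx.omega τ,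
    hT.termModel.Sat (hT.val s) φ ↔ φ.subst s ∈ T := by
  induction φ with
  | eq a b =>
    intro s
    rw [Str.Sat, eval_termModel, eval_termModel]
    exact Quotient.eq (r := hT.setoid .nat)
  | bot => exact fun s => ⟨False.elim, fun h => hT.consistent (.hyp h)⟩
  | imp φ ψ h₁ h₂ => intro s; rw [Str.Sat, h₁, h₂, Formula.subst, hT.imp_mem_iff]
  | all σ φ ih =>
    intro s
    rw [Str.Sat, Formula.subst, hT.all_mem_iff]
    refine Quotient.forall.trans (forall_congr' fun t => ?_)
    rw [cons_val, ih, Formula.subst_lift_inst]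

theorem exists_val (ρ : ∀ τ, V τ → hT.termModel.El τ) : ∃ s, ρ = hT.val s :=
  ⟨fun τ x => (ρ τ x).out, by funext τ x; exact (Quotient.out_eq (ρ τ x)).symm⟩

instance : hT.termModel.IsModel where
  ext {σ τ f g} := by
    refine Quotient.inductionOn₂ f g fun f g h => Quotient.sound ?_
    exact hT.eqT_arr_mem_iff.2 fun t => Quotient.exact (h (Quotient.mk _ t))
  sat {V φ} ρ h := by
    obtain ⟨s, rfl⟩ := hT.exists_val ρ
    exact (hT.sat_termModel φ s).2 (hT.mem_of_derives (.postulate (h.subst s)))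

end IsHenkin

/-- A closed term of each finite type. -/
def Ty.default : (σ : Ty) → Term Ctx.empty σ
  | .nat => zero
  | .arr σ τ => .const (.K τ σ) ⬝ τ.default

/-- A sentence that holds in all extensional models is provable. -/
theorem provable_of_sat {φ : Formula Ctx.empty}
    (h : ∀ (M : Str) [M.IsModel] (ρ : ∀ τ, Ctx.empty τ → M.El τ), M.Sat ρ φ) : Provable φ := by
  by_contra hφ
  let s : ∀ τ, Ctx.empty τ → Term Ctx.omega τ := fun _ x => x.elim
  have hc : ¬ Derives {(φ.subst s).not} .bot := by
    intro hd
    have h₁ : Derives ∅ (φ.subst s) := .by_contra (by simpa using hd)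
    -- Closed terms replace the auxiliary variables and bring the derivation back to the empty
    -- context.
    have h₂ := h₁.subst fun σ _ => Ty.default σ
    rw [Formula.subst_subst, Set.image_empty] at h₂
    have h₃ : (fun σ x => (s σ x).subst fun σ _ => Ty.default σ) = idSubst Ctx.empty := by
      funext σ x
      exact x.elim
    rw [h₃, Formula.subst_id] at h₂
    exact hφ h₂
  obtain ⟨T, hA, h₁, h₂, h₃⟩ := exists_henkin hc
  have hT : IsHenkin T := ⟨h₁, h₂, h₃⟩
  exact hT.not_mem_iff.1 hA ((hT.sat_termModel φ s).1 (h hT.termModel _))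

end Completeness

set_option linter.unusedSectionVars false

namespace Str

variable (M : Str) {V W : Ctx}

/-! ### Evaluation in models -/

section Evaluation

/-- The valuation of the context in which all elements of the model are parameters. -/
def self : ∀ τ, M.El τ → M.El τ := fun _ a => a

@[simp] theorem self_apply {τ : Ty} (a : M.El τ) : M.self τ a = a := rfl

@[simp] theorem cons_new {σ : Ty} (a : M.El σ) (ρ : ∀ τ, V τ → M.El τ) :
    M.cons a ρ σ .new = a := rfl

@[simp] theorem cons_old {σ τ : Ty} (a : M.El σ) (ρ : ∀ τ, V τ → M.El τ) (x : V τ) :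
    M.cons a ρ τ (.old x) = ρ τ x := rfl

@[simp] theorem eval_var (ρ : ∀ τ, V τ → M.El τ) {τ : Ty} (x : V τ) :
    M.eval ρ (.var x) = ρ τ x := rfl

@[simp] theorem eval_app (ρ : ∀ τ, V τ → M.El τ) {σ τ : Ty} (s : Term V (σ ⇢ τ))
    (t : Term V σ) : M.eval ρ (s ⬝ t) = M.app (M.eval ρ s) (M.eval ρ t) := rfl

@[simp] theorem eval_wk {σ τ : Ty} (a : M.El σ) (ρ : ∀ τ, V τ → M.El τ) (t : Term V τ) :
    M.eval (M.cons a ρ) (t.wk σ) = M.eval ρ t := by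
  rw [Term.wk, eval_subst]
  rfl

theorem eval_liftSubst {σ : Ty} (a : M.El σ) (ρ : ∀ τ, W τ → M.El τ)
    (s : ∀ τ, V τ → Term W τ) :
    (fun τ x => M.eval (M.cons a ρ) (liftSubst σ s τ x)) =
      M.cons a fun τ x => M.eval ρ (s τ x) := by
  funext τ x
  cases x with
  | new => rfl
  | old x => simp [liftSubst]

theorem eval_consSubst {σ : Ty} (t : Term W σ) (ρ : ∀ τ, W τ → M.El τ)
    (s : ∀ τ, V τ → Term W τ) :
    (fun τ x => M.eval ρ (consSubst t s τ x)) =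
      M.cons (M.eval ρ t) fun τ x => M.eval ρ (s τ x) := by
  funext τ x
  cases x <;> rfl

theorem sat_subst (φ : Formula V) : ∀ {W : Ctx} (ρ : ∀ τ, W τ → M.El τ)
    (s : ∀ τ, V τ → Term W τ),
    M.Sat ρ (φ.subst s) ↔ M.Sat (fun τ x => M.eval ρ (s τ x)) φ := by
  induction φ with
  | eq a b => intro W ρ s; simp only [Formula.subst, Sat, eval_subst]
  | bot => exact fun ρ s => Iff.rfl
  | imp φ ψ h₁ h₂ => intro W ρ s; simp only [Formula.subst, Sat, h₁, h₂]
  | all σ φ ih => intro W ρ s; simp only [Formula.subst, Sat, ih, eval_liftSubst]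

@[simp] theorem sat_eq (ρ : ∀ τ, V τ → M.El τ) (s t : Term V .nat) :
    M.Sat ρ (s ≐ t) ↔ M.eval ρ s = M.eval ρ t := Iff.rfl

@[simp] theorem sat_imp (ρ : ∀ τ, V τ → M.El τ) (φ ψ : Formula V) :
    M.Sat ρ (φ ⟹ ψ) ↔ (M.Sat ρ φ → M.Sat ρ ψ) := Iff.rfl

@[simp] theorem sat_all (ρ : ∀ τ, V τ → M.El τ) {σ : Ty} (φ : Formula (Ctx.Ext V σ)) :
    M.Sat ρ (.all σ φ) ↔ ∀ a, M.Sat (M.cons a ρ) φ := Iff.rfl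

@[simp] theorem sat_not (ρ : ∀ τ, V τ → M.El τ) (φ : Formula V) :
    M.Sat ρ φ.not ↔ ¬ M.Sat ρ φ := Iff.rfl

@[simp] theorem sat_and (ρ : ∀ τ, V τ → M.El τ) (φ ψ : Formula V) :
    M.Sat ρ (φ ⋏ ψ) ↔ M.Sat ρ φ ∧ M.Sat ρ ψ := by
  simp [Formula.and]

@[simp] theorem sat_iff (ρ : ∀ τ, V τ → M.El τ) (φ ψ : Formula V) :
    M.Sat ρ (φ ⟺ ψ) ↔ (M.Sat ρ φ ↔ M.Sat ρ ψ) := by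
  simp [Formula.iff, iff_iff_implies_and_implies]

@[simp] theorem sat_ex (ρ : ∀ τ, V τ → M.El τ) {σ : Ty} (φ : Formula (Ctx.Ext V σ)) :
    M.Sat ρ (.ex σ φ) ↔ ∃ a, M.Sat (M.cons a ρ) φ := by
  simp [Formula.ex]

@[simp] theorem sat_forAll (ρ : ∀ τ, V τ → M.El τ) {σ : Ty}
    (b : Term (Ctx.Ext V σ) σ → Formula (Ctx.Ext V σ)) :
    M.Sat ρ (.forAll σ b) ↔ ∀ a, M.Sat (M.cons a ρ) (b (.var .new)) := Iff.rfl

@[simp] theorem sat_exists (ρ : ∀ τ, V τ → M.El τ) {σ : Ty}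
    (b : Term (Ctx.Ext V σ) σ → Formula (Ctx.Ext V σ)) :
    M.Sat ρ (.exists_ σ b) ↔ ∃ a, M.Sat (M.cons a ρ) (b (.var .new)) := by
  simp [Formula.exists_]

end Evaluation

variable [M.IsModel]

/-! ### Combinatory completeness -/

section Combinators

variable {M} in
theorem ext {σ τ : Ty} {f g : M.El (σ ⇢ τ)} (h : ∀ a, f a = g a) : f = g := IsModel.ext h

/-- Extensionality collapses pointwise equality to identity, so the defining equations of the
constants become equations in `M`. -/
theorem sat_eqT {V : Ctx} {σ : Ty} (ρ : ∀ τ, V τ → M.El τ) (s t : Term V σ) :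
    M.Sat ρ (.eqT σ s t) ↔ M.eval ρ s = M.eval ρ t := by
  induction σ generalizing V with
  | nat => rfl
  | arr σ τ _ ih =>
    simp only [Formula.eqT, sat_forAll, ih, eval_app, eval_wk, eval_var, cons_new]
    exact ⟨ext, fun h _ => by rw [h]⟩

@[simp] theorem K_apply {σ τ : Ty} (a : M.El σ) (b : M.El τ) :
    M.app (M.app (M.const (.K σ τ)) a) b = a :=
  (M.sat_eqT M.self _ _).1 (IsModel.sat M.self (.K_eq (.var a) (.var b)))

@[simp] theorem S_apply {ρ σ τ : Ty} (a : M.El (ρ ⇢ σ ⇢ τ)) (b : M.El (ρ ⇢ σ)) (c : M.El ρ) :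
    M.app (M.app (M.app (M.const (.S ρ σ τ)) a) b) c = a c (b c) :=
  (M.sat_eqT M.self _ _).1 (IsModel.sat M.self (.S_eq (.var a) (.var b) (.var c)))

@[simp] theorem eval_lam (ρ : ∀ τ, V τ → M.El τ) {σ τ : Ty} (t : Term (Ctx.Ext V σ) τ)
    (a : M.El σ) : M.app (M.eval ρ t.lam) a = M.eval (M.cons a ρ) t := by
  induction t with
  | var x =>
    cases x with
    | new => exact (M.S_apply _ _ _).trans (M.K_apply _ _)
    | old x => exact M.K_apply _ _
  | const c => exact M.K_apply _ _
  | app s t hs ht => exact (M.S_apply _ _ _).trans (by rw [hs, ht, eval_app])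

@[simp] theorem eval_fn (ρ : ∀ τ, V τ → M.El τ) {σ τ : Ty}
    (b : Term (Ctx.Ext V σ) σ → Term (Ctx.Ext V σ) τ) (a : M.El σ) :
    M.app (M.eval ρ (fn σ b)) a = M.eval (M.cons a ρ) (b (.var .new)) :=
  M.eval_lam _ _ _

end Combinators

/-! ### Numbers and quantifier-free induction in a model -/

section Numbers

instance : Zero (M.El .nat) := ⟨M.const .zero⟩

/-- The successor function. -/
def succ (n : M.El .nat) : M.El .nat := M.app (M.const .succ) n

/-- The recursor of type `0`. -/
def recur (f : M.El (.nat ⇢ .nat ⇢ .nat)) (m n : M.El .nat) : M.El .nat :=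
  M.app (M.app (M.app (M.const .recur) f) m) n

@[simp] theorem eval_zero (ρ : ∀ τ, V τ → M.El τ) : M.eval ρ zero = 0 := rfl

@[simp] theorem eval_succ (ρ : ∀ τ, V τ → M.El τ) (t : Term V .nat) :
    M.eval ρ (RCAomega.succ t) = M.succ (M.eval ρ t) := rfl

@[simp] theorem eval_recur (ρ : ∀ τ, V τ → M.El τ) (f : Term V (.nat ⇢ .nat ⇢ .nat))
    (m n : Term V .nat) :
    M.eval ρ (RCAomega.recur f m n) = M.recur (M.eval ρ f) (M.eval ρ m) (M.eval ρ n) := rfl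

variable {M} in
theorem succ_ne_zero (n : M.El .nat) : M.succ n ≠ 0 :=
  IsModel.sat M.self (.succ_ne_zero (.var n))

variable {M} in
theorem succ_injective : Function.Injective M.succ := fun m n =>
  IsModel.sat M.self (.succ_inj (.var m) (.var n))

variable {M} in
-- One recursive definition, read in two contexts, yields different step terms; they agree
-- pointwise, and this lemma identifies the results.
theorem recur_congr {f g : M.El (.nat ⇢ .nat ⇢ .nat)} {m n : M.El .nat}
    (h : ∀ a b, M.app (M.app f a) b = g a b) : M.recur f m n = M.recur g m n := by
  rw [ext fun a => ext (h a)]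

@[simp] theorem recur_zero (f : M.El (.nat ⇢ .nat ⇢ .nat)) (m : M.El .nat) :
    M.recur f m 0 = m :=
  IsModel.sat M.self (.recur_zero (.var f) (.var m))

@[simp] theorem recur_succ (f : M.El (.nat ⇢ .nat ⇢ .nat)) (m n : M.El .nat) :
    M.recur f m (M.succ n) = f n (M.recur f m n) :=
  IsModel.sat M.self (.recur_succ (.var f) (.var m) (.var n))

theorem formula_induction {A : Formula (Ctx.Ext M.El .nat)} (hA : A.QuantFree)
    (h₀ : M.Sat (M.cons 0 M.self) A)
    (h₁ : ∀ n, M.Sat (M.cons n M.self) A → M.Sat (M.cons (M.succ n) M.self) A) (n : M.El .nat) :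
    M.Sat (M.cons n M.self) A := by
  refine IsModel.sat M.self (.induction A hA) ?_ ?_ n
  · rw [Formula.inst, sat_subst, eval_consSubst]
    exact h₀
  · intro n h
    rw [sat_subst, eval_consSubst]
    exact h₁ n h

/-- Functions on numbers that are given by a term with parameters. -/
@[fun_prop] def Internal (F : M.El .nat → M.El .nat) : Prop :=
  ∃ t : Term (Ctx.Ext M.El .nat) .nat, ∀ n, M.eval (M.cons n M.self) t = F n

/-- Predicates on numbers that are given by a quantifier-free formula with parameters. -/
def QF (P : M.El .nat → Prop) : Prop :=
  ∃ A : Formula (Ctx.Ext M.El .nat), A.QuantFree ∧ ∀ n, M.Sat (M.cons n M.self) A ↔ P n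

variable {M}

/-- The only induction on the numbers of `M`. Every use must exhibit its predicate as
quantifier-free, which the closure rules for `QF` and `Internal` provide. -/
theorem QF.induction {P : M.El .nat → Prop} (hP : M.QF P) (h₀ : P 0)
    (h₁ : ∀ n, P n → P (M.succ n)) (n : M.El .nat) : P n := by
  obtain ⟨A, hA, h⟩ := hP
  simp only [← h] at *
  exact M.formula_induction hA h₀ h₁ n

theorem QF.imp {P Q : M.El .nat → Prop} (hP : M.QF P) (hQ : M.QF Q) :
    M.QF fun n => P n → Q n := by
  obtain ⟨A, hA, h⟩ := hP
  obtain ⟨B, hB, h'⟩ := hQ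
  exact ⟨A ⟹ B, ⟨hA, hB⟩, fun n => imp_congr (h n) (h' n)⟩

theorem QF.false : M.QF fun _ => False := ⟨.bot, trivial, fun _ => Iff.rfl⟩

theorem QF.not {P : M.El .nat → Prop} (hP : M.QF P) : M.QF fun n => ¬ P n := hP.imp .false

theorem QF.or {P Q : M.El .nat → Prop} (hP : M.QF P) (hQ : M.QF Q) :
    M.QF fun n => P n ∨ Q n := by
  simpa only [or_iff_not_imp_left] using hP.not.imp hQ

theorem QF.and {P Q : M.El .nat → Prop} (hP : M.QF P) (hQ : M.QF Q) :
    M.QF fun n => P n ∧ Q n := by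
  simpa only [not_or, not_not] using (hP.not.or hQ.not).not

theorem QF.eq {F G : M.El .nat → M.El .nat} (hF : M.Internal F) (hG : M.Internal G) :
    M.QF fun n => F n = G n := by
  obtain ⟨s, hs⟩ := hF
  obtain ⟨t, ht⟩ := hG
  exact ⟨s ≐ t, trivial, fun n => by simp [hs, ht]⟩

@[fun_prop] theorem Internal.id : M.Internal fun n => n := ⟨.var .new, fun _ => rfl⟩

@[fun_prop] theorem Internal.const (a : M.El .nat) : M.Internal fun _ => a :=
  ⟨.var (.old a), fun _ => rfl⟩

@[fun_prop] theorem Internal.app (f : M.El .one) {F : M.El .nat → M.El .nat}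
    (hF : M.Internal F) : M.Internal fun n => M.app f (F n) := by
  obtain ⟨t, ht⟩ := hF
  exact ⟨.var (.old f) ⬝ t, fun n => by simp [ht]⟩

@[fun_prop] theorem Internal.comp {F G : M.El .nat → M.El .nat} (hF : M.Internal F)
    (hG : M.Internal G) : M.Internal fun n => F (G n) := by
  obtain ⟨s, hs⟩ := hF
  obtain ⟨t, ht⟩ := hG
  refine ⟨s.subst (consSubst t fun _ x => .var (.old x)), fun n => ?_⟩
  rw [eval_subst, eval_consSubst, ht]
  exact hs (G n)

theorem Internal.app₂ (f : M.El (.nat ⇢ .nat ⇢ .nat)) {F G : M.El .nat → M.El .nat}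
    (hF : M.Internal F) (hG : M.Internal G) : M.Internal fun n => M.app (M.app f (F n)) (G n) := by
  obtain ⟨s, hs⟩ := hF
  obtain ⟨t, ht⟩ := hG
  exact ⟨.var (.old f) ⬝ s ⬝ t, fun n => by simp [hs, ht]⟩

@[fun_prop] theorem Internal.succ {F : M.El .nat → M.El .nat} (hF : M.Internal F) :
    M.Internal fun n => M.succ (F n) :=
  .app _ hF

end Numbers

section Arithmetic

variable (M : Str) [M.IsModel] {V W : Ctx}

instance : One (M.El .nat) := ⟨M.succ 0⟩

instance : Add (M.El .nat) := ⟨fun m n => M.app (M.app (M.eval M.self plusC) m) n⟩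

instance : Mul (M.El .nat) := ⟨fun m n => M.app (M.app (M.eval M.self timesC) m) n⟩

instance : Sub (M.El .nat) := ⟨fun m n => M.app (M.app (M.eval M.self monusC) m) n⟩

/-- The predecessor function. -/
def pred (n : M.El .nat) : M.El .nat := M.app (M.eval M.self predC) n

-- The operation on `M` is read off in the context of all parameters; extensionality shows that
-- `plusC` has the same value in every other context.
@[simp] theorem eval_plus (ρ : ∀ τ, V τ → M.El τ) (s t : Term V .nat) :
    M.eval ρ (plus s t) = M.eval ρ s + M.eval ρ t := by
  refine congrArg (fun c => M.app (M.app c _) _) (ext fun a => ext fun b => ?_)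
  simp only [plusC, eval_fn, eval_recur, eval_wk, eval_var, cons_new]
  exact recur_congr fun a b => by simp

@[simp] theorem eval_times (ρ : ∀ τ, V τ → M.El τ) (s t : Term V .nat) :
    M.eval ρ (times s t) = M.eval ρ s * M.eval ρ t := by
  refine congrArg (fun c => M.app (M.app c _) _) (ext fun a => ext fun b => ?_)
  simp only [timesC, eval_fn, eval_recur, eval_var, cons_new, eval_zero]
  exact recur_congr fun a b => by simp

@[simp] theorem eval_pred (ρ : ∀ τ, V τ → M.El τ) (t : Term V .nat) :
    M.eval ρ (RCAomega.pred t) = M.pred (M.eval ρ t) := by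
  refine congrArg (fun c => M.app c _) (ext fun a => ?_)
  simp only [predC, eval_fn, eval_recur, eval_var, cons_new, eval_zero]
  exact recur_congr fun a b => by simp

@[simp] theorem eval_monus (ρ : ∀ τ, V τ → M.El τ) (s t : Term V .nat) :
    M.eval ρ (monus s t) = M.eval ρ s - M.eval ρ t := by
  refine congrArg (fun c => M.app (M.app c _) _) (ext fun a => ext fun b => ?_)
  simp only [monusC, eval_fn, eval_recur, eval_wk, eval_var, cons_new]
  exact recur_congr fun a b => by simp

variable {M}

@[fun_prop] theorem Internal.add {F G : M.El .nat → M.El .nat} (hF : M.Internal F)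
    (hG : M.Internal G) : M.Internal fun n => F n + G n := .app₂ _ hF hG

@[fun_prop] theorem Internal.mul {F G : M.El .nat → M.El .nat} (hF : M.Internal F)
    (hG : M.Internal G) : M.Internal fun n => F n * G n := .app₂ _ hF hG

@[fun_prop] theorem Internal.sub {F G : M.El .nat → M.El .nat} (hF : M.Internal F)
    (hG : M.Internal G) : M.Internal fun n => F n - G n := .app₂ _ hF hG

@[fun_prop] theorem Internal.pred {F : M.El .nat → M.El .nat} (hF : M.Internal F) :
    M.Internal fun n => M.pred (F n) := .app _ hF

theorem ind_eq {F G : M.El .nat → M.El .nat} (h₀ : F 0 = G 0)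
    (h₁ : ∀ n, F n = G n → F (M.succ n) = G (M.succ n)) (n : M.El .nat)
    (hF : M.Internal F := by fun_prop) (hG : M.Internal G := by fun_prop) : F n = G n :=
  (QF.eq hF hG).induction h₀ h₁ n

end Arithmetic
end Str

/-! ### The numbers of a model as an ordered semiring -/

namespace Str
section Arithmetic

variable {M : Str} [M.IsModel]

theorem one_eq : (1 : M.El .nat) = M.succ 0 := rfl

protected theorem add_zero (m : M.El .nat) : m + 0 = m := by
  change M.app (M.app (M.eval M.self plusC) m) 0 = m
  simp [plusC]

protected theorem add_succ (m n : M.El .nat) : m + M.succ n = M.succ (m + n) := by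
  change M.app (M.app (M.eval M.self plusC) m) _ =
    M.succ (M.app (M.app (M.eval M.self plusC) m) n)
  simp only [plusC, eval_fn, eval_recur, recur_succ, eval_wk, eval_var, cons_new, eval_succ]
  exact congrArg M.succ (recur_congr fun a b => by simp)

protected theorem mul_zero (m : M.El .nat) : m * 0 = 0 := by
  change M.app (M.app (M.eval M.self timesC) m) 0 = 0
  simp [timesC]

protected theorem mul_succ (m n : M.El .nat) : m * M.succ n = m * n + m := by
  change M.app (M.app (M.eval M.self timesC) m) _ =
    M.app (M.app (M.eval M.self timesC) m) n + m
  simp only [timesC, eval_fn, eval_recur, recur_succ, eval_wk, eval_var, cons_new, eval_plus]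
  exact congrArg (· + m) (recur_congr fun a b => by simp)

@[simp] theorem pred_zero : M.pred 0 = 0 := by
  simp [Str.pred, predC]

@[simp] theorem pred_succ (n : M.El .nat) : M.pred (M.succ n) = n := by
  simp [Str.pred, predC]

protected theorem sub_zero (m : M.El .nat) : m - 0 = m := by
  change M.app (M.app (M.eval M.self monusC) m) 0 = m
  simp [monusC]

protected theorem sub_succ (m n : M.El .nat) : m - M.succ n = M.pred (m - n) := by
  change M.app (M.app (M.eval M.self monusC) m) _ =
    M.pred (M.app (M.app (M.eval M.self monusC) m) n)
  simp only [monusC, eval_fn, eval_recur, recur_succ, eval_wk, eval_var, cons_new, eval_pred]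
  exact congrArg M.pred (recur_congr fun a b => by simp)

protected theorem zero_add (n : M.El .nat) : 0 + n = n :=
  ind_eq (F := fun n => 0 + n) (G := fun n => n) (Str.add_zero _)
    (fun n h => by simp only [Str.add_succ, h]) n

protected theorem succ_add (m n : M.El .nat) : M.succ m + n = M.succ (m + n) :=
  ind_eq (F := fun n => M.succ m + n) (G := fun n => M.succ (m + n))
    (by simp only [Str.add_zero]) (fun n h => by simp only [Str.add_succ, h]) n

protected theorem add_comm (m n : M.El .nat) : m + n = n + m :=
  ind_eq (F := fun n => m + n) (G := fun n => n + m)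
    (by simp only [Str.add_zero, Str.zero_add])
    (fun n h => by simp only [Str.add_succ, Str.succ_add, h]) n

protected theorem add_assoc (k m n : M.El .nat) : k + m + n = k + (m + n) :=
  ind_eq (F := fun n => k + m + n) (G := fun n => k + (m + n))
    (by simp only [Str.add_zero]) (fun n h => by simp only [Str.add_succ, h]) n

instance : AddCommMonoid (M.El .nat) where
  add_assoc := Str.add_assoc
  zero_add := Str.zero_add
  add_zero := Str.add_zero
  add_comm := Str.add_comm
  nsmul := nsmulRec

protected theorem zero_mul (n : M.El .nat) : 0 * n = 0 :=
  ind_eq (F := fun n => 0 * n) (G := fun _ => 0) (Str.mul_zero _)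
    (fun n h => by simp only [Str.mul_succ, h, Str.add_zero]) n

protected theorem succ_mul (m n : M.El .nat) : M.succ m * n = m * n + n :=
  ind_eq (F := fun n => M.succ m * n) (G := fun n => m * n + n)
    (by simp only [Str.mul_zero, Str.add_zero])
    (fun n h => by simp only [Str.mul_succ, h, Str.add_succ, add_right_comm]) n

protected theorem mul_comm (m n : M.El .nat) : m * n = n * m :=
  ind_eq (F := fun n => m * n) (G := fun n => n * m)
    (by simp only [Str.mul_zero, Str.zero_mul])
    (fun n h => by simp only [Str.mul_succ, Str.succ_mul, h]) n

protected theorem mul_add (k m n : M.El .nat) : k * (m + n) = k * m + k * n :=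
  ind_eq (F := fun n => k * (m + n)) (G := fun n => k * m + k * n)
    (by simp only [Str.mul_zero, Str.add_zero])
    (fun n h => by simp only [Str.add_succ, Str.mul_succ, h, Str.add_assoc]) n

protected theorem mul_assoc (k m n : M.El .nat) : k * m * n = k * (m * n) :=
  ind_eq (F := fun n => k * m * n) (G := fun n => k * (m * n))
    (by simp only [Str.mul_zero]) (fun n h => by simp only [Str.mul_succ, Str.mul_add, h]) n

protected theorem mul_one (m : M.El .nat) : m * 1 = m := by
  rw [one_eq, Str.mul_succ, Str.mul_zero, Str.zero_add]

instance : CommSemiring (M.El .nat) where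
  left_distrib := Str.mul_add
  right_distrib a b c := by
    rw [Str.mul_comm, Str.mul_add, Str.mul_comm c, Str.mul_comm c]
  zero_mul := Str.zero_mul
  mul_zero := Str.mul_zero
  mul_assoc := Str.mul_assoc
  one_mul n := by rw [Str.mul_comm, Str.mul_one]
  mul_one := Str.mul_one
  mul_comm := Str.mul_comm

theorem succ_eq (n : M.El .nat) : M.succ n = n + 1 := by
  rw [one_eq, Str.add_succ, add_zero]

@[simp] theorem pred_add_one (n : M.El .nat) : M.pred (n + 1) = n := by
  rw [← succ_eq, pred_succ]

theorem add_one_ne_zero (n : M.El .nat) : n + 1 ≠ 0 := by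
  rw [← succ_eq]
  exact succ_ne_zero n

theorem induction {P : M.El .nat → Prop} (hP : M.QF P) (h₀ : P 0) (h₁ : ∀ n, P n → P (n + 1))
    (n : M.El .nat) : P n :=
  hP.induction h₀ (fun n h => succ_eq n ▸ h₁ n h) n

theorem induction_eq {F G : M.El .nat → M.El .nat} (h₀ : F 0 = G 0)
    (h₁ : ∀ n, F n = G n → F (n + 1) = G (n + 1)) (n : M.El .nat)
    (hF : M.Internal F := by fun_prop) (hG : M.Internal G := by fun_prop) : F n = G n :=
  induction (QF.eq hF hG) h₀ h₁ n

/-- Naming the predecessor by `pred`, instead of asserting its existence, keeps the predicate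
quantifier-free. -/
theorem eq_zero_or_eq_add_one (n : M.El .nat) : n = 0 ∨ n = M.pred n + 1 :=
  induction (P := fun n => n = 0 ∨ n = M.pred n + 1)
    (.or (.eq (by fun_prop) (by fun_prop)) (.eq (by fun_prop) (by fun_prop)))
    (.inl rfl) (fun n _ => .inr (by rw [pred_add_one])) n

theorem exists_eq_add_one {n : M.El .nat} (h : n ≠ 0) : ∃ m, n = m + 1 :=
  ⟨_, (eq_zero_or_eq_add_one n).resolve_left h⟩

instance : IsRightCancelAdd (M.El .nat) where
  add_right_cancel k m n (h : m + k = n + k) := by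
    have : m + k = n + k → m = n :=
      induction (P := fun k => m + k = n + k → m = n)
        (.imp (.eq (by fun_prop) (by fun_prop)) (.eq (by fun_prop) (by fun_prop)))
        (fun h => by simpa using h)
        (fun k ih h => ih (succ_injective (by simpa only [succ_eq, add_assoc] using h))) k
    exact this h

instance : IsCancelAdd (M.El .nat) := AddCommMagma.IsRightCancelAdd.toIsCancelAdd _

theorem add_eq_zero_left {m n : M.El .nat} (h : m + n = 0) : n = 0 := by
  by_contra hn
  obtain ⟨k, rfl⟩ := exists_eq_add_one hn
  rw [← add_assoc] at h
  exact add_one_ne_zero _ h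

theorem sub_add_one (m n : M.El .nat) : m - (n + 1) = M.pred (m - n) := by
  rw [← succ_eq, Str.sub_succ]

protected theorem add_sub_add_right (k m n : M.El .nat) : m + k - (n + k) = m - n := by
  refine induction_eq (F := fun k => m + k - (n + k)) (G := fun _ => m - n) (by simp) ?_ k
  intro k h
  have (a b : M.El .nat) : a + 1 - (b + 1) = a - b :=
    induction_eq (F := fun b => a + 1 - (b + 1)) (G := fun b => a - b)
      (by rw [zero_add, ← zero_add (1 : M.El .nat), sub_add_one, Str.sub_zero,
        zero_add, pred_add_one, Str.sub_zero])
      (fun b h => by rw [sub_add_one, h, sub_add_one]) b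
  rw [← add_assoc, ← add_assoc, this, h]

protected theorem add_sub_cancel_left (m n : M.El .nat) : m + n - m = n := by
  simpa [Str.sub_zero, add_comm] using Str.add_sub_add_right m n 0

protected theorem zero_sub (n : M.El .nat) : 0 - n = 0 :=
  induction_eq (F := fun n => 0 - n) (G := fun _ => 0) (Str.sub_zero _)
    (fun n h => by simp only [sub_add_one, h, pred_zero]) n

protected theorem sub_add_self (m n : M.El .nat) : m - (m + n) = 0 := by
  simpa [Str.zero_sub, add_comm] using Str.add_sub_add_right m 0 n

/-- Totality of the order in a form without quantifiers: truncated subtraction names the difference,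
so quantifier-free induction applies. -/
theorem sub_dichotomy (m n : M.El .nat) :
    (m - n = 0 ∧ m + (n - m) = n) ∨ (m - n ≠ 0 ∧ n + (m - n) = m) := by
  refine induction (P := fun n => (m - n = 0 ∧ m + (n - m) = n) ∨ (m - n ≠ 0 ∧ n + (m - n) = m))
    (.or (.and (.eq (by fun_prop) (by fun_prop)) (.eq (by fun_prop) (by fun_prop)))
      (.and (.not (.eq (by fun_prop) (by fun_prop))) (.eq (by fun_prop) (by fun_prop)))) ?_ ?_ n
  · by_cases h : m = 0 <;> simp [h, Str.sub_zero]
  · rintro n (⟨h₁, h₂⟩ | ⟨h₁, h₂⟩)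
    · left
      rw [sub_add_one, h₁, pred_zero]
      refine ⟨rfl, ?_⟩
      conv_lhs => rw [← h₂, add_assoc, Str.add_sub_cancel_left]
      rw [← add_assoc, h₂]
    · obtain ⟨k, hk⟩ := exists_eq_add_one h₁
      have hm : m = n + 1 + k := by rw [← h₂, hk]; ring
      rw [sub_add_one, hk, pred_add_one, hm]
      by_cases h : k = 0
      · left
        simp only [h, add_zero]
        have := Str.sub_add_self (n + 1) 0
        rw [add_zero] at this
        exact ⟨trivial, by rw [this, add_zero]⟩
      · exact .inr ⟨h, rfl⟩

/-- The order of the numbers of a model. -/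
instance : LE (M.El .nat) := ⟨fun m n => m - n = 0⟩

theorem le_def {m n : M.El .nat} : m ≤ n ↔ m - n = 0 := Iff.rfl

protected theorem le_iff_exists_add {m n : M.El .nat} : m ≤ n ↔ ∃ k, n = m + k := by
  refine ⟨fun h => ⟨n - m, ?_⟩, ?_⟩
  · exact ((sub_dichotomy m n).resolve_right fun h' => h'.1 h).2.symm
  · rintro ⟨k, rfl⟩
    exact Str.sub_add_self m k

open Classical in
noncomputable instance : LinearOrder (M.El .nat) where
  le_refl m := Str.le_iff_exists_add.2 ⟨0, (add_zero m).symm⟩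
  le_trans a b c h₁ h₂ := by
    obtain ⟨k, rfl⟩ := Str.le_iff_exists_add.1 h₁
    obtain ⟨l, rfl⟩ := Str.le_iff_exists_add.1 h₂
    exact Str.le_iff_exists_add.2 ⟨k + l, add_assoc _ _ _⟩
  le_antisymm a b h₁ h₂ := by
    obtain ⟨k, rfl⟩ := Str.le_iff_exists_add.1 h₁
    obtain ⟨l, h⟩ := Str.le_iff_exists_add.1 h₂
    rw [add_assoc, left_eq_add, add_comm] at h
    rw [add_eq_zero_left h, add_zero]
  le_total a b := by
    rcases sub_dichotomy a b with h | h
    · exact .inl (Str.le_iff_exists_add.2 ⟨_, h.2.symm⟩)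
    · exact .inr (Str.le_iff_exists_add.2 ⟨_, h.2.symm⟩)
  toDecidableLE := Classical.decRel _

instance : CanonicallyOrderedAdd (M.El .nat) where
  exists_add_of_le := Str.le_iff_exists_add.1
  le_self_add _ b := Str.le_iff_exists_add.2 ⟨b, rfl⟩
  le_add_self _ b := Str.le_iff_exists_add.2 ⟨b, add_comm _ _⟩

instance : IsOrderedAddMonoid (M.El .nat) where
  add_le_add_left a b h c := by
    obtain ⟨k, rfl⟩ := Str.le_iff_exists_add.1 h
    exact Str.le_iff_exists_add.2 ⟨k, by ring⟩

instance : IsOrderedCancelAddMonoid (M.El .nat) where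
  le_of_add_le_add_left a b c h := by
    obtain ⟨k, h⟩ := Str.le_iff_exists_add.1 h
    rw [add_assoc] at h
    exact Str.le_iff_exists_add.2 ⟨k, add_left_cancel h⟩

instance : Nontrivial (M.El .nat) := ⟨1, 0, succ_ne_zero 0⟩

theorem lt_iff_add_one_le {m n : M.El .nat} : m < n ↔ m + 1 ≤ n := by
  constructor
  · intro h
    obtain ⟨k, rfl⟩ := Str.le_iff_exists_add.1 h.le
    have hk : k ≠ 0 := by
      rintro rfl
      simp at h
    obtain ⟨l, rfl⟩ := exists_eq_add_one hk
    exact Str.le_iff_exists_add.2 ⟨l, by ring⟩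
  · intro h
    refine lt_of_lt_of_le (lt_of_le_of_ne le_self_add fun h => ?_) h
    exact one_ne_zero (left_eq_add.1 h)

theorem lt_add_one_iff {m n : M.El .nat} : m < n + 1 ↔ m ≤ n := by
  rw [lt_iff_add_one_le, add_le_add_iff_right]

theorem one_le_of_pos {n : M.El .nat} (h : 0 < n) : 1 ≤ n := by
  simpa using lt_iff_add_one_le.1 h

theorem exists_eq_add_one_of_pos {n : M.El .nat} (h : 0 < n) : ∃ m, n = m + 1 :=
  exists_eq_add_one h.ne'

protected theorem mul_lt_mul_of_pos {k m n : M.El .nat} (hk : 0 < k) (h : m < n) :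
    k * m < k * n := by
  obtain ⟨l, rfl⟩ := Str.le_iff_exists_add.1 (lt_iff_add_one_le.1 h)
  obtain ⟨k, rfl⟩ := exists_eq_add_one_of_pos hk
  rw [lt_iff_add_one_le]
  exact Str.le_iff_exists_add.2 ⟨k + (k + 1) * l, by ring⟩

instance : IsStrictOrderedRing (M.El .nat) where
  zero_le_one := zero_le
  mul_lt_mul_of_pos_left _ hk _ _ h := Str.mul_lt_mul_of_pos hk h
  mul_lt_mul_of_pos_right k hk m n h := by
    simpa only [mul_comm k] using Str.mul_lt_mul_of_pos hk h

theorem QF.le {F G : M.El .nat → M.El .nat} (hF : M.Internal F) (hG : M.Internal G) :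
    M.QF fun n => F n ≤ G n :=
  .eq (F := fun n => F n - G n) (by fun_prop) (by fun_prop)

theorem QF.lt {F G : M.El .nat → M.El .nat} (hF : M.Internal F) (hG : M.Internal G) :
    M.QF fun n => F n < G n := by
  simpa only [not_le] using (QF.le hG hF).not

variable {V : Ctx}

@[simp] theorem sat_le (ρ : ∀ τ, V τ → M.El τ) (s t : Term V .nat) :
    M.Sat ρ (le s t) ↔ M.eval ρ s ≤ M.eval ρ t := by
  simp [le, le_def]

@[simp] theorem sat_lt (ρ : ∀ τ, V τ → M.El τ) (s t : Term V .nat) :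
    M.Sat ρ (lt s t) ↔ M.eval ρ s < M.eval ρ t := by
  simp [lt, lt_iff_add_one_le, succ_eq]

/-! ### Powers of two -/

variable (M) in
/-- The function `2 ^ n`. -/
def pow2 (n : M.El .nat) : M.El .nat := M.app (M.eval M.self pow2C) n

@[simp] theorem eval_pow2 (ρ : ∀ τ, V τ → M.El τ) (t : Term V .nat) :
    M.eval ρ (RCAomega.pow2 t) = M.pow2 (M.eval ρ t) := by
  refine congrArg (fun c => M.app c _) (ext fun a => ?_)
  simp only [pow2C, eval_fn, eval_recur, eval_var, cons_new, eval_zero, eval_succ]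
  exact recur_congr fun a b => by simp

@[fun_prop] theorem Internal.pow2 {F : M.El .nat → M.El .nat} (hF : M.Internal F) :
    M.Internal fun n => M.pow2 (F n) := .app _ hF

@[simp] theorem pow2_zero : M.pow2 0 = 1 := by
  simp [Str.pow2, pow2C, one_eq]

@[simp] theorem pow2_add_one (n : M.El .nat) : M.pow2 (n + 1) = M.pow2 n + M.pow2 n := by
  rw [← succ_eq]
  change M.app (M.eval M.self pow2C) _ =
    M.app (M.eval M.self pow2C) n + M.app (M.eval M.self pow2C) n
  simp only [pow2C, eval_fn, eval_recur, recur_succ, eval_var, cons_new, eval_plus,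
    eval_succ, eval_zero]
  rw [recur_congr]
  intro a b
  simp

theorem lt_pow2 (n : M.El .nat) : n < M.pow2 n := by
  refine induction (P := fun n => n < M.pow2 n) (.lt (by fun_prop) (by fun_prop)) (by simp) ?_ n
  intro n h
  rw [pow2_add_one]
  exact add_lt_add_of_lt_of_le h (one_le_of_pos (zero_le.trans_lt h))

theorem pow2_pos (n : M.El .nat) : 0 < M.pow2 n := zero_le.trans_lt (lt_pow2 n)

theorem pow2_add (m n : M.El .nat) : M.pow2 (m + n) = M.pow2 m * M.pow2 n :=
  induction_eq (F := fun n => M.pow2 (m + n)) (G := fun n => M.pow2 m * M.pow2 n) (by simp)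
    (fun n h => by rw [← add_assoc, pow2_add_one, h, pow2_add_one, mul_add]) n

theorem pow2_mono : Monotone M.pow2 := by
  intro m n h
  obtain ⟨k, rfl⟩ := Str.le_iff_exists_add.1 h
  rw [pow2_add]
  exact le_mul_of_one_le_right (zero_le) (one_le_of_pos (pow2_pos k))

/-! ### Pairing -/

variable (M) in
/-- The triangular numbers. -/
def tri (n : M.El .nat) : M.El .nat := M.app (M.eval M.self triC) n

@[simp] theorem eval_tri (ρ : ∀ τ, V τ → M.El τ) (t : Term V .nat) :
    M.eval ρ (RCAomega.tri t) = M.tri (M.eval ρ t) := by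
  refine congrArg (fun c => M.app c _) (ext fun a => ?_)
  simp only [triC, eval_fn, eval_recur, eval_var, cons_new, eval_zero]
  exact recur_congr fun a b => by simp

@[fun_prop] theorem Internal.tri {F : M.El .nat → M.El .nat} (hF : M.Internal F) :
    M.Internal fun n => M.tri (F n) := .app _ hF

@[simp] theorem tri_zero : M.tri 0 = 0 := by
  simp [Str.tri, triC]

@[simp] theorem tri_add_one (n : M.El .nat) : M.tri (n + 1) = M.tri n + (n + 1) := by
  simp only [← succ_eq]
  change M.app (M.eval M.self triC) _ = M.app (M.eval M.self triC) n + _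
  simp only [triC, eval_fn, eval_recur, recur_succ, eval_wk, eval_var, cons_new, eval_plus,
    eval_succ, eval_zero]
  rw [recur_congr]
  intro a b
  simp

theorem tri_mono : Monotone M.tri := by
  intro m n h
  obtain ⟨k, rfl⟩ := Str.le_iff_exists_add.1 h
  refine induction (P := fun k => M.tri m ≤ M.tri (m + k)) (.le (by fun_prop) (by fun_prop))
    (by simp) (fun k h => ?_) k
  rw [← add_assoc, tri_add_one]
  exact h.trans le_self_add

variable (M) in
/-- The inverse of the triangular numbers. -/
def triRoot (n : M.El .nat) : M.El .nat := M.app (M.eval M.self triRootC) n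

@[simp] theorem eval_triRoot (ρ : ∀ τ, V τ → M.El τ) (t : Term V .nat) :
    M.eval ρ (RCAomega.triRoot t) = M.triRoot (M.eval ρ t) := by
  refine congrArg (fun c => M.app c _) (ext fun a => ?_)
  simp only [triRootC, eval_fn, eval_recur, eval_var, cons_new, eval_zero]
  exact recur_congr fun a b => by simp

@[fun_prop] theorem Internal.triRoot {F : M.El .nat → M.El .nat} (hF : M.Internal F) :
    M.Internal fun n => M.triRoot (F n) := .app _ hF

@[simp] theorem triRoot_zero : M.triRoot 0 = 0 := by
  simp [Str.triRoot, triRootC]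

theorem triRoot_add_one (n : M.El .nat) :
    M.triRoot (n + 1) = M.triRoot n + (1 - (M.tri (M.triRoot n + 1) - (n + 1))) := by
  simp only [← succ_eq]
  change M.app (M.eval M.self triRootC) _ = M.app (M.eval M.self triRootC) n +
    (1 - (M.tri (M.succ (M.app (M.eval M.self triRootC) n)) - _))
  simp only [triRootC, eval_fn, eval_recur, recur_succ, eval_wk, eval_var, cons_new, eval_plus,
    eval_succ, eval_zero, eval_monus, eval_tri]
  rw [recur_congr, one_eq]
  intro a b
  simp

theorem triRoot_spec (n : M.El .nat) :
    M.tri (M.triRoot n) ≤ n ∧ n < M.tri (M.triRoot n + 1) := by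
  refine induction (P := fun n => M.tri (M.triRoot n) ≤ n ∧ n < M.tri (M.triRoot n + 1))
    (.and (.le (by fun_prop) (by fun_prop)) (.lt (by fun_prop) (by fun_prop)))
    ⟨by simp, by rw [triRoot_zero, tri_add_one]; simp⟩ ?_ n
  rintro n ⟨h₁, h₂⟩
  rw [triRoot_add_one]
  -- The increment `1 - (tri (w + 1) - (n + 1))` is `1` exactly when `n + 1` has reached the next
  -- triangular number, and `0` otherwise.
  by_cases h : M.tri (M.triRoot n + 1) ≤ n + 1
  · rw [le_def.1 h, Str.sub_zero]
    refine ⟨h, ?_⟩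
    rw [tri_add_one (_ + 1)]
    exact add_lt_add_of_lt_of_le h₂ le_add_self
  · have h' : M.tri (M.triRoot n + 1) - (n + 1) ≠ 0 := h
    have h'' : (1 : M.El .nat) - (M.tri (M.triRoot n + 1) - (n + 1)) = 0 := by
      rw [← le_def]
      exact one_le_of_pos (pos_iff_ne_zero.2 h')
    rw [h'', add_zero]
    exact ⟨h₁.trans le_self_add, not_le.1 h⟩

theorem triRoot_unique {n w : M.El .nat} (h₁ : M.tri w ≤ n) (h₂ : n < M.tri (w + 1)) :
    M.triRoot n = w := by
  obtain ⟨h₃, h₄⟩ := triRoot_spec n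
  refine le_antisymm ?_ ?_ <;> by_contra h <;>
    have := tri_mono (lt_iff_add_one_le.1 (not_le.1 h))
  · exact absurd (h₂.trans_le this) (not_lt.2 h₃)
  · exact absurd (h₄.trans_le this) (not_lt.2 h₁)

variable (M) in
/-- The second component of a pair. -/
def snd (n : M.El .nat) : M.El .nat := n - M.tri (M.triRoot n)

variable (M) in
/-- The first component of a pair. -/
def fst (n : M.El .nat) : M.El .nat := M.triRoot n - M.snd n

/-- The Cantor pairing function. -/
def pair (m n : M.El .nat) : M.El .nat := M.tri (m + n) + n

@[simp] theorem eval_pair (ρ : ∀ τ, V τ → M.El τ) (s t : Term V .nat) :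
    M.eval ρ (RCAomega.pair s t) = pair (M.eval ρ s) (M.eval ρ t) := by
  simp [RCAomega.pair, pairC, pair]

@[simp] theorem eval_snd (ρ : ∀ τ, V τ → M.El τ) (t : Term V .nat) :
    M.eval ρ (RCAomega.snd t) = M.snd (M.eval ρ t) := by
  simp [RCAomega.snd, sndC, Str.snd]

@[simp] theorem eval_fst (ρ : ∀ τ, V τ → M.El τ) (t : Term V .nat) :
    M.eval ρ (RCAomega.fst t) = M.fst (M.eval ρ t) := by
  simp [RCAomega.fst, fstC, Str.fst]

/-- The number `tri (m + n) + n` lies below `tri (m + n + 1)` because `n < m + n + 1`. -/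
theorem triRoot_pair (m n : M.El .nat) : M.triRoot (pair m n) = m + n := by
  refine triRoot_unique le_self_add ?_
  rw [pair, tri_add_one, add_lt_add_iff_left, lt_add_one_iff]
  exact le_add_self

@[simp] theorem snd_pair (m n : M.El .nat) : M.snd (pair m n) = n := by
  rw [Str.snd, triRoot_pair, pair, Str.add_sub_cancel_left]

@[simp] theorem fst_pair (m n : M.El .nat) : M.fst (pair m n) = m := by
  rw [Str.fst, triRoot_pair, snd_pair, add_comm, Str.add_sub_cancel_left]

end Arithmetic

end Str

/-! ### The ordered ring of differences of an ordered semiring -/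

section Differences

variable (N : Type*) [CommSemiring N] [LinearOrder N] [IsStrictOrderedRing N]

/-- Pairs of numbers with the same difference. -/
def diffSetoid : Setoid (N × N) where
  r p q := p.1 + q.2 = q.1 + p.2
  iseqv := ⟨fun _ => rfl, fun h => h.symm, fun {p q r} h₁ h₂ => by
    have : p.1 + r.2 + (q.1 + q.2) = r.1 + p.2 + (q.1 + q.2) := by
      calc _ = (p.1 + q.2) + (q.1 + r.2) := by ring
        _ = _ := by rw [h₁, h₂]; ring
    exact add_right_cancel this⟩

/-- The ring of differences. -/
def Diff : Type _ := Quotient (diffSetoid N)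

namespace Diff

variable {N}

/-- The difference of two numbers. -/
def mk (a b : N) : Diff N := Quotient.mk (diffSetoid N) (a, b)

theorem mk_eq {a b c d : N} : mk a b = mk c d ↔ a + d = c + b :=
  Quotient.eq (r := diffSetoid N)

theorem exists_mk (x : Diff N) : ∃ a b, x = mk a b := by
  obtain ⟨⟨a, b⟩, rfl⟩ := Quotient.exists_rep x
  exact ⟨a, b, rfl⟩

instance : Zero (Diff N) := ⟨mk 0 0⟩

instance : One (Diff N) := ⟨mk 1 0⟩

instance : Neg (Diff N) := ⟨Quotient.lift (fun p => mk p.2 p.1) fun p q h => mk_eq.2 (by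
  rw [add_comm, ← show p.1 + q.2 = q.1 + p.2 from h, add_comm])⟩

instance : Add (Diff N) := ⟨Quotient.lift₂ (fun p q => mk (p.1 + q.1) (p.2 + q.2)) (by
  intro p q p' q' (h₁ : _ = _) (h₂ : _ = _)
  refine mk_eq.2 ?_
  calc _ = (p.1 + p'.2) + (q.1 + q'.2) := by ring
    _ = _ := by rw [h₁, h₂]; ring)⟩

instance : Mul (Diff N) := ⟨Quotient.lift₂
  (fun p q => mk (p.1 * q.1 + p.2 * q.2) (p.1 * q.2 + p.2 * q.1)) (by
  intro p q p' q' (h₁ : _ = _) (h₂ : _ = _)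
  -- The representatives are changed one factor at a time.
  have e₁ : mk (p.1 * q.1 + p.2 * q.2) (p.1 * q.2 + p.2 * q.1) =
      mk (p'.1 * q.1 + p'.2 * q.2) (p'.1 * q.2 + p'.2 * q.1) := by
    refine mk_eq.2 ?_
    calc _ = (p.1 + p'.2) * q.1 + (p'.1 + p.2) * q.2 := by ring
      _ = (p'.1 + p.2) * q.1 + (p.1 + p'.2) * q.2 := by rw [h₁]
      _ = _ := by ring
  refine e₁.trans (mk_eq.2 ?_)
  calc _ = (q.1 + q'.2) * p'.1 + (q'.1 + q.2) * p'.2 := by ring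
    _ = (q'.1 + q.2) * p'.1 + (q.1 + q'.2) * p'.2 := by rw [h₂]
    _ = _ := by ring)⟩

theorem zero_def : (0 : Diff N) = mk 0 0 := rfl

theorem one_def : (1 : Diff N) = mk 1 0 := rfl

theorem neg_mk (a b : N) : -mk a b = mk b a := rfl

theorem mk_add_mk (a b c d : N) : mk a b + mk c d = mk (a + c) (b + d) := rfl

theorem mk_mul_mk (a b c d : N) : mk a b * mk c d = mk (a * c + b * d) (a * d + b * c) := rfl

theorem ind₁ {P : Diff N → Prop} (h : ∀ a b, P (mk a b)) (x : Diff N) : P x := by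
  obtain ⟨a, b, rfl⟩ := exists_mk x
  exact h a b

instance : CommRing (Diff N) where
  add_assoc x y z := by
    induction x using ind₁; induction y using ind₁; induction z using ind₁
    simp only [mk_add_mk, add_assoc]
  zero_add x := by
    induction x using ind₁
    simp only [zero_def, mk_add_mk, zero_add]
  add_zero x := by
    induction x using ind₁
    simp only [zero_def, mk_add_mk, add_zero]
  add_comm x y := by
    induction x using ind₁; induction y using ind₁
    simp only [mk_add_mk, mk_eq]
    ring
  neg_add_cancel x := by
    induction x using ind₁
    simp only [zero_def, neg_mk, mk_add_mk, mk_eq]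
    ring
  left_distrib x y z := by
    induction x using ind₁; induction y using ind₁; induction z using ind₁
    simp only [mk_add_mk, mk_mul_mk, mk_eq]
    ring
  right_distrib x y z := by
    induction x using ind₁; induction y using ind₁; induction z using ind₁
    simp only [mk_add_mk, mk_mul_mk, mk_eq]
    ring
  zero_mul x := by
    induction x using ind₁
    simp only [zero_def, mk_mul_mk, mk_eq]
    ring
  mul_zero x := by
    induction x using ind₁
    simp only [zero_def, mk_mul_mk, mk_eq]
    ring
  mul_assoc x y z := by
    induction x using ind₁; induction y using ind₁; induction z using ind₁
    simp only [mk_mul_mk, mk_eq]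
    ring
  one_mul x := by
    induction x using ind₁
    simp only [one_def, mk_mul_mk, mk_eq]
    ring
  mul_one x := by
    induction x using ind₁
    simp only [one_def, mk_mul_mk, mk_eq]
    ring
  mul_comm x y := by
    induction x using ind₁; induction y using ind₁
    simp only [mk_mul_mk, mk_eq]
    ring
  nsmul := nsmulRec
  zsmul := zsmulRec

/-- The inclusion of a semiring into its ring of differences. -/
def of : N →+* Diff N where
  toFun a := mk a 0
  map_zero' := rfl
  map_one' := rfl
  map_add' a b := by rw [mk_add_mk, add_zero]
  map_mul' a b := by rw [mk_mul_mk]; simp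

theorem mk_eq_sub (a b : N) : mk a b = of a - of b := by
  simp [of, sub_eq_add_neg, neg_mk, mk_add_mk]

theorem of_injective : Function.Injective (of (N := N)) := fun a b h => by
  simpa using mk_eq.1 h

theorem exists_of (x : Diff N) : ∃ a b, x = of a - of b := by
  obtain ⟨a, b, rfl⟩ := exists_mk x
  exact ⟨a, b, mk_eq_sub a b⟩

end Diff

end Differences

/-! ### The ordered field of fractions -/

section Fractions

variable (N : Type*) [CommSemiring N] [LinearOrder N] [IsStrictOrderedRing N]
  [CanonicallyOrderedAdd N]

/-- Of two numbers, the larger is the smaller plus something, so every difference is a number up to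
sign. Questions about `Diff N` thereby reduce to `N`. -/
theorem Diff.eq_of_or_eq_neg_of {N} [CommSemiring N] [LinearOrder N] [IsStrictOrderedRing N]
    [CanonicallyOrderedAdd N] (x : Diff N) : ∃ a : N, x = of a ∨ x = -of a := by
  obtain ⟨a, b, rfl⟩ := x.exists_of
  rcases le_total a b with h | h <;> obtain ⟨c, rfl⟩ := exists_add_of_le h
  · exact ⟨c, .inr (by simp)⟩
  · exact ⟨c, .inl (by simp)⟩

instance : Nontrivial (Diff N) := Diff.of_injective.nontrivial

instance : NoZeroDivisors (Diff N) where
  eq_zero_or_eq_zero_of_mul_eq_zero {x y} h := by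
    have h₀ : ∀ a b : N, Diff.of a * Diff.of b = 0 → Diff.of a = 0 ∨ Diff.of b = 0 := by
      intro a b h
      rw [← map_mul, map_eq_zero_iff _ Diff.of_injective, mul_eq_zero] at h
      simpa only [map_eq_zero_iff _ Diff.of_injective]
    obtain ⟨a, rfl | rfl⟩ := x.eq_of_or_eq_neg_of <;> obtain ⟨b, rfl | rfl⟩ := y.eq_of_or_eq_neg_of <;>
      simpa using h₀ a b (by simpa using h)

instance : IsDomain (Diff N) := NoZeroDivisors.to_isDomain _

/-- The field of fractions of the ring of differences. -/
def Frac : Type _ := FractionRing (Diff N)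

noncomputable instance : Field (Frac N) := inferInstanceAs (Field (FractionRing (Diff N)))

namespace Frac

variable {N}

/-- The inclusion of a semiring into its field of fractions. -/
noncomputable def of : N →+* Frac N :=
  (algebraMap (Diff N) (FractionRing (Diff N))).comp Diff.of

theorem of_injective : Function.Injective (of (N := N)) :=
  (IsFractionRing.injective (Diff N) (FractionRing (Diff N))).comp Diff.of_injective

theorem of_ne_zero {a : N} (h : a ≠ 0) : of a ≠ 0 :=
  (map_ne_zero_iff _ of_injective).2 h

theorem exists_of (x : Frac N) : ∃ a c : N, c ≠ 0 ∧ (x = of a / of c ∨ x = -(of a / of c)) := by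
  obtain ⟨p, q, hq, h⟩ := IsFractionRing.div_surjective (A := Diff N) (K := FractionRing (Diff N)) x
  obtain ⟨a, ha⟩ := p.eq_of_or_eq_neg_of
  obtain ⟨c, hc⟩ := q.eq_of_or_eq_neg_of
  have hc0 : c ≠ 0 := by
    rintro rfl
    exact nonZeroDivisors.ne_zero hq (by simpa using hc)
  have e (b : N) : algebraMap (Diff N) (FractionRing (Diff N)) (Diff.of b) = of b := rfl
  refine ⟨a, c, hc0, ?_⟩
  rcases ha with rfl | rfl <;> rcases hc with rfl | rfl <;>
    simp only [map_neg, e] at h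
  · exact .inl h.symm
  · exact .inr (h.symm.trans (div_neg (R := Frac N) _))
  · exact .inr (h.symm.trans (neg_div (R := Frac N) _ _))
  · exact .inl (h.symm.trans (neg_div_neg_eq (R := Frac N) _ _))

variable (N) in
/-- The nonnegative fractions. -/
noncomputable def cone : RingCone (Frac N) where
  carrier := {x | ∃ a c : N, c ≠ 0 ∧ x = of a / of c}
  zero_mem' := ⟨0, 1, one_ne_zero, by simp⟩
  one_mem' := ⟨1, 1, one_ne_zero, by simp⟩
  add_mem' := by
    rintro _ _ ⟨a, c, hc, rfl⟩ ⟨b, d, hd, rfl⟩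
    refine ⟨a * d + c * b, c * d, mul_ne_zero hc hd, ?_⟩
    simp only [map_add, map_mul]
    exact div_add_div _ _ (of_ne_zero hc) (of_ne_zero hd)
  mul_mem' := by
    rintro _ _ ⟨a, c, hc, rfl⟩ ⟨b, d, hd, rfl⟩
    refine ⟨a * b, c * d, mul_ne_zero hc hd, ?_⟩
    simp only [map_mul]
    exact div_mul_div_comm _ _ _ _
  eq_zero_of_mem_of_neg_mem' := by
    rintro _ ⟨a, c, hc, rfl⟩ ⟨b, d, hd, h⟩
    have hc' := of_ne_zero hc
    have hd' := of_ne_zero hd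
    -- From `x = a / c` and `-x = b / d` follows `a * d + b * c = 0` in `N`, where a sum vanishes
    -- only if both summands do.
    have h' : of (a * d + b * c) = (0 : Frac N) := by
      field_simp at h
      simp only [map_add, map_mul]
      linear_combination -h
    rw [map_eq_zero_iff _ of_injective] at h'
    have : a * d = 0 := le_antisymm (h' ▸ le_self_add) zero_le
    rw [(mul_eq_zero.1 this).resolve_right hd]
    simp

instance : HasMemOrNegMem (cone N) where
  mem_or_neg_mem x := by
    obtain ⟨a, c, hc, h | h⟩ := x.exists_of
    · exact .inl ⟨a, c, hc, h⟩
    · exact .inr ⟨a, c, hc, by rw [h, neg_neg]⟩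

open Classical in
noncomputable instance : LinearOrder (Frac N) :=
  have : DecidablePred (· ∈ cone N) := Classical.decPred _
  LinearOrder.mkOfAddGroupCone (cone N)

instance : IsOrderedRing (Frac N) := IsOrderedRing.mkOfCone (cone N)

instance : IsStrictOrderedRing (Frac N) := IsOrderedRing.toIsStrictOrderedRing _

theorem of_nonneg (a : N) : 0 ≤ of a := by
  change of a - 0 ∈ cone N
  exact ⟨a, 1, one_ne_zero, by simp⟩

theorem of_mono : Monotone (of (N := N)) := by
  intro a b h
  obtain ⟨c, rfl⟩ := exists_add_of_le h
  rw [map_add]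
  exact le_add_of_nonneg_right (of_nonneg c)

theorem of_strictMono : StrictMono (of (N := N)) := of_mono.strictMono_of_injective of_injective

end Frac

end Fractions

namespace Str

open Filter

variable {M : Str} [M.IsModel] {V : Ctx}

/-! ### Codes of rationals -/

section Rationals

variable (M) in
/-- The rational numbers of a model. -/
abbrev Rational : Type := Frac (M.El .nat)

/-- The rational number with a given code. -/
noncomputable def val (p : M.El .nat) : M.Rational :=
  (Frac.of (M.fst (M.fst p)) - Frac.of (M.snd (M.fst p))) / (Frac.of (M.snd p) + 1)

theorem of_add_one_pos (n : M.El .nat) : 0 < Frac.of n + 1 :=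
  add_pos_of_nonneg_of_pos (Frac.of_nonneg n) one_pos

theorem val_pair (a b d : M.El .nat) :
    val (pair (pair a b) d) = (Frac.of a - Frac.of b) / (Frac.of d + 1) := by
  simp [val]

/-- Any fraction may be used as a coded rational; the field of fractions contains nothing new. -/
theorem exists_val (x : M.Rational) : ∃ p, val p = x := by
  obtain ⟨a, c, hc, rfl | rfl⟩ := x.exists_of <;> obtain ⟨d, rfl⟩ := exists_eq_add_one hc
  · exact ⟨pair (pair a 0) d, by rw [val_pair]; simp⟩
  · exact ⟨pair (pair 0 a) d, by rw [val_pair]; simp [neg_div]⟩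

/-- The rational number `2 ^ (- n)`. -/
noncomputable def half (n : M.El .nat) : M.Rational := (Frac.of (M.pow2 n))⁻¹

theorem half_pos (n : M.El .nat) : 0 < half n := by
  refine inv_pos.2 ?_
  simpa using Frac.of_strictMono (pow2_pos n)

theorem half_add_one (n : M.El .nat) : half (n + 1) = half n / 2 := by
  have := half_pos n
  rw [half, inv_pos] at this
  rw [half, half, pow2_add_one, map_add]
  field_simp
  norm_num

theorem half_antitone : Antitone (half (M := M)) := by
  intro m n h
  have := half_pos m
  rw [half, inv_pos] at this
  exact inv_anti₀ this (Frac.of_mono (pow2_mono h))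

/-- The Archimedean property relative to `M`: for `ε = a / c` one has `2 ^ (- c) < 1 / c ≤ a / c`,
also when `c` is nonstandard. -/
theorem exists_half_lt {ε : M.Rational} (h : 0 < ε) : ∃ k, half k < ε := by
  obtain ⟨a, c, hc, rfl | rfl⟩ := ε.exists_of
  · have hc' : 0 < Frac.of c := by simpa using Frac.of_strictMono (pos_iff_ne_zero.2 hc)
    have ha : 1 ≤ Frac.of a := by
      have : 0 < Frac.of a := by simpa [hc'] using h
      rw [← map_one Frac.of]
      refine Frac.of_mono (one_le_of_pos (pos_iff_ne_zero.2 ?_))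
      rintro rfl
      simp at this
    refine ⟨c, ?_⟩
    calc half c < (Frac.of c)⁻¹ := inv_strictAnti₀ hc' (Frac.of_strictMono (lt_pow2 c))
      _ ≤ _ := by
        rw [inv_eq_one_div]
        exact div_le_div_of_nonneg_right ha hc'.le
  · have : 0 ≤ Frac.of a / Frac.of c := div_nonneg (Frac.of_nonneg a) (Frac.of_nonneg c)
    linarith

theorem of_pred_pow2 (n : M.El .nat) : Frac.of (M.pred (M.pow2 n)) + 1 = Frac.of (M.pow2 n) := by
  rw [← map_one Frac.of, ← map_add,
    ← (eq_zero_or_eq_add_one (M.pow2 n)).resolve_left (pow2_pos n).ne']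

theorem val_eval_qadd (ρ : ∀ τ, V τ → M.El τ) (p q : Term V .nat) :
    val (M.eval ρ (qadd p q)) = val (M.eval ρ p) + val (M.eval ρ q) := by
  have h₁ := (of_add_one_pos (M.snd (M.eval ρ p))).ne'
  have h₂ := (of_add_one_pos (M.snd (M.eval ρ q))).ne'
  -- Codes store the denominator minus one; the product of denominators is nonzero, so adding one
  -- undoes `pred`.
  have h₃ : Frac.of (M.pred ((M.snd (M.eval ρ p) + 1) * (M.snd (M.eval ρ q) + 1))) + 1 =
      (Frac.of (M.snd (M.eval ρ p)) + 1) * (Frac.of (M.snd (M.eval ρ q)) + 1) := by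
    rw [← map_one Frac.of, ← map_add, ← (eq_zero_or_eq_add_one _).resolve_left
      (mul_ne_zero (add_one_ne_zero _) (add_one_ne_zero _))]
    simp only [map_mul, map_add]
  simp only [qadd, qaddC, qmk, qpos, qneg, qden, eval_app, eval_fn, eval_pair, eval_plus,
    eval_times, eval_fst, eval_snd, eval_succ, eval_pred, eval_wk, eval_var, cons_new, succ_eq,
    val_pair, h₃, map_add, map_mul, map_one]
  rw [val, val, div_add_div _ _ h₁ h₂]
  ring

theorem val_eval_qopp (ρ : ∀ τ, V τ → M.El τ) (p : Term V .nat) :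
    val (M.eval ρ (qopp p)) = -val (M.eval ρ p) := by
  simp only [qopp, qoppC, qmk, qpos, qneg, eval_app, eval_fn, eval_pair, eval_fst, eval_snd,
    eval_var, cons_new, val_pair]
  rw [val]
  ring

/-- One of the two truncated differences is zero and the other is the distance. -/
theorem abs_of_sub_of (a b : M.El .nat) :
    |Frac.of a - Frac.of b| = Frac.of (a - b + (b - a)) := by
  rcases sub_dichotomy a b with ⟨h₁, h₂⟩ | ⟨h₁, h₂⟩
  · have := congrArg Frac.of h₂
    rw [map_add] at this
    rw [h₁, zero_add, ← this, abs_sub_comm, add_sub_cancel_left, abs_of_nonneg (Frac.of_nonneg _)]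
  · have hb : b - a = 0 := by rw [← h₂, Str.sub_add_self]
    have := congrArg Frac.of h₂
    rw [map_add] at this
    rw [hb, add_zero, ← this, add_sub_cancel_left, abs_of_nonneg (Frac.of_nonneg _)]

theorem val_eval_qabs (ρ : ∀ τ, V τ → M.El τ) (p : Term V .nat) :
    val (M.eval ρ (qabs p)) = |val (M.eval ρ p)| := by
  simp only [qabs, qabsC, qmk, qpos, qneg, eval_app, eval_fn, eval_pair, eval_fst, eval_snd,
    eval_var, cons_new, eval_plus, eval_monus, eval_zero, val_pair, map_zero, sub_zero]
  rw [val, abs_div, abs_of_sub_of, abs_of_pos (of_add_one_pos _)]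

theorem val_eval_qhalf (ρ : ∀ τ, V τ → M.El τ) (n : Term V .nat) :
    val (M.eval ρ (qhalf n)) = half (M.eval ρ n) := by
  simp [qhalf, qhalfC, qmk, val_pair, of_pred_pow2, half, succ_eq]

theorem of_le_of {a b : M.El .nat} : Frac.of a ≤ Frac.of b ↔ a ≤ b := Frac.of_strictMono.le_iff_le

theorem of_lt_of {a b : M.El .nat} : Frac.of a < Frac.of b ↔ a < b := Frac.of_strictMono.lt_iff_lt

theorem sat_qle (ρ : ∀ τ, V τ → M.El τ) (p q : Term V .nat) :
    M.Sat ρ (qle p q) ↔ val (M.eval ρ p) ≤ val (M.eval ρ q) := by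
  simp only [qle, qpos, qneg, qden, sat_le, eval_plus, eval_times, eval_fst, eval_snd, eval_succ,
    succ_eq]
  rw [val, val, div_le_div_iff₀ (of_add_one_pos _) (of_add_one_pos _), ← of_le_of]
  simp only [map_add, map_mul, map_one]
  constructor <;> intro h <;> linarith

theorem sat_qlt (ρ : ∀ τ, V τ → M.El τ) (p q : Term V .nat) :
    M.Sat ρ (qlt p q) ↔ val (M.eval ρ p) < val (M.eval ρ q) := by
  simp only [qlt, qpos, qneg, qden, sat_lt, eval_plus, eval_times, eval_fst, eval_snd, eval_succ,
    succ_eq]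
  rw [val, val, div_lt_div_iff₀ (of_add_one_pos _) (of_add_one_pos _), ← of_lt_of]
  simp only [map_add, map_mul, map_one]
  constructor <;> intro h <;> linarith

end Rationals

/-! ### Real numbers -/

section Reals

/-- The `n`-th approximation of a real number. -/
noncomputable def approx (x : M.El .one) (n : M.El .nat) : M.Rational := val (M.app x n)

/-- Fast-converging sequences of rationals. -/
def IsReal (x : M.El .one) : Prop := ∀ n i, |approx x n - approx x (n + i)| < half n

/-- Equality of real numbers. -/
def EqR (x y : M.El .one) : Prop := ∀ n, |approx x n - approx y n| ≤ half n + half n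

/-- The order of the real numbers. -/
def LtR (x y : M.El .one) : Prop := ∃ n, approx x n + (half n + half n) < approx y n

/-- The distance of two real numbers is less than `2 ^ (- k)`. -/
def Near (x y : M.El .one) (k : M.El .nat) : Prop :=
  ∃ n, |approx x (n + 1) - approx y (n + 1)| + (half n + half n) < half k

@[simp] theorem sat_isReal (ρ : ∀ τ, V τ → M.El τ) (x : Term V .one) :
    M.Sat ρ (isReal x) ↔ IsReal (M.eval ρ x) := by
  simp only [isReal, seq, sat_forAll, sat_qlt, val_eval_qabs, val_eval_qadd, val_eval_qopp,
    val_eval_qhalf, eval_app, eval_plus, eval_wk, eval_var, cons_new, IsReal, approx,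
    sub_eq_add_neg]

@[simp] theorem sat_eqR (ρ : ∀ τ, V τ → M.El τ) (x y : Term V .one) :
    M.Sat ρ (eqR x y) ↔ EqR (M.eval ρ x) (M.eval ρ y) := by
  simp only [eqR, seq, sat_forAll, sat_qle, val_eval_qabs, val_eval_qadd, val_eval_qopp,
    val_eval_qhalf, eval_app, eval_wk, eval_var, cons_new, EqR, approx, sub_eq_add_neg]

@[simp] theorem sat_ltR (ρ : ∀ τ, V τ → M.El τ) (x y : Term V .one) :
    M.Sat ρ (ltR x y) ↔ LtR (M.eval ρ x) (M.eval ρ y) := by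
  simp only [ltR, seq, sat_exists, sat_qlt, val_eval_qadd,
    val_eval_qhalf, eval_app, eval_wk, eval_var, cons_new, LtR, approx]

-- The index `n + 1` in `Near` is the shift made by addition of reals.
@[simp] theorem sat_near (ρ : ∀ τ, V τ → M.El τ) (x y : Term V .one) (k : Term V .nat) :
    M.Sat ρ (near x y k) ↔ Near (M.eval ρ x) (M.eval ρ y) (M.eval ρ k) := by
  simp only [near, sat_ltR, LtR, Near, approx, absR, addR, oppR, ofRat, seq, eval_fn, eval_app,
    val_eval_qabs, val_eval_qadd, val_eval_qopp, val_eval_qhalf, eval_wk, eval_var, cons_new,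
    eval_succ, succ_eq, sub_eq_add_neg]

/-- A rational number as a real number. -/
def ratR (p : M.El .nat) : M.El .one := M.eval M.self (ofRat (.var p))

@[simp] theorem approx_ratR (p n : M.El .nat) : approx (ratR p) n = val p := by
  simp [approx, ratR, ofRat]

theorem isReal_ratR (p : M.El .nat) : IsReal (ratR p) := fun n i => by
  simpa using half_pos n

variable {x y z : M.El .one} {k m n : M.El .nat}

theorem IsReal.abs_lt (hx : IsReal x) (h : m ≤ n) : |approx x m - approx x n| < half m := by
  obtain ⟨i, rfl⟩ := Str.le_iff_exists_add.1 h
  exact hx m i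

theorem IsReal.eventually (hx : IsReal x) (m : M.El .nat) :
    ∀ᶠ n in atTop, |approx x m - approx x n| < half m :=
  (eventually_ge_atTop m).mono fun _ h => hx.abs_lt h

/-- Relations between reals are recast as statements about all late approximations. Finitely many of
these hold at a common index, where linear arithmetic over the rationals of `M` finishes the
argument. -/
theorem eqR_iff (hx : IsReal x) (hy : IsReal y) :
    EqR x y ↔ ∀ k, ∀ᶠ n in atTop, |approx x n - approx y n| < half k := by
  constructor
  · intro h k
    -- From index `k + 2` on, `2 * 2 ^ (- n)` is at most half of `2 ^ (- k)`.
    filter_upwards [eventually_ge_atTop (k + 1 + 1)] with n hn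
    have h₁ := half_antitone hn
    rw [half_add_one, half_add_one] at h₁
    have := half_pos k
    linarith [h n]
  · intro h n
    by_contra! hn
    obtain ⟨k, hk⟩ := exists_half_lt (sub_pos.2 hn)
    obtain ⟨j, h₁, h₂, h₃⟩ := ((hx.eventually n).and ((hy.eventually n).and (h k))).exists
    rw [abs_lt] at h₁ h₂ h₃
    rcases abs_cases (approx x n - approx y n) with ⟨h₄, _⟩ | ⟨h₄, _⟩ <;> linarith

/-- An excess over `2 * 2 ^ (- n)` at index `n` cannot be undone later: each sequence moves by less
than `2 ^ (- n)`. -/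
theorem exists_of_not_eqR (hx : IsReal x) (hy : IsReal y) (h : ¬ EqR x y) :
    ∃ k, ∀ᶠ n in atTop, half k < |approx x n - approx y n| := by
  simp only [EqR, not_forall, not_le] at h
  obtain ⟨n, hn⟩ := h
  obtain ⟨k, hk⟩ := exists_half_lt (sub_pos.2 hn)
  refine ⟨k, ?_⟩
  filter_upwards [hx.eventually n, hy.eventually n] with j h₁ h₂
  rw [abs_lt] at h₁ h₂
  rcases abs_cases (approx x n - approx y n) with ⟨h₄, _⟩ | ⟨h₄, _⟩ <;>
    rcases abs_cases (approx x j - approx y j) with ⟨h₅, _⟩ | ⟨h₅, _⟩ <;> linarith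

/-- The margin `half m` keeps the strict inequality of reals, which an eventual strict inequality of
approximations would lose. -/
theorem near_iff (hx : IsReal x) (hy : IsReal y) :
    Near x y k ↔ ∃ m, ∀ᶠ n in atTop, |approx x n - approx y n| + half m < half k := by
  constructor
  · rintro ⟨n, hn⟩
    refine ⟨n + 1, ?_⟩
    filter_upwards [hx.eventually (n + 1), hy.eventually (n + 1)] with j h₁ h₂
    rw [half_add_one] at *
    rw [abs_lt] at h₁ h₂
    have := half_pos n
    rcases abs_cases (approx x (n + 1) - approx y (n + 1)) with ⟨h₄, _⟩ | ⟨h₄, _⟩ <;>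
      rcases abs_cases (approx x j - approx y j) with ⟨h₅, _⟩ | ⟨h₅, _⟩ <;> linarith
  · rintro ⟨m, hm⟩
    obtain ⟨j, hj⟩ := eventually_atTop.1 hm
    -- From index `m + 1` on, the allowance `2 * 2 ^ (- n)` in the definition fits into the margin
    -- `2 ^ (- m)`.
    refine ⟨max (m + 1) j, ?_⟩
    have h₁ := hj (max (m + 1) j + 1) ((le_max_right _ _).trans le_self_add)
    have h₂ := half_antitone (le_max_left (m + 1) j)
    rw [half_add_one] at h₂
    linarith

theorem ltR_iff (hx : IsReal x) (hy : IsReal y) :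
    LtR x y ↔ ∃ m, ∀ᶠ n in atTop, approx x n + half m < approx y n := by
  constructor
  · rintro ⟨n, hn⟩
    obtain ⟨k, hk⟩ := exists_half_lt (sub_pos.2 hn)
    refine ⟨k, ?_⟩
    filter_upwards [hx.eventually n, hy.eventually n] with j h₁ h₂
    rw [abs_lt] at h₁ h₂
    linarith
  · rintro ⟨m, hm⟩
    obtain ⟨j, hj⟩ := eventually_atTop.1 hm
    refine ⟨max (m + 1) j, ?_⟩
    have h₁ := hj (max (m + 1) j) (le_max_right _ _)
    have h₂ := half_antitone (le_max_left (m + 1) j)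
    rw [half_add_one] at h₂
    linarith

theorem EqR.refl (x : M.El .one) : EqR x x := fun n => by
  have := half_pos n
  simp only [sub_self, abs_zero]
  linarith

theorem EqR.symm (h : EqR x y) : EqR y x := fun n => by
  rw [abs_sub_comm]
  exact h n

theorem EqR.trans (hx : IsReal x) (hy : IsReal y) (hz : IsReal z) (h₁ : EqR x y)
    (h₂ : EqR y z) : EqR x z := by
  rw [eqR_iff hx hy] at h₁
  rw [eqR_iff hy hz] at h₂
  rw [eqR_iff hx hz]
  intro k
  filter_upwards [h₁ (k + 1), h₂ (k + 1)] with n h₁ h₂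
  rw [half_add_one] at h₁ h₂
  linarith [abs_sub_le (approx x n) (approx y n) (approx z n)]

/-- Sufficient condition for nearness with an explicit margin. -/
theorem near_of_eventually (hx : IsReal x) (hy : IsReal y)
    (h : ∀ᶠ n in atTop, |approx x n - approx y n| ≤ half (k + 1)) : Near x y k := by
  refine (near_iff hx hy).2 ⟨k + 1 + 1, h.mono fun n hn => ?_⟩
  have := half_pos k
  rw [half_add_one] at *
  rw [half_add_one]
  linarith

theorem Near.eventually (hx : IsReal x) (hy : IsReal y) (h : Near x y k) :
    ∀ᶠ n in atTop, |approx x n - approx y n| < half k := by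
  obtain ⟨m, hm⟩ := (near_iff hx hy).1 h
  filter_upwards [hm] with n hn
  linarith [half_pos m]

theorem near_self (hx : IsReal x) : Near x x k :=
  near_of_eventually hx hx (.of_forall fun n => by
    rw [sub_self, abs_zero]
    exact (half_pos _).le)

end Reals

end Str

namespace Str

open Filter

variable {M : Str} [M.IsModel] {V : Ctx}

/-! ### Functions on the reals -/

section Functions

/-- Functions from reals to reals. -/
def IsFun (f : M.El (.one ⇢ .one)) : Prop :=
  (∀ x, IsReal x → IsReal (M.app f x)) ∧
    ∀ x, IsReal x → ∀ y, IsReal y → EqR x y → EqR (M.app f x) (M.app f y)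

/-- Continuity. -/
def Cts (f : M.El (.one ⇢ .one)) : Prop :=
  ∀ x, IsReal x → ∀ k, ∃ N, ∀ y, IsReal y → Near x y N → Near (M.app f x) (M.app f y) k

/-- The closure of the graph. -/
def InClosureGraph (f : M.El (.one ⇢ .one)) (x y : M.El .one) : Prop :=
  ∀ k, ∃ z, IsReal z ∧ ∃ w, IsReal w ∧ EqR (M.app f z) w ∧ Near x z k ∧ Near y w k

/-- Graph continuity. -/
def GraphCts (f : M.El (.one ⇢ .one)) : Prop :=
  ∃ g, IsFun g ∧ Cts g ∧
    ∀ x, IsReal x → ∀ y, IsReal y → EqR (M.app g x) y → InClosureGraph f x y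

/-- Membership in an open interval. -/
def InInterval (a b x : M.El .one) : Prop := LtR a x ∧ LtR x b

/-- Quasi-continuity. -/
def QuasiCts (f : M.El (.one ⇢ .one)) : Prop :=
  ∀ x, IsReal x → ∀ k N, ∃ a, IsReal a ∧ ∃ b, IsReal b ∧ LtR a b ∧
    (∀ y, IsReal y → InInterval a b y → Near x y N) ∧
    ∀ y, IsReal y → InInterval a b y → Near (M.app f x) (M.app f y) k

theorem eval_qadd_congr {W : Ctx} {ρ : ∀ τ, V τ → M.El τ} {ρ' : ∀ τ, W τ → M.El τ}
    {p q : Term V .nat} {p' q' : Term W .nat} (hp : M.eval ρ p = M.eval ρ' p')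
    (hq : M.eval ρ q = M.eval ρ' q') : M.eval ρ (qadd p q) = M.eval ρ' (qadd p' q') := by
  simp only [qadd, qaddC, qmk, qpos, qneg, qden, eval_app, eval_fn, eval_pair, eval_plus,
    eval_times, eval_fst, eval_snd, eval_succ, eval_pred, eval_wk, eval_var, cons_new, hp, hq]

/-- The sum of two reals. -/
def addR (x y : M.El .one) : M.El .one :=
  M.eval M.self (RCAomega.addR (.var x) (.var y))

theorem approx_addR (x y : M.El .one) (n : M.El .nat) :
    approx (addR x y) n = approx x (n + 1) + approx y (n + 1) := by
  simp [approx, addR, RCAomega.addR, val_eval_qadd, seq, succ_eq]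

theorem eval_addR (ρ : ∀ τ, V τ → M.El τ) (x y : Term V .one) :
    M.eval ρ (RCAomega.addR x y) = addR (M.eval ρ x) (M.eval ρ y) := by
  refine ext fun n => ?_
  simp only [addR, RCAomega.addR, seq, eval_fn]
  exact eval_qadd_congr (by simp) (by simp)

/-- Pointwise sums. -/
def IsSum (f g h : M.El (.one ⇢ .one)) : Prop :=
  ∀ x, IsReal x → EqR (M.app f x) (addR (M.app g x) (M.app h x))

section Satisfaction

variable (ρ : ∀ τ, V τ → M.El τ)

@[simp] theorem sat_forAllR
    (b : Term (Ctx.Ext V .one) .one → Formula (Ctx.Ext V .one)) :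
    M.Sat ρ (forAllR b) ↔ ∀ x, IsReal x → M.Sat (M.cons x ρ) (b (.var .new)) := by
  simp [forAllR]

@[simp] theorem sat_existsR
    (b : Term (Ctx.Ext V .one) .one → Formula (Ctx.Ext V .one)) :
    M.Sat ρ (existsR b) ↔ ∃ x, IsReal x ∧ M.Sat (M.cons x ρ) (b (.var .new)) := by
  simp [existsR]

@[simp] theorem sat_isFun (f : Term V (.one ⇢ .one)) :
    M.Sat ρ (isFun f) ↔ IsFun (M.eval ρ f) := by
  simp [isFun, IsFun, value]

@[simp] theorem sat_forAllFun
    (b : Term (Ctx.Ext V (.one ⇢ .one)) (.one ⇢ .one) → Formula (Ctx.Ext V (.one ⇢ .one))) :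
    M.Sat ρ (forAllFun b) ↔ ∀ f, IsFun f → M.Sat (M.cons f ρ) (b (.var .new)) := by
  simp [forAllFun]

@[simp] theorem sat_existsFun
    (b : Term (Ctx.Ext V (.one ⇢ .one)) (.one ⇢ .one) → Formula (Ctx.Ext V (.one ⇢ .one))) :
    M.Sat ρ (existsFun b) ↔ ∃ f, IsFun f ∧ M.Sat (M.cons f ρ) (b (.var .new)) := by
  simp [existsFun]

@[simp] theorem sat_continuous (f : Term V (.one ⇢ .one)) :
    M.Sat ρ (continuous f) ↔ Cts (M.eval ρ f) := by
  simp [continuous, Cts, value]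

@[simp] theorem sat_graphContinuous (f : Term V (.one ⇢ .one)) :
    M.Sat ρ (graphContinuous f) ↔ GraphCts (M.eval ρ f) := by
  simp [graphContinuous, GraphCts, inGraph, inClosureGraph, InClosureGraph, value]

@[simp] theorem sat_quasiContinuous (f : Term V (.one ⇢ .one)) :
    M.Sat ρ (quasiContinuous f) ↔ QuasiCts (M.eval ρ f) := by
  simp [quasiContinuous, QuasiCts, inInterval, InInterval, value]

@[simp] theorem sat_isSum (f g h : Term V (.one ⇢ .one)) :
    M.Sat ρ (isSum f g h) ↔ IsSum (M.eval ρ f) (M.eval ρ g) (M.eval ρ h) := by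
  simp [isSum, IsSum, value, eval_addR]

end Satisfaction

/-! ### Continuity as the conjunction of quasi-continuity and graph continuity -/

variable {f g : M.El (.one ⇢ .one)}

theorem Near.congr {x x' y y' : M.El .one} {k : M.El .nat} (hx : IsReal x) (hx' : IsReal x')
    (hy : IsReal y) (hy' : IsReal y') (h₁ : EqR x x') (h₂ : EqR y y') (h : Near x y k) :
    Near x' y' k := by
  obtain ⟨m, hm⟩ := (near_iff hx hy).1 h
  refine (near_iff hx' hy').2 ⟨m + 1, ?_⟩
  filter_upwards [hm, (eqR_iff hx hx').1 h₁ (m + 1 + 1), (eqR_iff hy hy').1 h₂ (m + 1 + 1)]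
    with n h₁ h₂ h₃
  rw [half_add_one] at *
  rw [half_add_one] at *
  have e₁ := abs_sub_le (approx x' n) (approx x n) (approx y' n)
  have e₂ := abs_sub_le (approx x n) (approx y n) (approx y' n)
  rw [abs_sub_comm] at h₂
  linarith

theorem Cts.congr (hf : IsFun f) (hg : IsFun g) (h : ∀ x, IsReal x → EqR (M.app f x) (M.app g x))
    (hc : Cts f) : Cts g := by
  intro x hx k
  obtain ⟨N, hN⟩ := hc x hx k
  exact ⟨N, fun y hy hxy => (hN y hy hxy).congr (hf.1 x hx) (hg.1 x hx) (hf.1 y hy) (hg.1 y hy)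
    (h x hx) (h y hy)⟩

/-- A function that agrees with a continuous function on a dense set is graph continuous. -/
theorem graphCts_of_dense (hg : IsFun g) (hc : Cts g)
    (h : ∀ x, IsReal x → ∀ k, ∃ z, IsReal z ∧ Near x z k ∧ EqR (M.app f z) (M.app g z)) :
    GraphCts f := by
  refine ⟨g, hg, hc, fun x hx y hy hxy k => ?_⟩
  obtain ⟨N, hN⟩ := hc x hx k
  -- The bound `k` is for the first coordinate; `N` makes `g z` close to `g x` for the second.
  obtain ⟨z, hz, hxz, hfz⟩ := h x hx (max k N)
  have near_mono {m : M.El .nat} (hm : m ≤ max k N) : Near x z m := by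
    obtain ⟨j, hj⟩ := hxz
    exact ⟨j, hj.trans_le (half_antitone hm)⟩
  exact ⟨z, hz, M.app g z, hg.1 z hz, hfz, near_mono (le_max_left _ _),
    (hN z hz (near_mono (le_max_right _ _))).congr (hg.1 x hx) hy (hg.1 z hz) (hg.1 z hz) hxy
      (.refl _)⟩

theorem Cts.graphCts (hf : IsFun f) (hc : Cts f) : GraphCts f :=
  graphCts_of_dense hf hc fun x hx _ => ⟨x, hx, near_self hx, .refl _⟩

theorem Cts.quasiCts (hc : Cts f) : QuasiCts f := by
  intro x hx k N
  obtain ⟨L, hL⟩ := hc x hx k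
  -- Points of the interval are within `2 ^ (- m)` of the `m`-th approximation, hence within `2 * 2
  -- ^ (- m)` of `x`; this is the bound `half (max L N + 1)` that `near_of_eventually` asks for.
  obtain ⟨m, hm⟩ : ∃ m, m = max L N + 1 + 1 := ⟨_, rfl⟩
  have hm' : half (max L N + 1) = 2 * half m := by rw [hm, half_add_one (_ + 1)]; ring
  obtain ⟨a, ha⟩ := exists_val (approx x m - half m)
  obtain ⟨b, hb⟩ := exists_val (approx x m + half m)
  have key : ∀ y, IsReal y → InInterval (ratR a) (ratR b) y → Near x y (max L N) := by
    rintro y hy ⟨h₁, h₂⟩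
    obtain ⟨i, h₁⟩ := (ltR_iff (isReal_ratR a) hy).1 h₁
    obtain ⟨j, h₂⟩ := (ltR_iff hy (isReal_ratR b)).1 h₂
    refine near_of_eventually hx hy ?_
    filter_upwards [h₁, h₂, hx.eventually m] with n h₁ h₂ h₃
    rw [approx_ratR, ha] at h₁
    rw [approx_ratR, hb] at h₂
    have e₁ := half_pos i
    have e₂ := half_pos j
    rw [abs_lt] at h₃
    rw [hm', abs_le]
    constructor <;> linarith
  have near_mono {y : M.El .one} {j : M.El .nat} (hj : j ≤ max L N)
      (h : Near x y (max L N)) : Near x y j := by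
    obtain ⟨i, hi⟩ := h
    exact ⟨i, hi.trans_le (half_antitone hj)⟩
  refine ⟨ratR a, isReal_ratR a, ratR b, isReal_ratR b, ?_, fun y hy h =>
    near_mono (le_max_right _ _) (key y hy h), fun y hy h =>
    hL y hy (near_mono (le_max_left _ _) (key y hy h))⟩
  refine ⟨m + 1 + 1, ?_⟩
  have := half_pos m
  have e := half_add_one m
  have e' := half_add_one (m + 1)
  rw [approx_ratR, approx_ratR, ha, hb]
  linarith

theorem eqR_of_quasiCts (hf : IsFun f) (hg : IsFun g) (hc : Cts g) (hq : QuasiCts f)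
    (h : ∀ x, IsReal x → ∀ y, IsReal y → EqR (M.app g x) y → InClosureGraph f x y)
    (x : M.El .one) (hx : IsReal x) : EqR (M.app g x) (M.app f x) := by
  by_contra hne
  obtain ⟨k, hk⟩ := exists_of_not_eqR (hg.1 x hx) (hf.1 x hx) hne
  obtain ⟨N, hN⟩ := hc x hx (k + 1 + 1)
  -- The interval is sought inside the ball on which `g` stays within `2 ^ (- (k + 2))` of `g x`.
  obtain ⟨a, ha, b, hb, hab, h₁, h₂⟩ := hq x hx (k + 1 + 1) N
  obtain ⟨n, hn⟩ := hab
  obtain ⟨p, hp⟩ := exists_val ((approx a n + approx b n) / 2)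
  obtain ⟨K, hK⟩ := exists_half_lt (sub_pos.2 hn)
  -- The midpoint `p` keeps distance more than `2 ^ (- (K + 1))` from both endpoints, so half of
  -- that room is left for moving `z`.
  have between : ∀ z, IsReal z → (∀ᶠ j in atTop, |val p - approx z j| < half (K + 1 + 1)) →
      InInterval a b z := by
    intro z hz h
    refine ⟨(ltR_iff ha hz).2 ⟨K + 1 + 1, ?_⟩, (ltR_iff hz hb).2 ⟨K + 1 + 1, ?_⟩⟩
    · filter_upwards [h, ha.eventually n] with j h₁ h₂
      rw [half_add_one, half_add_one] at *
      rw [abs_lt] at h₁ h₂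
      linarith
    · filter_upwards [h, hb.eventually n] with j h₁ h₂
      rw [half_add_one, half_add_one] at *
      rw [abs_lt] at h₁ h₂
      linarith
  have hc := isReal_ratR p
  have hcab := between _ hc (.of_forall fun j => by
    rw [approx_ratR, sub_self, abs_zero]; exact half_pos _)
  -- The first bound keeps `z` in the interval, the second makes `f z` close to `g p`.
  obtain ⟨z, hz, w, hw, hzw, hcz, hgw⟩ := h _ hc _ (hg.1 _ hc) (.refl _) (max (K + 1 + 1) (k + 1 + 1))
  have hzab := between z hz (by
    filter_upwards [hcz.eventually hc hz] with j hj
    rw [approx_ratR] at hj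
    exact hj.trans_le (half_antitone (le_max_left _ _)))
  have e₁ := (hN _ hc (h₁ _ hc hcab)).eventually (hg.1 _ hx) (hg.1 _ hc)
  have e₂ := hgw.eventually (hg.1 _ hc) hw
  have e₃ := (eqR_iff (hf.1 _ hz) hw).1 hzw (k + 1 + 1)
  have e₄ := (h₂ z hz hzab).eventually (hf.1 _ hx) (hf.1 _ hz)
  obtain ⟨j, h₀, e₁, e₂, e₃, e₄⟩ := (hk.and (e₁.and (e₂.and (e₃.and e₄)))).exists
  have e₂' := e₂.trans_le (half_antitone (le_max_right _ _))
  rw [half_add_one, half_add_one] at *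
  -- The path `g x`, `g p`, `w`, `f z`, `f x` has four steps, each below `2 ^ (- (k + 2))`; this
  -- contradicts the gap above `2 ^ (- k)`.
  have t₁ := abs_sub_le (approx (M.app g x) j) (approx (M.app g (ratR p)) j)
    (approx (M.app f x) j)
  have t₂ := abs_sub_le (approx (M.app g (ratR p)) j) (approx w j) (approx (M.app f x) j)
  have t₃ := abs_sub_le (approx w j) (approx (M.app f z) j) (approx (M.app f x) j)
  rw [abs_sub_comm] at e₃ e₄
  linarith

theorem cts_iff (hf : IsFun f) : Cts f ↔ QuasiCts f ∧ GraphCts f := by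
  refine ⟨fun h => ⟨h.quasiCts, h.graphCts hf⟩, ?_⟩
  rintro ⟨hq, g, hg, hc, h⟩
  exact hc.congr hg hf (eqR_of_quasiCts hf hg hc hq h)

end Functions

end Str

theorem provable_decompositionOfContinuity : Provable decompositionOfContinuity :=
  provable_of_sat fun M _ ρ => by
    simp only [decompositionOfContinuity, Str.sat_forAllFun, Str.sat_iff, Str.sat_and,
      Str.sat_continuous, Str.sat_quasiContinuous, Str.sat_graphContinuous]
    exact fun f hf => Str.cts_iff hf

namespace Str

open Filter

variable {M : Str} [M.IsModel] {V : Ctx}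

/-! ### Definitions by cases and choice -/

section Choice

/-- The term with value `a` if `c` is zero and value `b` otherwise. -/
def cond (c a b : Term V .nat) : Term V .nat :=
  RCAomega.recur (fn .nat fun _ => fn .nat fun _ => ((b.wk .nat).wk .nat)) a c

@[simp] theorem eval_cond (ρ : ∀ τ, V τ → M.El τ) (c a b : Term V .nat) :
    M.eval ρ (cond c a b) = if M.eval ρ c = 0 then M.eval ρ a else M.eval ρ b := by
  simp only [cond, eval_recur]
  split_ifs with h
  · rw [h, recur_zero]
  · obtain ⟨m, hm⟩ := exists_eq_add_one h
    rw [hm, ← succ_eq, recur_succ]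
    simp

/-- The characteristic term of the order of rationals. -/
def qltTerm (p q : Term V .nat) : Term V .nat :=
  RCAomega.monus
    (RCAomega.succ (plus (times (qpos p) (qden q)) (times (qneg q) (qden p))))
    (plus (times (qpos q) (qden p)) (times (qneg p) (qden q)))

theorem eval_qltTerm (ρ : ∀ τ, V τ → M.El τ) (p q : Term V .nat) :
    M.eval ρ (qltTerm p q) = 0 ↔ val (M.eval ρ p) < val (M.eval ρ q) :=
  sat_qlt ρ p q

theorem exists_choice {A : Formula (Ctx.Ext (Ctx.Ext M.El .one) .nat)} (hA : A.QuantFree)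
    (h : ∀ x, ∃ y, M.Sat (M.cons y (M.cons x M.self)) A) :
    ∃ Y : M.El (.one ⇢ .nat), ∀ x, M.Sat (M.cons (M.app Y x) (M.cons x M.self)) A := by
  have := IsModel.sat M.self (.choice A hA)
  simp only [sat_imp, sat_all, sat_ex, sat_subst, eval_consSubst, eval_liftSubst] at this
  exact this h

variable (M) in
/-- Kleene's quantifier `∃²`. -/
def HasE2 : Prop := ∃ E : M.El (.one ⇢ .nat), ∀ u : M.El .one, M.app E u = 0 ↔ ∃ n, M.app u n = 0

end Choice

/-! ### Kleene's quantifier from a discontinuous function -/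

section Grilliot

/-- The search for a zero of `u`: the least zero of `u` if it is less than `j`, and `j` if
there is no such zero. -/
def search (u : Term V .one) (j : Term V .nat) : Term V .nat :=
  RCAomega.recur (fn .nat fun _ => fn .nat fun r =>
    plus r (cond (((u.wk .nat).wk .nat) ⬝ r) zero (RCAomega.succ zero))) zero j

/-- The search function for the zeros of `u`. -/
def searchFn (u : M.El .one) : M.El .one :=
  M.eval M.self (fn .nat fun j => search (Term.wk .nat (.var u)) j)

theorem eval_search (ρ : ∀ τ, V τ → M.El τ) (u : Term V .one) (j : Term V .nat) :
    M.eval ρ (search u j) = M.app (searchFn (M.eval ρ u)) (M.eval ρ j) := by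
  simp only [searchFn, eval_fn, search, eval_recur, eval_var, cons_new, eval_zero]
  refine recur_congr fun a b => ?_
  simp

variable (u : M.El .one)

theorem searchFn_zero : M.app (searchFn u) 0 = 0 := by
  simp [searchFn, search]

theorem searchFn_add_one (j : M.El .nat) : M.app (searchFn u) (j + 1) =
    M.app (searchFn u) j + if M.app u (M.app (searchFn u) j) = 0 then 0 else 1 := by
  have h (i : M.El .nat) : M.app (searchFn u) i = M.recur (M.eval M.self (fn .nat fun _ =>
      fn .nat fun r => plus r (cond ((.var (.old (.old u))) ⬝ r) zero (RCAomega.succ zero)))) 0 i := by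
    simp only [searchFn, eval_fn, search, eval_recur, eval_var, cons_new, eval_zero]
    refine recur_congr fun a b => ?_
    simp only [eval_fn, eval_plus, eval_cond, eval_app, eval_wk, eval_var, cons_new, cons_old]
    rfl
  rw [h, h, ← succ_eq, recur_succ]
  simp only [eval_fn, eval_plus, eval_cond, eval_app, eval_var, cons_new, cons_old]
  rfl

variable {u}

/-- A successful search never moves again. -/
theorem searchFn_of_eq_zero {j : M.El .nat} (h : M.app u (M.app (searchFn u) j) = 0)
    (i : M.El .nat) : M.app (searchFn u) (j + i) = M.app (searchFn u) j :=
  induction_eq (F := fun i => M.app (searchFn u) (j + i)) (G := fun _ => M.app (searchFn u) j)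
    (by rw [add_zero]) (fun i hi => by rw [← add_assoc, searchFn_add_one, hi, if_pos h, add_zero]) i

theorem searchFn_of_ne_zero {j : M.El .nat} (h : M.app u (M.app (searchFn u) j) ≠ 0) :
    M.app (searchFn u) j = j := by
  refine (induction (P := fun j => M.app u (M.app (searchFn u) j) = 0 ∨ M.app (searchFn u) j = j)
    (.or (.eq (by fun_prop) (by fun_prop)) (.eq (by fun_prop) (by fun_prop)))
    (.inr (searchFn_zero u)) ?_ j).resolve_left h
  intro j hj
  by_cases hu : M.app u (M.app (searchFn u) j) = 0
  · rw [searchFn_of_eq_zero hu]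
    exact .inl hu
  · rw [searchFn_add_one, if_neg hu, hj.resolve_left hu]
    exact .inr rfl

theorem le_searchFn {j : M.El .nat} (h : M.app u (M.app (searchFn u) j) ≠ 0) (i : M.El .nat) :
    j ≤ M.app (searchFn u) (j + i) := by
  refine induction (P := fun i => j ≤ M.app (searchFn u) (j + i))
    (.le (by fun_prop) (by fun_prop)) ?_ (fun i hi => ?_) i
  · rw [add_zero, searchFn_of_ne_zero h]
  · rw [← add_assoc, searchFn_add_one]
    exact hi.trans le_self_add

theorem search_of_zero {n : M.El .nat} (h : M.app u n = 0) :
    M.app u (M.app (searchFn u) n) = 0 := by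
  by_contra h'
  rw [searchFn_of_ne_zero h'] at h'
  exact h' h

variable {f : M.El (.one ⇢ .one)} {x : M.El .one} {s : M.El (.nat ⇢ .one)}

/-- For a sequence `s` converging to `x`, the real that is `s n` if `n` is the least zero of `u`
and is `x` if `u` has no zeros. -/
theorem exists_splice (hx : IsReal x) (hs : ∀ n, IsReal (M.app s n))
    (hn : ∀ n, Near x (M.app s n) n) : ∃ Y : M.El (.one ⇢ .one), ∀ u,
      IsReal (M.app Y u) ∧ ((¬ ∃ n, M.app u n = 0) → EqR (M.app Y u) x) ∧
      ((∃ n, M.app u n = 0) → ∃ n, EqR (M.app Y u) (M.app s n)) := by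
  -- The `j`-th entry follows `x` until the search bounded by `j` succeeds and then follows `s ν`
  -- for the zero `ν` found. No unbounded search is needed, so this is a term; reading entries at `j
  -- + 2` gains a factor of four.
  let Y : M.El (.one ⇢ .one) := M.eval M.self (fn .one fun u => fn .nat fun j =>
    cond (Term.wk .nat u ⬝ search (Term.wk .nat u) j)
      (.var (.old (.old s)) ⬝ search (Term.wk .nat u) j ⬝ RCAomega.succ (RCAomega.succ j))
      (.var (.old (.old x)) ⬝ RCAomega.succ (RCAomega.succ j)))
  have hY (u : M.El .one) (j : M.El .nat) : approx (M.app Y u) j =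
      if M.app u (M.app (searchFn u) j) = 0 then
        approx (M.app s (M.app (searchFn u) j)) (j + 1 + 1) else approx x (j + 1 + 1) := by
    have : M.app (M.app Y u) j = if M.app u (M.app (searchFn u) j) = 0 then
        M.app (M.app s (M.app (searchFn u) j)) (j + 1 + 1) else M.app x (j + 1 + 1) := by
      simp [Y, eval_search, succ_eq]
    rw [approx, this]
    split_ifs <;> rfl
  have half_two (j : M.El .nat) : half (j + 1 + 1) = half j / 4 := by
    rw [half_add_one, half_add_one]; ring
  have hreal (u : M.El .one) : IsReal (M.app Y u) := by
    intro j i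
    have hj := half_pos j
    have e := half_two j
    rw [hY, hY]
    by_cases h : M.app u (M.app (searchFn u) j) = 0
    · rw [if_pos h, searchFn_of_eq_zero h, if_pos h]
      have := (hs (M.app (searchFn u) j)).abs_lt (m := j + 1 + 1) (n := j + i + 1 + 1)
        (by gcongr; exact le_self_add)
      linarith
    rw [if_neg h]
    by_cases h' : M.app u (M.app (searchFn u) (j + i)) = 0
    swap
    · rw [if_neg h']
      have := hx.abs_lt (m := j + 1 + 1) (n := j + i + 1 + 1) (by gcongr; exact le_self_add)
      linarith
    rw [if_pos h']
    set ν := M.app (searchFn u) (j + i) with hν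
    -- A zero found only after stage `j` exceeds `j`, so `s ν` is within `2 ^ (- (j + 1))` of `x`.
    -- Two errors of at most `2 ^ (- (j + 2))` bring the total to `2 ^ (- j)`.
    have hjν : j + 1 ≤ ν := by
      refine lt_iff_add_one_le.1 (lt_of_le_of_ne (le_searchFn h i) ?_)
      intro he
      rw [searchFn_of_ne_zero h, he] at h
      exact h h'
    obtain ⟨t, h₁, h₂, h₃⟩ := ((hx.eventually (j + 1 + 1)).and
      (((hs ν).eventually (j + i + 1 + 1)).and ((hn ν).eventually hx (hs ν)))).exists
    have h₄ := half_antitone hjν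
    have h₅ : half (j + i + 1 + 1) ≤ half (j + 1 + 1) :=
      half_antitone (by gcongr; exact le_self_add)
    rw [half_add_one] at h₄
    have t₁ := abs_sub_le (approx x (j + 1 + 1)) (approx x t) (approx (M.app s ν) (j + i + 1 + 1))
    have t₂ := abs_sub_le (approx x t) (approx (M.app s ν) t)
      (approx (M.app s ν) (j + i + 1 + 1))
    rw [abs_sub_comm] at h₂
    linarith
  refine ⟨Y, fun u => ⟨hreal u, fun h => ?_, fun ⟨n, h⟩ => ⟨M.app (searchFn u) n, ?_⟩⟩⟩
  · rw [not_exists] at h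
    refine (eqR_iff (hreal u) hx).2 fun k => ?_
    filter_upwards [eventually_ge_atTop k] with j hj
    rw [hY, if_neg (h _), abs_sub_comm]
    exact (hx.abs_lt (le_self_add.trans le_self_add)).trans_le (half_antitone hj)
  · have h' := search_of_zero h
    refine (eqR_iff (hreal u) (hs _)).2 fun k => ?_
    filter_upwards [eventually_ge_atTop k, eventually_ge_atTop n] with j hj hnj
    obtain ⟨i, rfl⟩ := Str.le_iff_exists_add.1 hnj
    rw [hY, searchFn_of_eq_zero h', if_pos h', abs_sub_comm]
    exact ((hs _).abs_lt (le_self_add.trans le_self_add)).trans_le (half_antitone hj)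

/-- Grilliot's trick: a function that is not sequentially continuous yields `∃²`. -/
theorem hasE2_of_sequence (hf : IsFun f) (hx : IsReal x) (hs : ∀ n, IsReal (M.app s n))
    (hn : ∀ n, Near x (M.app s n) n) (k : M.El .nat)
    (hk : ∀ n, ∀ᶠ j in atTop, half k ≤ |approx (M.app f x) j - approx (M.app f (M.app s n)) j|) :
    M.HasE2 := by
  obtain ⟨Y, hY⟩ := exists_splice hx hs hn
  -- Three errors of `2 ^ (- k) / 16` separate the two cases: the `K`-th approximations differ by
  -- less than `3 / 16` of `2 ^ (- k)` if `u` has no zero, and by more than `13 / 16` of it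
  -- otherwise. Comparison with the threshold `2 ^ (- (k + 1))` is a single decision on rationals.
  obtain ⟨K, hK⟩ : ∃ K, K = k + 1 + 1 + 1 + 1 := ⟨_, rfl⟩
  have hK' : half K = half k / 16 := by
    rw [hK]; simp only [half_add_one]; ring
  have hk' := half_pos k
  let E : M.El (.one ⇢ .nat) := M.eval M.self (fn .one fun u =>
    qltTerm (qhalf (.var (.old (k + 1))))
      (qabs (qadd (.var (.old (M.app f x)) ⬝ .var (.old K))
        (qopp (.var (.old f) ⬝ (.var (.old Y) ⬝ u) ⬝ .var (.old K))))))
  have hE (u : M.El .one) : M.app E u = 0 ↔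
      half (k + 1) < |approx (M.app f x) K - approx (M.app f (M.app Y u)) K| := by
    simp only [E, eval_fn, eval_qltTerm, val_eval_qhalf, val_eval_qabs, val_eval_qadd,
      val_eval_qopp, eval_app, eval_var, cons_old, cons_new, self_apply, sub_eq_add_neg, approx]
  refine ⟨E, fun u => ?_⟩
  rw [hE, half_add_one]
  obtain ⟨hr, hno, hyes⟩ := hY u
  have ev := (hf.1 _ hx).eventually K
  have ev' := (hf.1 _ hr).eventually K
  constructor
  · intro h
    by_contra h'
    have := (eqR_iff (hf.1 _ hr) (hf.1 _ hx)).1 (hf.2 _ hr _ hx (hno h')) K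
    obtain ⟨j, h₁, h₂, h₃⟩ := (ev.and (ev'.and this)).exists
    rw [abs_lt] at h₁ h₂ h₃
    rcases abs_cases (approx (M.app f x) K - approx (M.app f (M.app Y u)) K) with ⟨h₄, _⟩ | ⟨h₄, _⟩ <;>
      linarith
  · intro h
    obtain ⟨n, hn⟩ := hyes h
    have := (eqR_iff (hf.1 _ hr) (hf.1 _ (hs n))).1 (hf.2 _ hr _ (hs n) hn) K
    obtain ⟨j, h₁, h₂, h₃, h₄⟩ := (ev.and (ev'.and (this.and (hk n)))).exists
    have t₁ := abs_sub_le (approx (M.app f x) j) (approx (M.app f x) K)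
      (approx (M.app f (M.app s n)) j)
    have t₂ := abs_sub_le (approx (M.app f x) K) (approx (M.app f (M.app Y u)) K)
      (approx (M.app f (M.app s n)) j)
    have t₃ := abs_sub_le (approx (M.app f (M.app Y u)) K) (approx (M.app f (M.app Y u)) j)
      (approx (M.app f (M.app s n)) j)
    rw [abs_sub_comm] at h₁
    linarith

/-- The reverse inequality, up to an error `half m` of any chosen size. -/
theorem le_of_not_near {x y : M.El .one} {k : M.El .nat} (h : ¬ Near x y k) (m : M.El .nat) :
    ∀ᶠ n in atTop, half k ≤ |approx x n - approx y n| + half m := by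
  filter_upwards [eventually_ge_atTop (m + 1 + 1)] with n hn
  obtain ⟨i, rfl⟩ := exists_eq_add_one_of_pos
    (lt_of_lt_of_le (zero_le.trans_lt (lt_add_one (m + 1))) hn)
  have h₁ := not_lt.1 (not_exists.1 h i)
  have h₂ := half_antitone (le_of_add_le_add_right hn)
  rw [half_add_one] at h₂
  linarith

/-- Sequential continuity in the absence of `∃²`. -/
theorem exists_near_of_not_hasE2 (hE : ¬ M.HasE2) (hf : IsFun f) (hx : IsReal x)
    (hs : ∀ n, IsReal (M.app s n)) (hn : ∀ n, Near x (M.app s n) n) (k : M.El .nat) :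
    ∃ n, Near (M.app f x) (M.app f (M.app s n)) k := by
  by_contra! h
  refine hE (hasE2_of_sequence hf hx hs hn (k + 1) fun n => ?_)
  filter_upwards [le_of_not_near (h n) (k + 1)] with j hj
  rw [half_add_one] at *
  linarith

/-- In the absence of `∃²`, all functions on the reals are continuous. -/
theorem cts_of_not_hasE2 (hE : ¬ M.HasE2) (hf : IsFun f) : Cts f := by
  by_contra hc
  simp only [Cts, not_forall, not_exists] at hc
  obtain ⟨x, hx, k, h⟩ := hc
  obtain ⟨K, hK⟩ : ∃ K, K = k + 1 + 1 + 1 + 1 := ⟨_, rfl⟩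
  have hK' : half K = half k / 16 := by
    rw [hK]; simp only [half_add_one]; ring
  have hk' := half_pos k
  have half_two (j : M.El .nat) : half (j + 1 + 1) = half j / 4 := by
    rw [half_add_one, half_add_one]; ring
  have half_three (j : M.El .nat) : half (j + 1 + 1 + 1) = half j / 8 := by
    rw [half_add_one, half_two]; ring
  -- The choice scheme selects numbers only, so a bad real `y` near `x` is replaced by a bad
  -- rational. Sequential continuity at `y`, along the entries of `y`, makes the value at the
  -- rational close to `f y`.
  have key (N : M.El .nat) : ∃ p, |approx x (N + 1 + 1 + 1) - val p| < half (N + 1) ∧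
      half (k + 1 + 1) < |approx (M.app f x) K - approx (M.app f (ratR p)) K| := by
    obtain ⟨y, hy, hxy, hfy⟩ := h (N + 1 + 1 + 1)
    let s : M.El (.nat ⇢ .one) := M.eval M.self (fn .nat fun n =>
      ofRat (.var (.old y) ⬝ plus n (.var (.old (N + 1 + 1 + 1)))))
    have hs (n : M.El .nat) : M.app s n = ratR (M.app y (n + (N + 1 + 1 + 1))) :=
      ext fun i => by simp [s, ratR, ofRat]
    obtain ⟨n, hn⟩ := exists_near_of_not_hasE2 hE hf hy (s := s)
      (fun n => by rw [hs]; exact isReal_ratR _) (fun n => by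
        rw [hs]
        refine near_of_eventually hy (isReal_ratR _) ?_
        filter_upwards [hy.eventually (n + (N + 1 + 1 + 1))] with j hj
        rw [approx_ratR, abs_sub_comm]
        refine hj.le.trans (half_antitone ?_)
        gcongr
        exact le_add_self) (k + 1 + 1)
    rw [hs] at hn
    refine ⟨M.app y (n + (N + 1 + 1 + 1)), ?_, ?_⟩
    · obtain ⟨j, h₁, h₂, h₃⟩ := ((hx.eventually (N + 1 + 1 + 1)).and
        ((hxy.eventually hx hy).and (hy.eventually (n + (N + 1 + 1 + 1))))).exists
      have h₃' := h₃.trans_le (half_antitone (le_add_self : N + 1 + 1 + 1 ≤ n + (N + 1 + 1 + 1)))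
      have t₁ := abs_sub_le (approx x (N + 1 + 1 + 1)) (approx x j)
        (approx y (n + (N + 1 + 1 + 1)))
      have t₂ := abs_sub_le (approx x j) (approx y j) (approx y (n + (N + 1 + 1 + 1)))
      rw [abs_sub_comm] at h₃'
      rw [half_three] at h₁ h₂ h₃'
      rw [half_add_one]
      have := half_pos N
      change |_ - approx y (n + (N + 1 + 1 + 1))| < _
      linarith
    · have hr := isReal_ratR (M.app y (n + (N + 1 + 1 + 1)))
      generalize ratR (M.app y (n + (N + 1 + 1 + 1))) = r at *
      obtain ⟨j, h₁, h₂, h₃, h₄⟩ := ((le_of_not_near hfy (k + 1 + 1)).and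
        ((hn.eventually (hf.1 _ hy) (hf.1 _ hr)).and (((hf.1 _ hx).eventually K).and
          ((hf.1 _ hr).eventually K)))).exists
      rw [half_two] at *
      have t₁ := abs_sub_le (approx (M.app f x) j) (approx (M.app f r) j) (approx (M.app f y) j)
      have t₂ := abs_sub_le (approx (M.app f x) j) (approx (M.app f x) K) (approx (M.app f r) j)
      have t₃ := abs_sub_le (approx (M.app f x) K) (approx (M.app f r) K) (approx (M.app f r) j)
      rw [abs_sub_comm] at h₂ h₃
      linarith
  -- Comparing approximations at fixed indices makes the formula quantifier-free. Choice is over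
  -- type `1`, so `N` is passed as the value at `0` of a function.
  let A : Formula (Ctx.Ext (Ctx.Ext M.El .one) .nat) :=
    qlt (qabs (qadd (.var (.old (.old x)) ⬝ RCAomega.succ (RCAomega.succ (RCAomega.succ
      (.var (.old .new) ⬝ zero)))) (qopp (.var .new))))
      (qhalf (RCAomega.succ (.var (.old .new) ⬝ zero))) ⋏
    qlt (qhalf (.var (.old (.old (k + 1 + 1)))))
      (qabs (qadd (.var (.old (.old (M.app f x))) ⬝ .var (.old (.old K)))
        (qopp (.var (.old (.old f)) ⬝ ofRat (.var .new) ⬝ .var (.old (.old K))))))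
  have hA (v : M.El .one) (p : M.El .nat) : M.Sat (M.cons p (M.cons v M.self)) A ↔
      |approx x (M.app v 0 + 1 + 1 + 1) - val p| < half (M.app v 0 + 1) ∧
      half (k + 1 + 1) < |approx (M.app f x) K - approx (M.app f (ratR p)) K| := by
    have : M.eval (M.cons p (M.cons v M.self)) (ofRat (.var .new)) = ratR p :=
      ext fun i => by simp [ratR, ofRat]
    simp only [A, sat_and, sat_qlt, val_eval_qhalf, val_eval_qabs, val_eval_qadd,
      val_eval_qopp, eval_app, eval_var, cons_old, cons_new, self_apply, sub_eq_add_neg, approx,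
      this, eval_succ, eval_zero, succ_eq]
  obtain ⟨Y, hY⟩ := exists_choice (A := A) ⟨⟨trivial, trivial, trivial⟩, trivial⟩
    fun v => (key (M.app v 0)).imp fun p hp => (hA v p).2 hp
  -- Feeding constant functions to the choice functional gives a sequence of rationals converging to
  -- `x`, against which Grilliot's trick applies.
  let s : M.El (.nat ⇢ .one) := M.eval M.self (fn .nat fun n =>
    ofRat (.var (.old Y) ⬝ (fn .nat fun _ => Term.wk .nat n)))
  have hs (n : M.El .nat) : ∃ p, M.app s n = ratR p ∧
      |approx x (n + 1 + 1 + 1) - val p| < half (n + 1) ∧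
      half (k + 1 + 1) < |approx (M.app f x) K - approx (M.app f (ratR p)) K| := by
    let v : M.El .one := M.eval (M.cons n M.self) (fn .nat fun _ => Term.wk .nat (.var .new))
    have hv : M.app v 0 = n := by simp [v]
    refine ⟨M.app Y v, ext fun i => ?_, ?_⟩
    · simp [s, ratR, ofRat, v]
    · have := (hA _ _).1 (hY v)
      rwa [hv] at this
  refine hE (hasE2_of_sequence hf hx (s := s) ?_ ?_ (k + 1 + 1 + 1) ?_)
  · intro n
    obtain ⟨p, hp, -⟩ := hs n
    rw [hp]
    exact isReal_ratR p
  · intro n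
    obtain ⟨p, hp, h₁, -⟩ := hs n
    rw [hp]
    refine (near_iff hx (isReal_ratR p)).2 ⟨n + 1 + 1, ?_⟩
    filter_upwards [hx.eventually (n + 1 + 1 + 1)] with j hj
    have t := abs_sub_le (approx x j) (approx x (n + 1 + 1 + 1)) (val p)
    rw [abs_sub_comm] at hj
    have := half_pos n
    rw [half_three] at hj
    rw [half_add_one] at h₁
    rw [approx_ratR, half_two]
    linarith
  · intro n
    obtain ⟨p, hp, -, h₂⟩ := hs n
    rw [hp]
    filter_upwards [(hf.1 _ hx).eventually K, (hf.1 _ (isReal_ratR p)).eventually K] with j h₃ h₄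
    have t₂ := abs_sub_le (approx (M.app f x) K) (approx (M.app f x) j)
      (approx (M.app f (ratR p)) K)
    have t₃ := abs_sub_le (approx (M.app f x) j) (approx (M.app f (ratR p)) j)
      (approx (M.app f (ratR p)) K)
    rw [half_two] at h₂
    rw [half_three]
    rw [abs_sub_comm] at h₄
    linarith

end Grilliot

end Str

namespace Str

open Filter

variable {M : Str} [M.IsModel] {V : Ctx}

/-! ### Parity -/

section Parity

variable (M) in
/-- The parity function. -/
def parity : M.El .one :=
  M.eval M.self (fn .nat fun n => RCAomega.recur
    (fn .nat fun _ => fn .nat fun r => RCAomega.monus (RCAomega.succ zero) r) zero n)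

/-- Even numbers. -/
def IsEven (n : M.El .nat) : Prop := M.app M.parity n = 0

theorem parity_add_one (n : M.El .nat) : M.app M.parity (n + 1) = 1 - M.app M.parity n := by
  rw [← succ_eq]
  simp only [parity, eval_fn, eval_recur, eval_var, cons_new, recur_succ, eval_monus, eval_succ,
    eval_zero]
  rw [recur_congr, one_eq]
  intro a b
  simp only [eval_fn, eval_monus, eval_succ, eval_zero, eval_var, cons_new]

theorem isEven_zero : IsEven (0 : M.El .nat) := by
  simp [IsEven, parity]

theorem isEven_add_one (n : M.El .nat) : IsEven (n + 1) ↔ ¬ IsEven n := by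
  rw [IsEven, parity_add_one, ← le_def]
  constructor
  · intro h h'
    rw [IsEven] at h'
    rw [h'] at h
    exact not_lt.2 h one_pos
  · exact fun h => one_le_of_pos (pos_iff_ne_zero.2 h)

theorem QF.isEven {F : M.El .nat → M.El .nat} (hF : M.Internal F) : M.QF fun n => IsEven (F n) :=
  .eq (by fun_prop) (by fun_prop)

theorem QF.iff {P Q : M.El .nat → Prop} (hP : M.QF P) (hQ : M.QF Q) : M.QF fun n => P n ↔ Q n := by
  simpa only [iff_iff_implies_and_implies] using (hP.imp hQ).and (hQ.imp hP)

/-- Parity is given by the recursor and not by the existence of a half, so its laws fall under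
quantifier-free induction. -/
theorem isEven_add (m n : M.El .nat) : IsEven (m + n) ↔ (IsEven m ↔ IsEven n) := by
  refine induction (P := fun n => IsEven (m + n) ↔ (IsEven m ↔ IsEven n))
    (.iff (.isEven (by fun_prop)) (.iff (.isEven (by fun_prop)) (.isEven (by fun_prop)))) ?_ ?_ n
  · simp [isEven_zero]
  · intro n h
    rw [← add_assoc, isEven_add_one, isEven_add_one, h]
    tauto

theorem isEven_add_self (n : M.El .nat) : IsEven (n + n) := by
  simp [isEven_add]

theorem not_isEven_mul {m : M.El .nat} (hm : ¬ IsEven m) (n : M.El .nat) :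
    IsEven (m * n) ↔ IsEven n := by
  refine induction (P := fun n => IsEven (m * n) ↔ IsEven n)
    (.iff (.isEven (by fun_prop)) (.isEven (by fun_prop))) (by simp) ?_ n
  intro n h
  rw [mul_add, mul_one, isEven_add, isEven_add_one, h]
  tauto

theorem isEven_mul_pow2 (m n : M.El .nat) : IsEven (m * M.pow2 (n + 1)) := by
  rw [pow2_add_one, mul_add]
  exact isEven_add_self _

end Parity

/-! ### A dense set of reals with dense complement -/

section OddFractions

/-- The reals that are fractions with an odd denominator. -/
def IsOddFraction (x : M.El .one) : Prop := ∃ p, IsEven (M.snd p) ∧ EqR x (ratR p)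

theorem eqR_ratR {p q : M.El .nat} : EqR (ratR p) (ratR q) ↔ val p = val q := by
  rw [eqR_iff (isReal_ratR p) (isReal_ratR q)]
  simp only [approx_ratR, eventually_const]
  constructor
  · intro h
    by_contra hne
    obtain ⟨k, hk⟩ := exists_half_lt (abs_pos.2 (sub_ne_zero.2 hne))
    exact lt_asymm hk (h k)
  · intro h k
    rw [h, sub_self, abs_zero]
    exact half_pos k

theorem IsOddFraction.congr {x y : M.El .one} (hx : IsReal x) (hy : IsReal y) (h : EqR x y)
    (hxo : IsOddFraction x) : IsOddFraction y := by
  obtain ⟨p, hp, hxp⟩ := hxo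
  exact ⟨p, hp, h.symm.trans hy hx (isReal_ratR p) hxp⟩

/-- The fraction `(a - b) / (d + 1)` is approximated by `(a - b) * t / ((d + 1) * t + 1)` for a
large power `t` of two, whose denominator is odd. -/
theorem exists_near_isOddFraction {x : M.El .one} (hx : IsReal x) (k : M.El .nat) :
    ∃ z, IsReal z ∧ Near x z k ∧ IsOddFraction z := by
  set c := M.app x (k + 1 + 1) with hc
  set a := M.fst (M.fst c) with ha
  set b := M.snd (M.fst c) with hb
  set d := M.snd c with hd
  have hv : approx x (k + 1 + 1) = (Frac.of a - Frac.of b) / (Frac.of d + 1) := rfl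
  -- The error is at most `|a - b| / t`, and `|a - b| < 2 ^ (a + b)`; the remaining factor `2 ^ (k +
  -- 2)` brings it below `half (k + 2)`.
  obtain ⟨t, ht⟩ : ∃ t, t = M.pow2 (a + b + (k + 1) + 1) := ⟨_, rfl⟩
  have ht' : Frac.of t = Frac.of (M.pow2 (a + b)) * (half (k + 1 + 1))⁻¹ := by
    rw [ht, add_assoc (a + b), pow2_add, map_mul, half, inv_inv]
  have ht0 : 0 < Frac.of t := by
    have := half_pos (a + b + (k + 1) + 1)
    rwa [half, inv_pos, ← ht] at this
  have hd0 : 0 < Frac.of d + 1 := of_add_one_pos d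
  have hdt : 0 < (Frac.of d + 1) * Frac.of t := mul_pos hd0 ht0
  let p := pair (pair (a * t) (b * t)) ((d + 1) * t)
  have hp : val p = (Frac.of a - Frac.of b) * Frac.of t / ((Frac.of d + 1) * Frac.of t + 1) := by
    simp only [p, val_pair, map_mul, map_add, map_one]
    ring
  have hdiff : approx x (k + 1 + 1) - val p =
      (Frac.of a - Frac.of b) / ((Frac.of d + 1) * ((Frac.of d + 1) * Frac.of t + 1)) := by
    rw [hv, hp]
    field_simp
    ring
  have hab : |Frac.of a - Frac.of b| < Frac.of (M.pow2 (a + b)) := by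
    have h₁ : |Frac.of a - Frac.of b| ≤ Frac.of (a + b) := by
      have := Frac.of_nonneg a
      have := Frac.of_nonneg b
      rw [map_add, abs_le]
      constructor <;> linarith
    exact h₁.trans_lt (Frac.of_strictMono (lt_pow2 _))
  have hbound : |approx x (k + 1 + 1) - val p| < half (k + 1 + 1) := by
    have h₁ : 0 < (Frac.of d + 1) * ((Frac.of d + 1) * Frac.of t + 1) := by positivity
    rw [hdiff, abs_div, abs_of_pos h₁, div_lt_iff₀ h₁]
    have hh := half_pos (k + 1 + 1)
    have h₂ : half (k + 1 + 1) * Frac.of t = Frac.of (M.pow2 (a + b)) := by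
      rw [ht']
      field_simp
    have h₃ : Frac.of t ≤ (Frac.of d + 1) * ((Frac.of d + 1) * Frac.of t + 1) := by
      have := Frac.of_nonneg d
      have h₄ : Frac.of t ≤ (Frac.of d + 1) * Frac.of t + 1 := by nlinarith
      have h₅ : 0 ≤ Frac.of d * ((Frac.of d + 1) * Frac.of t + 1) := by positivity
      linarith
    calc _ < _ := hab
      _ = half (k + 1 + 1) * Frac.of t := h₂.symm
      _ ≤ _ := mul_le_mul_of_nonneg_left h₃ hh.le
  refine ⟨ratR p, isReal_ratR p, ?_, p, ?_, .refl _⟩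
  · refine near_of_eventually hx (isReal_ratR p) ?_
    filter_upwards [hx.eventually (k + 1 + 1)] with j hj
    rw [approx_ratR]
    rw [half_add_one (k + 1), abs_lt] at *
    rw [abs_le]
    constructor <;> linarith
  · simp only [p, snd_pair, ht]
    exact isEven_mul_pow2 _ _

/-- Clearing denominators gives odd plus even equal to even: the product of the two odd denominators
is the only term without a factor `2 ^ (k + 1)`. -/
theorem val_add_half_ne {p q : M.El .nat} (hp : IsEven (M.snd p)) (hq : IsEven (M.snd q))
    (k : M.El .nat) : val q ≠ val p + half (k + 1) := by
  intro h
  set a := M.fst (M.fst p)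
  set b := M.snd (M.fst p)
  set d := M.snd p
  set a' := M.fst (M.fst q)
  set b' := M.snd (M.fst q)
  set d' := M.snd q
  have e₁ : val p = (Frac.of a - Frac.of b) / (Frac.of d + 1) := rfl
  have e₂ : val q = (Frac.of a' - Frac.of b') / (Frac.of d' + 1) := rfl
  have h₁ := (of_add_one_pos d).ne'
  have h₂ := (of_add_one_pos d').ne'
  have h₃ : Frac.of (M.pow2 (k + 1)) ≠ 0 := Frac.of_ne_zero (pow2_pos _).ne'
  have key : (d + 1) * (d' + 1) + (b' * (d + 1) + a * (d' + 1)) * M.pow2 (k + 1) =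
      (a' * (d + 1) + b * (d' + 1)) * M.pow2 (k + 1) := by
    apply Frac.of_injective
    rw [e₁, e₂, half] at h
    field_simp at h
    simp only [map_add, map_mul, map_one]
    linear_combination -h
  have := isEven_mul_pow2 (a' * (d + 1) + b * (d' + 1)) k
  rw [← key, isEven_add, not_isEven_mul (by rw [isEven_add_one]; exact not_not.2 hp),
    isEven_add_one] at this
  exact (this.2 (isEven_mul_pow2 _ k)) hq

/-- An approximation of `x` that happens to be an odd fraction is shifted by a small power of `1 /
2`. Using odd fractions instead of all rationals keeps even the complement within reach of rational
points. -/
theorem exists_near_not_isOddFraction {x : M.El .one} (hx : IsReal x) (k : M.El .nat) :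
    ∃ z, IsReal z ∧ Near x z k ∧ ¬ IsOddFraction z := by
  have near_of_val {p : M.El .nat} (hp : |approx x (k + 1 + 1) - val p| ≤ half (k + 1 + 1)) :
      Near x (ratR p) k := by
    refine near_of_eventually hx (isReal_ratR p) ?_
    filter_upwards [hx.eventually (k + 1 + 1)] with j hj
    have t := abs_sub_le (approx x j) (approx x (k + 1 + 1)) (val p)
    rw [abs_sub_comm] at hj
    rw [approx_ratR]
    rw [half_add_one (k + 1)] at *
    linarith
  by_cases h : IsOddFraction (ratR (M.app x (k + 1 + 1)))
  swap
  · refine ⟨_, isReal_ratR _, near_of_val ?_, h⟩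
    change |approx x _ - approx x _| ≤ _
    rw [sub_self, abs_zero]
    exact (half_pos _).le
  obtain ⟨p, hp, hxp⟩ := h
  have hxp' : approx x (k + 1 + 1) = val p := eqR_ratR.1 hxp
  obtain ⟨q, hq⟩ := exists_val (val p + half (k + 1 + 1))
  refine ⟨ratR q, isReal_ratR q, near_of_val ?_, ?_⟩
  · rw [hxp', hq, sub_add_cancel_left, abs_neg, abs_of_pos (half_pos _)]
  · rintro ⟨r, hr, hqr⟩
    exact val_add_half_ne hp hr (k + 1) ((eqR_ratR.1 hqr).symm.trans hq)

/-- Two nested uses of `∃²`: the inner one decides whether `x` equals the rational coded by `p`, a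
universal statement over indices, and the outer one searches for `p`. -/
theorem exists_decision (hE : M.HasE2) :
    ∃ S : M.El (.one ⇢ .nat), ∀ x, M.app S x = 0 ↔ IsOddFraction x := by
  obtain ⟨E, hE⟩ := hE
  let S : M.El (.one ⇢ .nat) := M.eval M.self (fn .one fun x =>
    .var (.old E) ⬝ fn .nat fun p =>
      cond (.var (.old (.old E)) ⬝ fn .nat fun n =>
          qltTerm (qadd (qhalf n) (qhalf n))
            (qabs (qadd (Term.wk .nat (Term.wk .nat x) ⬝ n) (qopp (Term.wk .nat p)))))
        (RCAomega.succ zero)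
        (.var (.old (.old M.parity)) ⬝ RCAomega.snd p))
  refine ⟨S, fun x => ?_⟩
  simp only [S, eval_fn, eval_app, eval_var, cons_old, self_apply, hE, IsOddFraction]
  refine exists_congr fun p => ?_
  have hiff : EqR x (ratR p) ↔
      ¬ ∃ n, half n + half n < |val (M.app x n) + -val p| := by
    simp only [EqR, approx_ratR, not_exists, not_lt]
    simp only [approx, sub_eq_add_neg]
  rw [hiff, eval_cond]
  split_ifs with h <;> rw [eval_app, eval_var, cons_old, cons_old, self_apply, hE] at h <;>
    simp only [eval_fn, eval_qltTerm, val_eval_qadd, val_eval_qhalf, val_eval_qabs, val_eval_qopp,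
      eval_app, eval_wk, eval_var, cons_new] at h
  · exact iff_of_false (succ_ne_zero 0) fun h' => h'.2 h
  · rw [eval_app, eval_var, cons_old, cons_old, self_apply, eval_snd, eval_var, cons_new]
    exact ⟨fun h' => ⟨h', h⟩, And.left⟩

end OddFractions

/-! ### Sums of graph continuous functions -/

section Sums

theorem exists_piecewise (S : M.El (.one ⇢ .nat)) (f g : M.El (.one ⇢ .one)) :
    ∃ h : M.El (.one ⇢ .one), ∀ x, M.app h x = if M.app S x = 0 then M.app f x else M.app g x := by
  refine ⟨M.eval M.self (fn .one fun x => fn .nat fun n =>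
    cond (.var (.old (.old S)) ⬝ Term.wk .nat x) (.var (.old (.old f)) ⬝ Term.wk .nat x ⬝ n)
      (.var (.old (.old g)) ⬝ Term.wk .nat x ⬝ n)), fun x => ext fun n => ?_⟩
  simp only [eval_fn, eval_cond, eval_app, eval_wk, eval_var, cons_old, cons_new, self_apply]
  split_ifs <;> rfl

variable {f g Z : M.El (.one ⇢ .one)}

/-- Invariance of `D` under equality of reals ensures that equal arguments fall into the same case.
-/
theorem isFun_piecewise {h : M.El (.one ⇢ .one)} (hf : IsFun f) (hg : IsFun g)
    {D : M.El .one → Prop} (hD : ∀ x y, IsReal x → IsReal y → EqR x y → D x → D y)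
    (h₁ : ∀ x, D x → M.app h x = M.app f x) (h₂ : ∀ x, ¬ D x → M.app h x = M.app g x) :
    IsFun h := by
  constructor
  · intro x hx
    by_cases hd : D x
    · rw [h₁ x hd]
      exact hf.1 x hx
    · rw [h₂ x hd]
      exact hg.1 x hx
  · intro x hx y hy hxy
    by_cases hd : D x
    · rw [h₁ x hd, h₁ y (hD x y hx hy hxy hd)]
      exact hf.2 x hx y hy hxy
    · rw [h₂ x hd, h₂ y fun hd' => hd (hD y x hy hx hxy.symm hd')]
      exact hg.2 x hx y hy hxy

theorem val_zero : val (0 : M.El .nat) = 0 := by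
  have h₁ : M.snd 0 = 0 := by simp [Str.snd, Str.zero_sub]
  have h₂ : M.fst 0 = 0 := by rw [Str.fst, h₁, triRoot_zero, Str.zero_sub]
  simp [val, h₁, h₂]

theorem eqR_addR_zero {x : M.El .one} (hx : IsReal x) : EqR x (addR x (ratR 0)) := by
  intro n
  have := half_pos n
  rw [approx_addR, approx_ratR, val_zero, add_zero]
  linarith [hx.abs_lt (le_self_add : n ≤ n + 1)]

theorem eqR_zero_addR {x : M.El .one} (hx : IsReal x) : EqR x (addR (ratR 0) x) := by
  intro n
  have := half_pos n
  rw [approx_addR, approx_ratR, val_zero, zero_add]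
  linarith [hx.abs_lt (le_self_add : n ≤ n + 1)]

theorem exists_sum (hf : IsFun f) :
    ∃ g, IsFun g ∧ ∃ h, IsFun h ∧ GraphCts g ∧ GraphCts h ∧ IsSum f g h := by
  obtain ⟨Z, hZ⟩ : ∃ Z : M.El (.one ⇢ .one), ∀ x, M.app Z x = ratR 0 :=
    ⟨M.eval M.self (fn .one fun _ => .var (.old (ratR 0))), fun x => by simp⟩
  have hZf : IsFun Z := by
    constructor
    · intro x _
      rw [hZ]
      exact isReal_ratR 0
    · intro x _ y _ _
      rw [hZ, hZ]
      exact .refl _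
  have hZc : Cts Z := by
    intro x _ k
    refine ⟨0, fun y _ _ => ?_⟩
    rw [hZ, hZ]
    exact near_self (isReal_ratR 0)
  -- The model is classical, so it may be split on `∃²` although the theory decides neither case.
  by_cases hE : M.HasE2
  swap
  · refine ⟨f, hf, Z, hZf, (cts_of_not_hasE2 hE hf).graphCts hf, hZc.graphCts hZf, fun x hx => ?_⟩
    rw [hZ]
    exact eqR_addR_zero (hf.1 x hx)
  obtain ⟨S, hS⟩ := exists_decision hE
  obtain ⟨g, hg⟩ := exists_piecewise S Z f
  obtain ⟨h, hh⟩ := exists_piecewise S f Z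
  have hg₁ (x : M.El .one) (hx : IsOddFraction x) : M.app g x = M.app Z x := by
    rw [hg, if_pos ((hS x).2 hx)]
  have hg₂ (x : M.El .one) (hx : ¬ IsOddFraction x) : M.app g x = M.app f x := by
    rw [hg, if_neg fun h => hx ((hS x).1 h)]
  have hh₁ (x : M.El .one) (hx : IsOddFraction x) : M.app h x = M.app f x := by
    rw [hh, if_pos ((hS x).2 hx)]
  have hh₂ (x : M.El .one) (hx : ¬ IsOddFraction x) : M.app h x = M.app Z x := by
    rw [hh, if_neg fun h => hx ((hS x).1 h)]
  have hcongr (x y : M.El .one) (hx : IsReal x) (hy : IsReal y) (h : EqR x y)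
      (hxo : IsOddFraction x) : IsOddFraction y := hxo.congr hx hy h
  have hgf := isFun_piecewise hZf hf hcongr hg₁ hg₂
  have hhf := isFun_piecewise hf hZf hcongr hh₁ hh₂
  refine ⟨g, hgf, h, hhf, graphCts_of_dense hZf hZc fun x hx k => ?_,
    graphCts_of_dense hZf hZc fun x hx k => ?_, fun x hx => ?_⟩
  · obtain ⟨z, hz, hxz, ho⟩ := exists_near_isOddFraction hx k
    exact ⟨z, hz, hxz, by rw [hg₁ z ho]; exact .refl _⟩
  · obtain ⟨z, hz, hxz, ho⟩ := exists_near_not_isOddFraction hx k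
    exact ⟨z, hz, hxz, by rw [hh₂ z ho]; exact .refl _⟩
  · by_cases ho : IsOddFraction x
    · rw [hg₁ x ho, hh₁ x ho, hZ]
      exact eqR_zero_addR (hf.1 x hx)
    · rw [hg₂ x ho, hh₂ x ho, hZ]
      exact eqR_addR_zero (hf.1 x hx)

end Sums

end Str

theorem provable_sumOfGraphContinuous : Provable sumOfGraphContinuous :=
  provable_of_sat fun M _ ρ => by
    simp only [sumOfGraphContinuous, Str.sat_forAllFun, Str.sat_existsFun, Str.sat_and,
      Str.sat_graphContinuous, Str.sat_isSum, Str.eval_wk, Str.eval_var, Str.cons_new]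
    exact fun f hf => Str.exists_sum hf

end RCAomega

theorem theorem2p6 :
    RCAomega.Provable RCAomega.sumOfGraphContinuous ∧
      RCAomega.Provable RCAomega.decompositionOfContinuity :=
  ⟨RCAomega.provable_sumOfGraphContinuous, RCAomega.provable_decompositionOfContinuity⟩
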